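/- **Setting.** A join-ordering instance on $n\ge 2$ relations $[n]$ is a query graph $G$ on $[n]$ (arbitrary, possibly cyclic or complete) and a join cardinality function $c$ from sets of relations to $\mathbb N$. A join tree is a (bushy) binary tree whose leaves are distinct relations and in which every inner node joins two subtrees linked by an edge of $G$ (for complete $G$ this allows all cross products). Its cost $C_{\mathrm{out}}$ is the sum, over its inner nodes, of $c$ of the set of relations below the node. For $S\subseteq[n]$ let $\mathrm{OPT}(S)\in\mathbb N\cup\{\infty\}$ be the least $C_{\mathrm{out}}$ of a join tree with leaf set $S$ ($\infty$ if there is none). Call $S$ joinable if $|S|\ge 2$ and $G[S]$ is connected, and let $W$ be the largest $c(S)$ over joinable $S$ (put $W=1$ if this is $0$ or there is no joinable $S$). **Method.** For $f,g:2^{[n]}\to\mathbb N\cup\{\infty\}$ embed values as $v\mapsto x^v$, $\infty\mapsto 0$ in $\mathbb Z[x]$; let $\hat f_d(S)=\sum_{T\subseteq S,\,|T|=d}x^{f(T)}$, and let $\mathrm{FSC}_r(f,g)(S)$ be the smallest exponent (with $\infty$ for the zero polynomial) of $$\sum_{T\subseteq S}(-1)^{|S\setminus T|}\sum_{d=0}^{r}\hat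 f_d(T)\,\hat g_{r-d}(T).$$ DPconv starts with $\mathrm{DP}(S)=0$ for $|S|=1$ and $\mathrm{DP}(S)=\infty$ otherwise; then, for $k=2,\dots,n$, it sets $\mathrm{DP}(S)\leftarrow \mathrm{FSC}_k(\mathrm{DP},\mathrm{DP})(S)+c(S)$ for all joinable $S$ with $|S|=k$, and leaves $\mathrm{DP}(S)=\infty$ for the non-joinable $S$ with $|S|=k$. **Theorem.** 1. For all $n$, $f,g$ and $S\subseteq[n]$: $\mathrm{FSC}_{|S|}(f,g)(S)=\min_{T\subseteq S}\big(f(T)+g(S\setminus T)\big)$. 2. At the end of DPconv, $\mathrm{DP}(S)=\mathrm{OPT}(S)$ for every $S\subseteq[n]$. 3. There are one program for the word RAM (words of $O(n+\log W)$ bits; unit-cost addition, truncated subtraction, multiplication, integer division and remainder, comparison, indirect addressing) and a constant $C$ such that on every instance with $n\ge 2$, given as $n$, the adjacency matrix of $G$ and the table of the $c(S)$ for joinable $S$ (with $0$ entered at the other $S$), the program outputs $\mathrm{OPT}([n])$ together with an optimal join tree (or reports that there is no join tree), within $$C\cdot 2^n n^2\cdot Wn\log(Wn)$$ steps. Consequently,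 on instances with $W\le K n^{q}$ for constants $K,q$, the same program runs in time $\widetilde O(2^n)$, that is, $2^n n^{O(1)}$. -/

import Mathlib

namespace DPconv

/-! ### Queries, join trees, the cost function `C_out` -/

/-- A join-ordering instance on relations `R_0, …, R_{n-1}`: the query graph, whose edges are the
join predicates, and the join cardinality function on sets of relations. -/
structure Query (n : ℕ) where
  graph : SimpleGraph (Fin n)
  card : Finset (Fin n) → ℕ

/-- Binary (bushy) join trees: leaves are relations, inner nodes are joins. -/
inductive JoinTree (n : ℕ) where
  | leaf (i : Fin n) : JoinTree n
  | join (l r : JoinTree n) : JoinTree n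

namespace JoinTree

variable {n : ℕ}

/-- The set of relations spanned by a join tree. -/
def rels : JoinTree n → Finset (Fin n)
  | leaf i => {i}
  | join l r => l.rels ∪ r.rels

/-- Every relation is used at most once, and every inner node joins two subtrees that are linked
by a join edge (no cross products). For the complete query graph the second condition is void, so
this case allows all cross products. -/
def Valid (G : SimpleGraph (Fin n)) : JoinTree n → Prop
  | leaf _ => True
  | join l r => l.Valid G ∧ r.Valid G ∧ Disjoint l.rels r.rels ∧
      ∃ u ∈ l.rels, ∃ v ∈ r.rels, G.Adj u v

/-- `C_out`: the sum of the cardinalities of all joins in the tree. -/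
def costOut (c : Finset (Fin n) → ℕ) : JoinTree n → ℕ
  | leaf _ => 0
  | join l r => c (l.rels ∪ r.rels) + l.costOut c + r.costOut c

/-- Prefix (Polish) notation: `0` for a join, `i + 1` for the relation `R_i`. -/
def code : JoinTree n → List ℕ
  | leaf i => [(i : ℕ) + 1]
  | join l r => 0 :: (l.code ++ r.code)

end JoinTree

namespace Query

variable {n : ℕ}

/-- `S` is the result of a join without cross products: it has at least two relations and induces
a connected subgraph of the query graph. -/
def Joinable (Q : Query n) (S : Finset (Fin n)) : Prop :=
  2 ≤ S.card ∧ (Q.graph.induce (S : Set (Fin n))).Connected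

/-- The least `C_out` cost over all join trees for `S` (`⊤` if there is none). -/
noncomputable def optCost (Q : Query n) (S : Finset (Fin n)) : ℕ∞ :=
  ⨅ T : JoinTree n, ⨅ _ : T.Valid Q.graph ∧ T.rels = S, (T.costOut Q.card : ℕ∞)

open Classical in
/-- The largest join cardinality `W`, replaced by `1` if it is `0`. -/
noncomputable def maxCard (Q : Query n) : ℕ :=
  max 1 ((Finset.univ.filter Q.Joinable).sup Q.card)

open Classical in
/-- The cardinality function with `⊤` at the sets of relations that are not the result of a join. -/
noncomputable def joinCard (Q : Query n) (S : Finset (Fin n)) : ℕ∞ :=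
  if Q.Joinable S then (Q.card S : ℕ∞) else ⊤

end Query

/-! ### Fast subset convolution, the embedding technique, and the `DPconv` recursion -/

section Convolution

variable {n : ℕ} {R : Type*} [CommRing R]

/-- The `(min, +)` subset convolution. -/
noncomputable def minPlusConv (f g : Finset (Fin n) → ℕ∞) (S : Finset (Fin n)) : ℕ∞ :=
  ⨅ T ∈ S.powerset, f T + g (S \ T)

/-- The zeta transform of the slice of rank `r`, i.e. of `f` restricted to the sets of size `r`. -/
def rankedZeta (f : Finset (Fin n) → R) (r : ℕ) (S : Finset (Fin n)) : R :=
  ∑ T ∈ S.powerset with T.card = r, f T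

/-- The slice of rank `r` of the ranked convolution. -/
def rankedConv (f g : Finset (Fin n) → R) (r : ℕ) (S : Finset (Fin n)) : R :=
  ∑ d ∈ Finset.range (r + 1), rankedZeta f d S * rankedZeta g (r - d) S

/-- The Möbius transform, inverse to the zeta transform. -/
def moebius (h : Finset (Fin n) → R) (S : Finset (Fin n)) : R :=
  ∑ T ∈ S.powerset, (-1) ^ (S \ T).card * h T

/-- The layer `r` of the fast subset convolution in the `(+, ·)` ring `R`, to be read at the sets
`S` of size `r`. -/
def fscLayer (f g : Finset (Fin n) → R) (r : ℕ) (S : Finset (Fin n)) : R :=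
  moebius (rankedConv f g r) S

/-- The embedding of a value as the exponent of a monomial; `⊤` becomes the zero polynomial. -/
noncomputable def embed : ℕ∞ → Polynomial ℤ
  | ⊤ => 0
  | (v : ℕ) => Polynomial.X ^ v

/-- The layer `r` of the fast subset convolution in the `(min, +)` semi-ring: embed, convolve in
the ring of polynomials, and read off the smallest exponent (`⊤` for the zero polynomial). -/
noncomputable def fscLayerMinPlus (f g : Finset (Fin n) → ℕ∞) (r : ℕ) (S : Finset (Fin n)) : ℕ∞ :=
  (fscLayer (fun T => embed (f T)) (fun T => embed (g T)) r S).trailingDegree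

/-- The `DP`-table after the layers `2, …, k`. -/
noncomputable def dpTable (Q : Query n) : ℕ → Finset (Fin n) → ℕ∞
  | 0 | 1 => fun S => if S.card = 1 then 0 else ⊤
  | k + 2 => fun S =>
      if S.card = k + 2 then
        fscLayerMinPlus (dpTable Q (k + 1)) (dpTable Q (k + 1)) (k + 2) S + Q.joinCard S
      else dpTable Q (k + 1) S

end Convolution

/-! ### The machine model: a word RAM with a step count -/

namespace RAM

/-- Arithmetic operations; subtraction is truncated at `0`, and division by `0` gives `0`. -/
inductive Op where
  | add | sub | mul | div | mod

def Op.eval : Op → ℕ → ℕ → ℕ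
  | add, a, b => a + b
  | sub, a, b => a - b
  | mul, a, b => a * b
  | div, a, b => a / b
  | mod, a, b => a % b

/-- Programs. The numbers `x y z` are names of registers, `k` is a numeral. -/
inductive Prog where
  | skip : Prog
  | const (x k : ℕ) : Prog
  | arith (o : Op) (x y z : ℕ) : Prog
  | load (x y : ℕ) : Prog
  | store (x y : ℕ) : Prog
  | seq (p q : Prog) : Prog
  | ite (x y : ℕ) (p q : Prog) : Prog
  | while (x y : ℕ) (p : Prog) : Prog

/-- The contents of the registers and of the random access memory. -/
structure State where
  reg : ℕ → ℕ
  mem : ℕ → ℕ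

def State.setReg (s : State) (x v : ℕ) : State :=
  { s with reg := Function.update s.reg x v }

def State.setMem (s : State) (a v : ℕ) : State :=
  { s with mem := Function.update s.mem a v }

/-- `Exec B p s t s'`: on a machine whose words are the numbers below `B`, the program `p`, started
in `s`, halts in `s'` after `t` steps. Each elementary instruction and each test is one step. An
instruction whose result is not a word is a fault: the program then has no execution. -/
inductive Exec (B : ℕ) : Prog → State → ℕ → State → Prop where
  | skip (s : State) : Exec B Prog.skip s 1 s
  /-- `x := k` -/
  | const (s : State) (x k : ℕ) (h : k < B) : Exec B (Prog.const x k) s 1 (s.setReg x k)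
  /-- `x := y o z` -/
  | arith (s : State) (o : Op) (x y z : ℕ) (h : o.eval (s.reg y) (s.reg z) < B) :
      Exec B (Prog.arith o x y z) s 1 (s.setReg x (o.eval (s.reg y) (s.reg z)))
  /-- `x := mem[y]` -/
  | load (s : State) (x y : ℕ) (h : s.mem (s.reg y) < B) :
      Exec B (Prog.load x y) s 1 (s.setReg x (s.mem (s.reg y)))
  /-- `mem[x] := y` -/
  | store (s : State) (x y : ℕ) :
      Exec B (Prog.store x y) s 1 (s.setMem (s.reg x) (s.reg y))
  | seq {p q : Prog} {s s' s'' : State} {t t' : ℕ} (hp : Exec B p s t s')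
      (hq : Exec B q s' t' s'') : Exec B (Prog.seq p q) s (t + t') s''
  /-- `if x < y then p else q` -/
  | iteTrue {x y : ℕ} {p q : Prog} {s s' : State} {t : ℕ} (h : s.reg x < s.reg y)
      (hp : Exec B p s t s') : Exec B (Prog.ite x y p q) s (t + 1) s'
  | iteFalse {x y : ℕ} {p q : Prog} {s s' : State} {t : ℕ} (h : ¬ s.reg x < s.reg y)
      (hq : Exec B q s t s') : Exec B (Prog.ite x y p q) s (t + 1) s'
  /-- `while x < y do p` -/
  | whileTrue {x y : ℕ} {p : Prog} {s s' s'' : State} {t t' : ℕ} (h : s.reg x < s.reg y)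
      (hp : Exec B p s t s') (hw : Exec B (Prog.while x y p) s' t' s'') :
      Exec B (Prog.while x y p) s (t + t' + 1) s''
  | whileFalse {x y : ℕ} {p : Prog} {s : State} (h : ¬ s.reg x < s.reg y) :
      Exec B (Prog.while x y p) s 1 s

end RAM

/-! ### Input, output and running time -/

namespace Query

variable {n : ℕ}

/-- The set of relations with bit mask `m`. -/
def ofMask (n m : ℕ) : Finset (Fin n) :=
  Finset.univ.filter (fun i => m.testBit (i : ℕ) = true)

open Classical in
/-- The input: `n`, the adjacency matrix row by row, and, in the order of the bit masks of the sets
of relations, the table of the join cardinalities (with `0` at the sets that are not the result of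
a join). -/
noncomputable def input (Q : Query n) : List ℕ :=
  n :: ((List.finRange n).flatMap fun i =>
      (List.finRange n).map fun j => if Q.graph.Adj i j then 1 else 0) ++
    (List.range (2 ^ n)).map fun m => if Q.Joinable (ofMask n m) then Q.card (ofMask n m) else 0

/-- The input stands at the beginning of the memory; everything else is `0`. -/
noncomputable def start (Q : Query n) : RAM.State where
  reg := fun _ => 0
  mem := fun a => Q.input.getD a 0

/-- The list `out` stands at the beginning of the memory of `s`. -/
def Holds (s : RAM.State) (out : List ℕ) : Prop :=
  ∀ i, (h : i < out.length) → s.mem i = out[i]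

/-- The output is the flag `1`, the optimal cost and an optimal join tree for all relations, or the
flag `0` if there is no join tree. -/
def IsOutput (Q : Query n) (s : RAM.State) : Prop :=
  (∃ T : JoinTree n, T.Valid Q.graph ∧ T.rels = Finset.univ ∧
      (T.costOut Q.card : ℕ∞) = Q.optCost Finset.univ ∧
      Holds s (1 :: T.costOut Q.card :: T.code)) ∨
    (Q.optCost Finset.univ = ⊤ ∧ Holds s [0])

/-- On a machine with `w`-bit words, the program `p` solves the instance `Q` in at most `τ` steps. -/
def SolvedWithin (Q : Query n) (p : RAM.Prog) (w : ℕ) (τ : ℝ) : Prop :=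
  ∃ (t : ℕ) (s : RAM.State), RAM.Exec (2 ^ w) p Q.start t s ∧ Q.IsOutput s ∧ (t : ℝ) ≤ τ

end Query

end DPconv

/-! ### Ranked subset convolution and the embedding of values as exponents -/

section
open Finset

namespace DPconv
section Conv
variable {n : ℕ} {R : Type*} [CommRing R]

/-! Convolution. A product of ranked zeta transforms expands into a sum over pairs (U, V) of subsets
with |U| + |V| = r, and the Möbius transform keeps the pairs with U ∪ V = S. For r = |S| the size
condition makes such pairs disjoint, so V = S \ U; this is `fscLayer_card`, valid over any
commutative ring. After the embedding every coefficient counts splits of S, so nothing cancels and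
the smallest exponent is the minimum (`fscLayerMinPlus_card`).

Recursion. A tree with at least two leaves splits at its root; conversely, trees for the two parts
of a connected set can always be joined, because some edge crosses the cut. This is Bellman's
equation `Query.optCost_eq`. The empty set has cost ∞, so only proper nonempty subsets contribute,
and working through the layers by cardinality is correct (`dpTable_eq`).

Algorithm. Put m = W n. All finite costs, and all finite sums of the costs of two disjoint parts,
are at most m, so the polynomials in question have degree at most m. The program never stores their
coefficients: it keeps their values at 0, …, m modulo a number N with 2^n < N ≤ 2^(n+1) that is
coprime to m!, and transforms and products act on these values pointwise. To decide whether a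
minimum is at least v, it applies a linear functional to the values. Lagrange interpolation with
denominators cleared provides a functional whose result is m! times the sum of the coefficients
below v (`sum_functional_mul_pow`). That sum is the number of splits of value below v, at most 2^n <
N, so its multiple by m! vanishes modulo N exactly if there is no such split (`decode_eq_zero_iff`).
Bisection on v takes n + 1 such tests of O(m) operations each. A layer costs O(2^n n m) and the
whole computation O(2^n n^2 m), without using the logarithm in the bound.

A suitable N exists by Bertrand's postulate if m ≤ 2^n. If m > 2^n, the dynamic program over all
pairs of masks takes O(4^n n) operations, which stays within the bound because one factor 2^n may be
replaced by m. In both cases a tree is recovered from the table of costs by an exhaustive search for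
an optimal split at each inner node.

Machine. Programs are written for an abstract machine with an input area and a three-dimensional
array. `WP` is a total correctness triple with a time bound, and its rules contain the compilation
to RAM code. `wp_joinOrder` specifies the whole program; `Query.exec_joinOrder` transfers this to
the word RAM. -/

theorem sum_superset_neg_one_pow (A S : Finset (Fin n)) :
    ∑ T ∈ S.powerset, (-1 : R) ^ (S \ T).card * (if A ⊆ T then 1 else 0)
      = if S ⊆ A then (if A ⊆ S then 1 else 0) else 0 := by
  by_cases hAS : A ⊆ S
  -- The term of T in the expanded product is the sign (-1)^|S \ T| if S \ T avoids A, that is A ⊆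
  -- T, and 0 otherwise. The unexpanded product has the factor 1 at points of A and 0 elsewhere.
  · have h := Finset.prod_add (fun _ : Fin n => (1 : R)) (fun i => if i ∈ A then 0 else -1) S
    have h1 : ∏ i ∈ S, ((1 : R) + if i ∈ A then 0 else -1) = if S ⊆ A then 1 else 0 := by
      have : ∀ i ∈ S, ((1 : R) + if i ∈ A then 0 else -1) = if i ∈ A then 1 else 0 := by
        intro i _; split_ifs <;> simp
      rw [Finset.prod_congr rfl this, Finset.prod_ite_zero]
      simp [Finset.subset_iff]
    rw [h1] at h
    simp only [hAS, if_true]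
    rw [h]
    refine Finset.sum_congr rfl fun T hT => ?_
    simp only [Finset.prod_const_one, one_mul]
    have hT := Finset.mem_powerset.1 hT
    by_cases hA : A ⊆ T
    · have : ∀ i ∈ S \ T, (if i ∈ A then (0 : R) else -1) = -1 := by
        intro i hi
        rw [if_neg]
        exact fun h => (Finset.mem_sdiff.1 hi).2 (hA h)
      rw [Finset.prod_congr rfl this]; simp [hA]
    · obtain ⟨i, hiA, hiT⟩ := Finset.not_subset.1 hA
      simp only [hA, if_false, mul_zero]
      symm
      exact Finset.prod_eq_zero (Finset.mem_sdiff.2 ⟨hAS hiA, hiT⟩) (by simp [hiA])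
  · simp only [hAS, if_false, ite_self]
    refine Finset.sum_eq_zero fun T hT => ?_
    rw [if_neg, mul_zero]
    exact fun h => hAS (h.trans (Finset.mem_powerset.1 hT))

theorem rankedConv_eq (f g : Finset (Fin n) → R) (r : ℕ) (S : Finset (Fin n)) :
    rankedConv f g r S = ∑ U ∈ S.powerset, ∑ V ∈ S.powerset,
      if U.card + V.card = r then f U * g V else 0 := by
  unfold rankedConv rankedZeta
  simp only [Finset.sum_filter, Finset.sum_mul_sum]
  rw [Finset.sum_comm]
  refine Finset.sum_congr rfl fun U _ => ?_
  rw [Finset.sum_comm]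
  refine Finset.sum_congr rfl fun V _ => ?_
  by_cases h : U.card + V.card = r
  · rw [if_pos h, Finset.sum_eq_single U.card]
    · simp [show V.card = r - U.card by omega]
    · intro b _ hb; simp [hb.symm]
    · intro h'; simp at h'; omega
  · rw [if_neg h]
    refine Finset.sum_eq_zero fun d hd => ?_
    simp only [Finset.mem_range] at hd
    by_cases h1 : U.card = d
    · rw [if_neg (c := V.card = r - d) (by omega), mul_zero]
    · rw [if_neg h1, zero_mul]

/-- The Möbius sum selects the pairs with U ∪ V = S. Together with |U| + |V| = |S| this forces V = S
\ U, which is why layer r is meaningful only at sets of size r. -/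
theorem fscLayer_card (f g : Finset (Fin n) → R) (S : Finset (Fin n)) :
    fscLayer f g S.card S = ∑ U ∈ S.powerset, f U * g (S \ U) := by
  unfold fscLayer moebius
  have key : ∀ T ∈ S.powerset, (-1 : R) ^ (S \ T).card * rankedConv f g S.card T
      = ∑ U ∈ S.powerset, ∑ V ∈ S.powerset, (if U.card + V.card = S.card then f U * g V else 0) *
          ((-1 : R) ^ (S \ T).card * (if U ∪ V ⊆ T then 1 else 0)) := by
    intro T hT
    have hT := Finset.mem_powerset.1 hT
    rw [rankedConv_eq, Finset.mul_sum]
    have hsub : T.powerset = S.powerset.filter (· ⊆ T) := by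
      ext X; simp only [Finset.mem_powerset, Finset.mem_filter]
      exact ⟨fun h => ⟨h.trans hT, h⟩, fun h => h.2⟩
    rw [hsub, Finset.sum_filter]
    refine Finset.sum_congr rfl fun U _ => ?_
    by_cases hU : U ⊆ T
    · rw [if_pos hU, Finset.sum_filter, Finset.mul_sum]
      refine Finset.sum_congr rfl fun V _ => ?_
      by_cases hV : V ⊆ T
      · simp [hV, hU, Finset.union_subset, mul_comm]
      · simp [hV, Finset.union_subset_iff]
    · rw [if_neg hU]
      symm
      refine Finset.sum_eq_zero fun V _ => ?_
      simp [hU, Finset.union_subset_iff]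
  rw [Finset.sum_congr rfl key, Finset.sum_comm]
  refine Finset.sum_congr rfl fun U hU => ?_
  have hU := Finset.mem_powerset.1 hU
  rw [Finset.sum_comm]
  have key2 : ∀ V ∈ S.powerset, (∑ T ∈ S.powerset,
      (if U.card + V.card = S.card then f U * g V else 0) *
          ((-1 : R) ^ (S \ T).card * (if U ∪ V ⊆ T then 1 else 0)))
      = if V = S \ U then f U * g V else 0 := by
    intro V hV
    have hV := Finset.mem_powerset.1 hV
    rw [← Finset.mul_sum, sum_superset_neg_one_pow, if_pos (Finset.union_subset hU hV)]
    have hc := Finset.card_sdiff_of_subset hU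
    have hc' := Finset.card_le_card hU
    by_cases h : V = S \ U
    · subst h
      rw [if_pos (by omega), if_pos (by rw [Finset.union_sdiff_of_subset hU]), if_pos rfl, mul_one]
    · rw [if_neg h]
      by_cases h1 : U.card + V.card = S.card
      · rw [if_neg (c := S ⊆ U ∪ V), mul_zero]
        intro h2
        have h3 : S \ U ⊆ V := by
          intro x hx
          have := Finset.mem_sdiff.1 hx
          rcases Finset.mem_union.1 (h2 this.1) with h | h
          · exact absurd h this.2
          · exact h
        exact h (Finset.eq_of_subset_of_card_le h3 (by omega)).symm
      · rw [if_neg h1, zero_mul]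
  rw [Finset.sum_congr rfl key2, Finset.sum_ite_eq', if_pos]
  exact Finset.mem_powerset.2 Finset.sdiff_subset

theorem embed_top : embed ⊤ = 0 := rfl

theorem embed_coe (v : ℕ) : embed (v : ℕ∞) = Polynomial.X ^ v := rfl

theorem embed_mul (a b : ℕ∞) : embed a * embed b = embed (a + b) := by
  induction a using ENat.recTopCoe with
  | top => simp [embed_top]
  | coe a =>
    induction b using ENat.recTopCoe with
    | top => simp [embed_top]
    | coe b => rw [embed_coe, embed_coe, ← Nat.cast_add, embed_coe, pow_add]

theorem coeff_embed (a : ℕ∞) (v : ℕ) : (embed a).coeff v = if a = v then 1 else 0 := by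
  induction a using ENat.recTopCoe with
  | top => simp [embed_top]
  | coe a => simp [embed_coe, Polynomial.coeff_X_pow, eq_comm]

/-- Each coefficient is a cardinality, so there is no cancellation and the exponents that occur are
exactly the finite values of `h` on `s`. -/
theorem trailingDegree_sum_embed {ι : Type*} (s : Finset ι) (h : ι → ℕ∞) :
    (∑ U ∈ s, embed (h U)).trailingDegree = ⨅ U ∈ s, h U := by
  have hc : ∀ v, (∑ U ∈ s, embed (h U)).coeff v = ((s.filter fun U => h U = v).card : ℤ) := by
    intro v
    rw [Polynomial.finsetSum_coeff]
    simp [coeff_embed]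
  have hc' : ∀ v, (∑ U ∈ s, embed (h U)).coeff v ≠ 0 ↔ ∃ U ∈ s, h U = v := by
    intro v
    rw [hc, Nat.cast_ne_zero, Finset.card_ne_zero]
    simp [Finset.Nonempty]
  apply le_antisymm
  · refine le_iInf₂ fun U hU => ?_
    rcases eq_or_ne (h U) ⊤ with h1 | h1
    · rw [h1]; exact le_top
    · obtain ⟨v, hv⟩ := ENat.ne_top_iff_exists.1 h1
      rw [← hv]
      exact Polynomial.trailingDegree_le_of_ne_zero ((hc' v).2 ⟨U, hU, hv.symm⟩)
  · rw [Polynomial.trailingDegree]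
    refine Finset.le_min fun v hv => ?_
    obtain ⟨U, hU, hUv⟩ := (hc' v).1 (Polynomial.mem_support_iff.1 hv)
    refine (iInf₂_le U hU).trans ?_
    rw [hUv]; rfl

theorem fscLayerMinPlus_card (f g : Finset (Fin n) → ℕ∞) (S : Finset (Fin n)) :
    fscLayerMinPlus f g S.card S = minPlusConv f g S := by
  unfold fscLayerMinPlus minPlusConv
  rw [fscLayer_card]
  simp only [embed_mul]
  exact trailingDegree_sum_embed _ _

end Conv
end DPconv

end

/-! ### Connectivity, join trees and Bellman's equation -/

section
open Finset

namespace DPconv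

section Connectivity
variable {n : ℕ}

/-- `S` is nonempty and induces a connected subgraph. -/
def Query.Conn (Q : Query n) (S : Finset (Fin n)) : Prop :=
  (Q.graph.induce (S : Set (Fin n))).Connected

theorem Query.joinable_iff (Q : Query n) (S : Finset (Fin n)) :
    Q.Joinable S ↔ 2 ≤ S.card ∧ Q.Conn S := Iff.rfl

theorem Query.Conn.nonempty {Q : Query n} {S : Finset (Fin n)} (h : Q.Conn S) : S.Nonempty := by
  obtain ⟨x⟩ := SimpleGraph.Connected.nonempty h
  exact ⟨x.1, x.2⟩

theorem Query.conn_singleton (Q : Query n) (i : Fin n) : Q.Conn {i} := by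
  unfold Query.Conn
  rw [Finset.coe_singleton]
  have : Nonempty ({i} : Set (Fin n)) := ⟨⟨i, rfl⟩⟩
  exact { preconnected := fun a b => by
            have : a = b := Subsingleton.elim a b
            rw [this]
          nonempty := inferInstance }

theorem Query.conn_of_card_eq_one (Q : Query n) {S : Finset (Fin n)} (h : S.card = 1) :
    Q.Conn S := by
  obtain ⟨i, rfl⟩ := Finset.card_eq_one.1 h
  exact Q.conn_singleton i

theorem Query.Conn.union {Q : Query n} {S T : Finset (Fin n)} (hS : Q.Conn S) (hT : Q.Conn T)
    {u v : Fin n} (hu : u ∈ S) (hv : v ∈ T) (h : Q.graph.Adj u v) : Q.Conn (S ∪ T) := by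
  unfold Query.Conn
  rw [Finset.coe_union]
  exact SimpleGraph.connected_induce_union hS.preconnected hT.preconnected
    (Finset.mem_coe.2 hu) (Finset.mem_coe.2 hv) h

/-- A walk inside S from a point of T to a point of S \ T has to use an edge that leaves T. -/
theorem Query.Conn.exists_adj {Q : Query n} {S T : Finset (Fin n)} (hS : Q.Conn S) (hT : T ⊆ S)
    (h1 : T.Nonempty) (h2 : (S \ T).Nonempty) : ∃ u ∈ T, ∃ v ∈ S \ T, Q.graph.Adj u v := by
  obtain ⟨a, ha⟩ := h1
  obtain ⟨b, hb⟩ := h2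
  obtain ⟨p⟩ := hS.preconnected ⟨a, hT ha⟩ ⟨b, (Finset.mem_sdiff.1 hb).1⟩
  obtain ⟨d, -, h3, h4⟩ := p.exists_boundary_dart {x | x.1 ∈ T} ha (Finset.mem_sdiff.1 hb).2
  exact ⟨d.fst.1, h3, d.snd.1, Finset.mem_sdiff.2 ⟨d.snd.2, h4⟩, d.adj⟩

/-- A finite connected graph with at least two vertices has a vertex whose removal leaves it
connected. This makes connectivity a recursion over subsets, which the machine can tabulate. -/
theorem Query.conn_iff (Q : Query n) {S : Finset (Fin n)} (hS : 2 ≤ S.card) :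
    Q.Conn S ↔ ∃ v ∈ S, Q.Conn (S.erase v) ∧ ∃ u ∈ S, Q.graph.Adj v u := by
  constructor
  · intro h
    have hnt : Nontrivial (S : Set (Fin n)) := by
      obtain ⟨a, ha, b, hb, hab⟩ := Finset.one_lt_card.1 hS
      exact ⟨⟨⟨a, ha⟩, ⟨b, hb⟩, fun h => hab (congrArg Subtype.val h)⟩⟩
    obtain ⟨v, hv⟩ :=
      SimpleGraph.Connected.exists_connected_induce_compl_singleton_of_finite_nontrivial h
    have hc : Q.Conn (S.erase v.1) := by
      unfold Query.Conn
      -- Connectedness passes along a surjective homomorphism, which identifies the iterated induced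
      -- subgraph with the one on `S.erase v`.
      let f : ((Q.graph.induce (S : Set (Fin n))).induce {v}ᶜ) →g
          Q.graph.induce ((S.erase v.1 : Finset (Fin n)) : Set (Fin n)) :=
        { toFun := fun x => ⟨x.1.1, by
            have h1 : x.1 ≠ v := x.2
            have h2 : x.1.1 ≠ v.1 := fun h => h1 (Subtype.ext h)
            have h3 : x.1.1 ∈ S := x.1.2
            simp [h2]⟩
          map_rel' := fun h => h }
      refine hv.map f ?_
      rintro ⟨x, hx⟩
      have hx' := Finset.mem_erase.1 (Finset.mem_coe.1 hx)
      exact ⟨⟨⟨x, hx'.2⟩, fun h => hx'.1 (congrArg Subtype.val h)⟩, rfl⟩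
    have hvS : v.1 ∈ S := v.2
    refine ⟨v.1, hvS, hc, ?_⟩
    obtain ⟨u, hu, w, hw, huw⟩ := h.exists_adj (T := {v.1}) (by simp) (by simp)
      (by rw [← Finset.erase_eq]; exact hc.nonempty)
    rw [Finset.mem_singleton] at hu
    subst hu
    exact ⟨w, (Finset.mem_sdiff.1 hw).1, huw⟩
  · rintro ⟨v, hv, hc, u, hu, huv⟩
    have := (Q.conn_singleton v).union hc (Finset.mem_singleton_self v)
      (Finset.mem_erase.2 ⟨huv.ne', hu⟩) huv
    rwa [← Finset.insert_eq, Finset.insert_erase hv] at this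

end Connectivity

section Trees
variable {n : ℕ}

theorem JoinTree.rels_nonempty : ∀ T : JoinTree n, T.rels.Nonempty
  | .leaf i => ⟨i, by simp [JoinTree.rels]⟩
  | .join l r => (rels_nonempty l).mono (by simp [JoinTree.rels])

theorem JoinTree.Valid.conn {Q : Query n} : ∀ {T : JoinTree n}, T.Valid Q.graph → Q.Conn T.rels
  | .leaf i, _ => Q.conn_singleton i
  | .join l r, h => by
    obtain ⟨hl, hr, -, u, hu, v, hv, huv⟩ := h
    exact hl.conn.union hr.conn hu hv huv

theorem JoinTree.card_join {l r : JoinTree n} (h : Disjoint l.rels r.rels) :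
    (JoinTree.join l r).rels.card = l.rels.card + r.rels.card := by
  rw [JoinTree.rels, Finset.card_union_of_disjoint h]

theorem JoinTree.Valid.joinable {Q : Query n} {l r : JoinTree n}
    (h : (JoinTree.join l r).Valid Q.graph) : Q.Joinable (l.rels ∪ r.rels) := by
  refine (Q.joinable_iff _).2 ⟨?_, h.conn⟩
  have h1 := JoinTree.card_join h.2.2.1
  have h2 := Finset.card_pos.2 l.rels_nonempty
  have h3 := Finset.card_pos.2 r.rels_nonempty
  rw [JoinTree.rels] at h1
  omega

theorem Query.card_le_maxCard (Q : Query n) {S : Finset (Fin n)} (h : Q.Joinable S) :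
    Q.card S ≤ Q.maxCard := by
  classical
  unfold Query.maxCard
  refine le_max_of_le_right ?_
  convert Finset.le_sup (f := Q.card) (s := Finset.univ.filter Q.Joinable) (b := S) (by simp [h])

/-- A tree with k leaves has k - 1 joins, each of cardinality at most W. Adding W on the left avoids
truncated subtraction and makes the induction additive. -/
theorem JoinTree.Valid.costOut_le {Q : Query n} : ∀ {T : JoinTree n}, T.Valid Q.graph →
    T.costOut Q.card + Q.maxCard ≤ Q.maxCard * T.rels.card
  | .leaf i, _ => by simp [JoinTree.costOut, JoinTree.rels]
  | .join l r, h => by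
    rw [JoinTree.card_join h.2.2.1, JoinTree.costOut]
    have h1 := h.1.costOut_le
    have h2 := h.2.1.costOut_le
    have h3 := Q.card_le_maxCard h.joinable
    rw [mul_add]; omega

variable (Q : Query n)

theorem Query.optCost_le {T : JoinTree n} (h : T.Valid Q.graph) :
    Q.optCost T.rels ≤ T.costOut Q.card :=
  iInf₂_le T ⟨h, rfl⟩

/-- An infimum over a nonempty family in `ℕ∞` is attained, and the family is nonempty because an
empty infimum would be `⊤`. -/
theorem Query.exists_tree_of_optCost {S : Finset (Fin n)} (h : Q.optCost S ≠ ⊤) :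
    ∃ T : JoinTree n, T.Valid Q.graph ∧ T.rels = S ∧ (T.costOut Q.card : ℕ∞) = Q.optCost S := by
  have hne : Nonempty {T : JoinTree n // T.Valid Q.graph ∧ T.rels = S} := by
    by_contra hcon
    apply h
    unfold Query.optCost
    simp only [iInf_eq_top]
    intro T hT
    exact absurd ⟨⟨T, hT⟩⟩ hcon
  have h2 : Q.optCost S =
      ⨅ T : {T : JoinTree n // T.Valid Q.graph ∧ T.rels = S}, (T.1.costOut Q.card : ℕ∞) := by
    unfold Query.optCost
    rw [iInf_subtype]
  obtain ⟨T, hT⟩ := ENat.exists_eq_iInf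
    (fun T : {T : JoinTree n // T.Valid Q.graph ∧ T.rels = S} => (T.1.costOut Q.card : ℕ∞))
  exact ⟨T.1, T.2.1, T.2.2, by rw [h2]; exact hT⟩

theorem Query.optCost_empty : Q.optCost ∅ = ⊤ := by
  by_contra h
  obtain ⟨T, -, h2, -⟩ := Q.exists_tree_of_optCost h
  exact T.rels_nonempty.ne_empty h2

theorem Query.optCost_of_card_eq_one {S : Finset (Fin n)} (h : S.card = 1) : Q.optCost S = 0 := by
  obtain ⟨i, rfl⟩ := Finset.card_eq_one.1 h
  have h1 := Q.optCost_le (T := .leaf i) trivial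
  simpa [JoinTree.rels, JoinTree.costOut] using h1

/-- Joining optimal trees of the two parts of a split. -/
theorem Query.valid_join_of_split {S T : Finset (Fin n)} (hS : Q.Conn S) (hT : T ⊆ S)
    {l r : JoinTree n} (hl : l.Valid Q.graph) (hr : r.Valid Q.graph) (hlT : l.rels = T)
    (hrT : r.rels = S \ T) : (JoinTree.join l r).Valid Q.graph ∧ (JoinTree.join l r).rels = S := by
  have h1 := l.rels_nonempty
  have h2 := r.rels_nonempty
  refine ⟨⟨hl, hr, ?_, ?_⟩, ?_⟩
  · rw [hlT, hrT]; exact Finset.disjoint_sdiff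
  · rw [hlT] at h1 ⊢; rw [hrT] at h2 ⊢
    exact hS.exists_adj hT h1 h2
  · rw [JoinTree.rels, hlT, hrT, Finset.union_sdiff_of_subset hT]

/-- For ≤, optimal trees of the two parts are joined along an edge that crosses the cut of the
connected set S. For ≥, an optimal tree is cut at its root. Improper splits do no harm, since the
empty set has no tree. -/
theorem Query.optCost_eq {S : Finset (Fin n)} (h : 2 ≤ S.card) :
    Q.optCost S = minPlusConv Q.optCost Q.optCost S + Q.joinCard S := by
  classical
  apply le_antisymm
  · by_cases hJ : Q.Joinable S
    · have hjc : Q.joinCard S = Q.card S := by unfold Query.joinCard; exact if_pos hJ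
      rw [hjc]
      unfold minPlusConv
      by_cases htop : (⨅ T ∈ S.powerset, Q.optCost T + Q.optCost (S \ T)) = ⊤
      · rw [htop]; simp
      · have hne : Nonempty {T // T ∈ S.powerset} := ⟨⟨∅, by simp⟩⟩
        have hrw : (⨅ T ∈ S.powerset, Q.optCost T + Q.optCost (S \ T)) =
            ⨅ T : {T // T ∈ S.powerset}, Q.optCost T.1 + Q.optCost (S \ T.1) := by
          rw [iInf_subtype]
        obtain ⟨⟨T, hT⟩, hTe⟩ := ENat.exists_eq_iInf
          (fun T : {T // T ∈ S.powerset} => Q.optCost T.1 + Q.optCost (S \ T.1))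
        rw [hrw, ← hTe] at htop ⊢
        simp only at htop ⊢
        have hTS := Finset.mem_powerset.1 hT
        obtain ⟨l, hl, hlT, hlc⟩ := Q.exists_tree_of_optCost
          (fun h => htop (by rw [h, top_add]) : Q.optCost T ≠ ⊤)
        obtain ⟨r, hr, hrT, hrc⟩ := Q.exists_tree_of_optCost
          (fun h => htop (by rw [h, add_top]) : Q.optCost (S \ T) ≠ ⊤)
        obtain ⟨hv, hrel⟩ := Q.valid_join_of_split hJ.2 hTS hl hr hlT hrT
        have := Q.optCost_le hv
        rw [hrel] at this
        refine this.trans ?_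
        have h3 : (JoinTree.join l r).costOut Q.card
            = Q.card S + l.costOut Q.card + r.costOut Q.card := by
          rw [← hrel]; rfl
        rw [h3, ← hlc, ← hrc]
        push_cast
        apply le_of_eq; ring
    · have hjc : Q.joinCard S = ⊤ := by unfold Query.joinCard; exact if_neg hJ
      rw [hjc, add_top]; exact le_top
  · by_cases htop : Q.optCost S = ⊤
    · rw [htop]; exact le_top
    obtain ⟨T, hT, hTS, hTc⟩ := Q.exists_tree_of_optCost htop
    rw [← hTc]
    cases T with
    | leaf i =>
      rw [JoinTree.rels] at hTS
      rw [← hTS] at h; simp at h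
    | join l r =>
      have hJ := hT.joinable
      rw [JoinTree.rels] at hTS
      rw [hTS] at hJ
      have hjc : Q.joinCard S = Q.card S := by unfold Query.joinCard; exact if_pos hJ
      rw [hjc, JoinTree.costOut, hTS]
      have h1 : minPlusConv Q.optCost Q.optCost S ≤ Q.optCost l.rels + Q.optCost r.rels := by
        unfold minPlusConv
        refine (iInf₂_le l.rels (Finset.mem_powerset.2 ?_)).trans ?_
        · rw [← hTS]; exact Finset.subset_union_left
        · rw [← hTS, Finset.union_sdiff_cancel_left hT.2.2.1]
      have h2 := Q.optCost_le hT.1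
      have h3 := Q.optCost_le hT.2.1
      push_cast
      calc _ ≤ ((l.costOut Q.card : ℕ∞) + r.costOut Q.card) + Q.card S := by
            gcongr; exact h1.trans (add_le_add h2 h3)
        _ = _ := by ring

theorem Query.optCost_le_of_ne_top {S : Finset (Fin n)} (h : Q.optCost S ≠ ⊤) :
    ∃ v : ℕ, Q.optCost S = v ∧ v + Q.maxCard ≤ Q.maxCard * S.card := by
  obtain ⟨T, hT, hTS, hTc⟩ := Q.exists_tree_of_optCost h
  exact ⟨_, hTc.symm, by rw [← hTS]; exact hT.costOut_le⟩

theorem Query.optCost_eq_top_of_not_conn {S : Finset (Fin n)} (h : ¬ Q.Conn S) :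
    Q.optCost S = ⊤ := by
  by_contra hc
  obtain ⟨T, hT, hTS, -⟩ := Q.exists_tree_of_optCost hc
  exact h (hTS ▸ hT.conn)

/-- The splits T = ∅ and T = S have value `⊤`. So the convolution at S consults only proper subsets,
and a table that is complete below S can replace the full one. -/
theorem minPlusConv_congr {f g : Finset (Fin n) → ℕ∞} {S : Finset (Fin n)} (hf : f ∅ = ⊤)
    (hg : g ∅ = ⊤) (h : ∀ T, T ⊆ S → T ≠ S → f T = g T) : minPlusConv f f S = minPlusConv g g S := by
  unfold minPlusConv
  refine iInf_congr fun T => iInf_congr fun hT => ?_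
  have hT := Finset.mem_powerset.1 hT
  by_cases h1 : T = S
  · subst h1; simp [hf, hg]
  by_cases h2 : T = ∅
  · subst h2; simp [hf, hg]
  rw [h T hT h1, h (S \ T) Finset.sdiff_subset]
  intro h3
  rw [Finset.sdiff_eq_self_iff_disjoint] at h3
  exact h2 (Finset.disjoint_self_iff_empty _ |>.1 (h3.mono_left hT))

/-- At a set whose size is the index of the layer, `fscLayerMinPlus_card` turns the layer into a
minimum over splits. This minimum involves only smaller sets, where the table is already optimal. -/
theorem dpTable_eq (k : ℕ) (S : Finset (Fin n)) :
    dpTable Q (k + 1) S = if S.card ≤ k + 1 then Q.optCost S else ⊤ := by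
  induction k generalizing S with
  | zero =>
    simp only [dpTable]
    by_cases h1 : S.card = 1
    · simp [h1, Q.optCost_of_card_eq_one h1]
    · rw [if_neg h1]
      by_cases h0 : S.card ≤ 0 + 1
      · have : S = ∅ := Finset.card_eq_zero.1 (by omega)
        subst this; simp [Q.optCost_empty]
      · rw [if_neg h0]
  | succ k ih =>
    rw [dpTable]; beta_reduce
    by_cases h : S.card = k + 2
    · rw [if_pos h, if_pos (by omega), ← h, fscLayerMinPlus_card, Q.optCost_eq (by omega)]
      congr 1
      apply minPlusConv_congr
      · rw [ih]; simp [Q.optCost_empty]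
      · exact Q.optCost_empty
      · intro T hT hTS
        rw [ih, if_pos]
        have := Finset.card_lt_card (Finset.ssubset_iff_subset_ne.2 ⟨hT, hTS⟩)
        omega
    · rw [if_neg h, ih]
      by_cases h2 : S.card ≤ k + 1
      · rw [if_pos h2, if_pos (by omega)]
      · rw [if_neg h2, if_neg (by omega)]

theorem dpTable_eq_optCost (S : Finset (Fin n)) : dpTable Q n S = Q.optCost S := by
  cases n with
  | zero =>
    have : S = ∅ := Finset.eq_empty_of_isEmpty S
    subst this
    simp [dpTable, Q.optCost_empty]
  | succ k =>
    rw [dpTable_eq, if_pos]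
    exact (Finset.card_le_univ S).trans (by simp)

end Trees
end DPconv

end

/-! ### An abstract machine and its compilation to the word RAM -/

section
open Finset

namespace DPconv
namespace RAM

infixr:60 " ⨟ " => Prog.seq

/-! ### An abstract machine: registers, the flat input/output area, and a three-dimensional array -/

/-- The state of the abstract machine. -/
structure Store where
  reg : ℕ → ℕ
  inp : ℕ → ℕ
  mem : ℕ → ℕ → ℕ → ℕ

namespace Store

def setReg (s : Store) (x v : ℕ) : Store := { s with reg := Function.update s.reg x v }

def setInp (s : Store) (a v : ℕ) : Store := { s with inp := Function.update s.inp a v }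

def setMem (s : Store) (i j k v : ℕ) : Store :=
  { s with mem := fun i' j' k' => if i' = i ∧ j' = j ∧ k' = k then v else s.mem i' j' k' }

@[simp] theorem setReg_reg (s : Store) (x v y : ℕ) :
    (s.setReg x v).reg y = if y = x then v else s.reg y := by
  simp [setReg, Function.update_apply]

@[simp] theorem setReg_inp (s : Store) (x v : ℕ) : (s.setReg x v).inp = s.inp := rfl
@[simp] theorem setReg_mem (s : Store) (x v : ℕ) : (s.setReg x v).mem = s.mem := rfl
@[simp] theorem setInp_reg (s : Store) (a v : ℕ) : (s.setInp a v).reg = s.reg := rfl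
@[simp] theorem setInp_mem (s : Store) (a v : ℕ) : (s.setInp a v).mem = s.mem := rfl

@[simp] theorem setInp_inp (s : Store) (a v b : ℕ) :
    (s.setInp a v).inp b = if b = a then v else s.inp b := by
  simp [setInp, Function.update_apply]

@[simp] theorem setMem_reg (s : Store) (i j k v : ℕ) : (s.setMem i j k v).reg = s.reg := rfl
@[simp] theorem setMem_inp (s : Store) (i j k v : ℕ) : (s.setMem i j k v).inp = s.inp := rfl

@[simp] theorem setMem_mem (s : Store) (i j k v i' j' k' : ℕ) :
    (s.setMem i j k v).mem i' j' k' = if i' = i ∧ j' = j ∧ k' = k then v else s.mem i' j' k' := rfl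

end Store

/-- The registers below `lo` agree. -/
def Frame (lo : ℕ) (s s' : Store) : Prop := ∀ z < lo, s'.reg z = s.reg z

theorem Frame.refl (lo : ℕ) (s : Store) : Frame lo s s := fun _ _ => rfl

theorem Frame.trans {lo lo' : ℕ} {s s' s'' : Store} (h : Frame lo s s') (h' : Frame lo' s' s'')
    (hl : lo ≤ lo' := by norm_num) : Frame lo s s'' :=
  fun z hz => (h' z (hz.trans_le hl)).trans (h z hz)

theorem Frame.setReg {lo x v : ℕ} {s s' : Store} (h : Frame lo s s')
    (hx : lo ≤ x := by norm_num) : Frame lo s (s'.setReg x v) := by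
  intro z hz
  rw [Store.setReg_reg, if_neg (by omega), h z hz]

theorem Frame.setMem {lo i j k v : ℕ} {s s' : Store} (h : Frame lo s s') :
    Frame lo s (s'.setMem i j k v) := h

theorem Frame.setInp {lo a v : ℕ} {s s' : Store} (h : Frame lo s s') :
    Frame lo s (s'.setInp a v) := h

/-- Where the abstract machine lives on the word RAM: the array starts at the address `off` and has
`K × K` planes, all numbers in the abstract machine are below `V`, and the words are the numbers
below `B`. -/
structure Layout where
  off : ℕ
  K : ℕ
  V : ℕ
  B : ℕ
  hV : 100 ≤ V
  hB : V ^ 40 ≤ B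

theorem Layout.lt_B (L : Layout) {v k : ℕ} (h : v < L.V ^ k) (hk : k ≤ 40) : v < L.B :=
  h.trans_le ((Nat.pow_le_pow_right (by have := L.hV; omega) hk).trans L.hB)

theorem Layout.lt_B_of_lt_V (L : Layout) {v : ℕ} (h : v < L.V) : v < L.B :=
  L.lt_B (k := 1) (by simpa using h) (by norm_num)

/-- The machine state `σ` represents the abstract state `s`. -/
structure Sim (L : Layout) (σ : State) (s : Store) : Prop where
  reg : ∀ x < 100, σ.reg x = s.reg x
  inp : ∀ a < L.off, σ.mem a = s.inp a
  mem : ∀ i, ∀ j < L.K, ∀ k < L.K, σ.mem ((((i * L.K + j) * L.K) + k) + L.off) = s.mem i j k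

/-- All numbers in the abstract state are small. -/
structure Bdd (L : Layout) (s : Store) : Prop where
  reg : ∀ x, s.reg x < L.V
  inp : ∀ a, s.inp a < L.V
  mem : ∀ i j k, s.mem i j k < L.V

theorem Bdd.setReg {L : Layout} {s : Store} (h : Bdd L s) (x : ℕ) {v : ℕ} (hv : v < L.V) :
    Bdd L (s.setReg x v) where
  reg y := by rw [Store.setReg_reg]; split_ifs; exacts [hv, h.reg y]
  inp := h.inp
  mem := h.mem

theorem Bdd.setInp {L : Layout} {s : Store} (h : Bdd L s) (x : ℕ) {v : ℕ} (hv : v < L.V) :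
    Bdd L (s.setInp x v) where
  reg := h.reg
  inp y := by rw [Store.setInp_inp]; split_ifs; exacts [hv, h.inp y]
  mem := h.mem

theorem Bdd.setMem {L : Layout} {s : Store} (h : Bdd L s) (i j k : ℕ) {v : ℕ} (hv : v < L.V) :
    Bdd L (s.setMem i j k v) where
  reg := h.reg
  inp := h.inp
  mem i' j' k' := by rw [Store.setMem_mem]; split_ifs; exacts [hv, h.mem i' j' k']

/-! ### Expressions -/

inductive Expr where
  | lit (k : ℕ) : Expr
  | var (x : ℕ) : Expr
  | bin (o : Op) (a b : Expr) : Expr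
  | inp (a : Expr) : Expr
  | mem (i j k : Expr) : Expr

namespace Expr

instance (k : ℕ) : OfNat Expr k := ⟨.lit k⟩
instance : Add Expr := ⟨.bin .add⟩
instance : Sub Expr := ⟨.bin .sub⟩
instance : Mul Expr := ⟨.bin .mul⟩
instance : Div Expr := ⟨.bin .div⟩
instance : Mod Expr := ⟨.bin .mod⟩

def eval (s : Store) : Expr → ℕ
  | lit k => k
  | var x => s.reg x
  | bin o a b => o.eval (a.eval s) (b.eval s)
  | inp a => s.inp (a.eval s)
  | mem i j k => s.mem (i.eval s) (j.eval s) (k.eval s)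

/-- All accesses to the memory are within their area. -/
def Ok (L : Layout) (s : Store) : Expr → Prop
  | lit _ => True
  | var _ => True
  | bin _ a b => a.Ok L s ∧ b.Ok L s
  | inp a => a.Ok L s ∧ a.eval s < L.off
  | mem i j k => i.Ok L s ∧ j.Ok L s ∧ k.Ok L s ∧ j.eval s < L.K ∧ k.eval s < L.K ∧
      s.reg 0 = L.off ∧ s.reg 1 = L.K

/-- An expression of size k has a value below `V ^ k` and is evaluated in fewer than 5 k steps. The
3 in the last case stands for the three register operands in the address of an array cell. -/
def size : Expr → ℕ
  | lit _ => 1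
  | var _ => 1
  | bin _ a b => a.size + b.size
  | inp a => a.size + 1
  | mem i j k => i.size + j.size + k.size + 3

def wf : Expr → Bool
  | lit k => k < 100
  | var x => x < 100
  | bin _ a b => a.wf && b.wf
  | inp a => a.wf
  | mem i j k => i.wf && j.wf && k.wf

/-- A decidable side condition, settled by `rfl` for each concrete expression. The number 40 is the
exponent in `Layout.hB`. -/
def good (e : Expr) : Bool := e.wf && decide (e.size ≤ 40)

@[simp] theorem eval_ofNat (s : Store) (k : ℕ) : (no_index (OfNat.ofNat k : Expr)).eval s = OfNat.ofNat k := rfl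
@[simp] theorem eval_zero (s : Store) : (0 : Expr).eval s = 0 := rfl
@[simp] theorem eval_one (s : Store) : (1 : Expr).eval s = 1 := rfl
@[simp] theorem eval_var (s : Store) (x : ℕ) : (var x).eval s = s.reg x := rfl
@[simp] theorem eval_add (s : Store) (a b : Expr) : (a + b).eval s = a.eval s + b.eval s := rfl
@[simp] theorem eval_sub (s : Store) (a b : Expr) : (a - b).eval s = a.eval s - b.eval s := rfl
@[simp] theorem eval_mul (s : Store) (a b : Expr) : (a * b).eval s = a.eval s * b.eval s := rfl
@[simp] theorem eval_div (s : Store) (a b : Expr) : (a / b).eval s = a.eval s / b.eval s := rfl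
@[simp] theorem eval_mod (s : Store) (a b : Expr) : (a % b).eval s = a.eval s % b.eval s := rfl
@[simp] theorem eval_inp (s : Store) (a : Expr) : (inp a).eval s = s.inp (a.eval s) := rfl
@[simp] theorem eval_mem (s : Store) (i j k : Expr) :
    (mem i j k).eval s = s.mem (i.eval s) (j.eval s) (k.eval s) := rfl

variable (L : Layout)

@[simp] theorem ok_ofNat (s : Store) (k : ℕ) : (no_index (OfNat.ofNat k : Expr)).Ok L s ↔ True := Iff.rfl
@[simp] theorem ok_zero (s : Store) : (0 : Expr).Ok L s ↔ True := Iff.rfl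
@[simp] theorem ok_one (s : Store) : (1 : Expr).Ok L s ↔ True := Iff.rfl
@[simp] theorem ok_var (s : Store) (x : ℕ) : (var x).Ok L s ↔ True := Iff.rfl
@[simp] theorem ok_add (s : Store) (a b : Expr) : (a + b).Ok L s ↔ a.Ok L s ∧ b.Ok L s := Iff.rfl
@[simp] theorem ok_sub (s : Store) (a b : Expr) : (a - b).Ok L s ↔ a.Ok L s ∧ b.Ok L s := Iff.rfl
@[simp] theorem ok_mul (s : Store) (a b : Expr) : (a * b).Ok L s ↔ a.Ok L s ∧ b.Ok L s := Iff.rfl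
@[simp] theorem ok_div (s : Store) (a b : Expr) : (a / b).Ok L s ↔ a.Ok L s ∧ b.Ok L s := Iff.rfl
@[simp] theorem ok_mod (s : Store) (a b : Expr) : (a % b).Ok L s ↔ a.Ok L s ∧ b.Ok L s := Iff.rfl
@[simp] theorem ok_inp (s : Store) (a : Expr) :
    (inp a).Ok L s ↔ a.Ok L s ∧ a.eval s < L.off := Iff.rfl
@[simp] theorem ok_mem (s : Store) (i j k : Expr) :
    (mem i j k).Ok L s ↔ i.Ok L s ∧ j.Ok L s ∧ k.Ok L s ∧ j.eval s < L.K ∧ k.eval s < L.K ∧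
      s.reg 0 = L.off ∧ s.reg 1 = L.K := Iff.rfl

end Expr

/-! ### Compilation -/

/-- Started in a state that represents `s`, the program `p r` computes `v` in register `r` and
changes no memory cell and no register below `r`. -/
def Computes (L : Layout) (s : Store) (p : ℕ → Prog) (v c : ℕ) : Prop :=
  ∀ r, 100 ≤ r → ∀ σ, Sim L σ s → ∃ t σ', Exec L.B (p r) σ t σ' ∧ t ≤ c ∧ σ'.mem = σ.mem ∧
    σ'.reg r = v ∧ ∀ x < r, σ'.reg x = σ.reg x

theorem Sim.of_agree {L : Layout} {σ σ' : State} {s : Store} (h : Sim L σ s)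
    (hm : σ'.mem = σ.mem) {r : ℕ} (hr : 100 ≤ r) (hx : ∀ x < r, σ'.reg x = σ.reg x) :
    Sim L σ' s where
  reg x hx' := (hx x (by omega)).trans (h.reg x hx')
  inp := by rw [hm]; exact h.inp
  mem := by rw [hm]; exact h.mem

def litC (k : ℕ) : ℕ → Prog := fun r => .const r k

/-- A register is copied by adding it to 0, as the instruction set has no move. -/
def varC (x : ℕ) : ℕ → Prog := fun r => .const r 0 ⨟ .arith .add r r x

/-- The registers from r on act as an evaluation stack: the second operand is computed in r + 1 and
leaves register r intact. -/
def binC (o : Op) (p q : ℕ → Prog) : ℕ → Prog := fun r => p r ⨟ q (r + 1) ⨟ .arith o r r (r + 1)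

def loadC (p : ℕ → Prog) : ℕ → Prog := fun r => p r ⨟ .load r r

/-- The address of a cell of the array. -/
def addrC (i j k : ℕ → Prog) : ℕ → Prog :=
  binC .add (binC .add (binC .mul (binC .add (binC .mul i (varC 1)) j) (varC 1)) k) (varC 0)

theorem Computes.lit {L : Layout} {s : Store} {k : ℕ} (h : k < L.B) :
    Computes L s (litC k) k 1 := by
  intro r _ σ _
  refine ⟨_, _, Exec.const σ r k h, le_rfl, rfl, by simp [State.setReg], ?_⟩
  intro x hx
  simp [State.setReg, hx.ne]

theorem Computes.var {L : Layout} {s : Store} {x : ℕ} (hx : x < 100) (hv : s.reg x < L.B) :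
    Computes L s (varC x) (s.reg x) 2 := by
  intro r hr σ hσ
  have hne : x ≠ r := by omega
  have hval : Op.eval .add ((σ.setReg r 0).reg r) ((σ.setReg r 0).reg x) = s.reg x := by
    simp [State.setReg, hne, Op.eval, hσ.reg x hx]
  refine ⟨_, _, Exec.seq (Exec.const σ r 0 (by omega))
    (Exec.arith _ .add r r x (by rw [hval]; exact hv)), le_rfl, rfl, ?_, ?_⟩
  · rw [hval]; simp [State.setReg]
  · intro y hy
    simp [State.setReg, Function.update_apply, hy.ne]

theorem Computes.bin {L : Layout} {s : Store} {p q : ℕ → Prog} {a b c d : ℕ} (o : Op)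
    (hp : Computes L s p a c) (hq : Computes L s q b d) (hv : o.eval a b < L.B) :
    Computes L s (binC o p q) (o.eval a b) (c + d + 1) := by
  intro r hr σ hσ
  obtain ⟨t, σ1, h1, ht, hm, hv1, hr1⟩ := hp r hr σ hσ
  obtain ⟨t', σ2, h2, ht', hm', hv2, hr2⟩ := hq (r + 1) (by omega) σ1 (hσ.of_agree hm hr hr1)
  have hval : o.eval (σ2.reg r) (σ2.reg (r + 1)) = o.eval a b := by
    rw [hv2, hr2 r (by omega), hv1]
  refine ⟨_, _, Exec.seq h1 (Exec.seq h2 (Exec.arith σ2 o r r (r + 1) (by rw [hval]; exact hv))),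
    by omega, ?_, ?_, ?_⟩
  · exact hm'.trans hm
  · rw [hval]; simp [State.setReg]
  · intro x hx
    simp only [State.setReg, Function.update_apply, hx.ne, if_false]
    rw [hr2 x (by omega), hr1 x hx]

theorem Computes.load {L : Layout} {s : Store} {p : ℕ → Prog} {a v c : ℕ}
    (hp : Computes L s p a c) (hm : ∀ σ, Sim L σ s → σ.mem a = v) (hv : v < L.B) :
    Computes L s (loadC p) v (c + 1) := by
  intro r hr σ hσ
  obtain ⟨t, σ1, h1, ht, hm1, hv1, hr1⟩ := hp r hr σ hσ
  have hval : σ1.mem (σ1.reg r) = v := by rw [hv1, hm1, hm σ hσ]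
  refine ⟨_, _, Exec.seq h1 (Exec.load σ1 r r (by rw [hval]; exact hv)), by omega, hm1, ?_, ?_⟩
  · rw [hval]; simp [State.setReg]
  · intro x hx
    simp only [State.setReg, Function.update_apply, hx.ne, if_false]
    exact hr1 x hx

/-- Bounds for the values of expressions by powers of `V`. -/
theorem Op.eval_lt {o : Op} {a b V k l : ℕ} (hV : 2 ≤ V) (ha : a < V ^ k) (hb : b < V ^ l)
    (hk : 1 ≤ k) (hl : 1 ≤ l) : o.eval a b < V ^ (k + l) := by
  have hle : V ^ k ≤ V ^ (k + l) := Nat.pow_le_pow_right (by omega) (by omega)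
  cases o with
  | add =>
    have h1 : V ≤ V ^ k := Nat.le_self_pow (by omega) V
    have h2 : V ≤ V ^ l := Nat.le_self_pow (by omega) V
    rw [pow_add, Op.eval]
    nlinarith
  | sub => exact (Nat.sub_le a b).trans_lt (ha.trans_le hle)
  | mul =>
    rw [pow_add, Op.eval]
    exact Nat.mul_lt_mul'' ha hb
  | div => exact (Nat.div_le_self a b).trans_lt (ha.trans_le hle)
  | mod => exact (Nat.mod_le a b).trans_lt (ha.trans_le hle)

/-- A computation together with a bound of its value. -/
def ComputesBdd (L : Layout) (s : Store) (p : ℕ → Prog) (v c k : ℕ) : Prop :=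
  Computes L s p v c ∧ v < L.V ^ k ∧ 1 ≤ k

theorem ComputesBdd.bin {L : Layout} {s : Store} {p q : ℕ → Prog} {a b c d k l : ℕ} (o : Op)
    (hp : ComputesBdd L s p a c k) (hq : ComputesBdd L s q b d l) (hkl : k + l ≤ 40) :
    ComputesBdd L s (binC o p q) (o.eval a b) (c + d + 1) (k + l) := by
  have h := Op.eval_lt (o := o) (by have := L.hV; omega) hp.2.1 hq.2.1 hp.2.2 hq.2.2
  exact ⟨hp.1.bin o hq.1 (L.lt_B h hkl), h, by have := hp.2.2; omega⟩

theorem ComputesBdd.var {L : Layout} {s : Store} (hb : Bdd L s) {x : ℕ} (hx : x < 100) :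
    ComputesBdd L s (varC x) (s.reg x) 2 1 :=
  ⟨.var hx (L.lt_B_of_lt_V (hb.reg x)), by simpa using hb.reg x, le_rfl⟩

theorem ComputesBdd.addr {L : Layout} {s : Store} (hb : Bdd L s) {p q r : ℕ → Prog}
    {i j k c d e a b g : ℕ} (hp : ComputesBdd L s p i c a) (hq : ComputesBdd L s q j d b)
    (hr : ComputesBdd L s r k e g) (h0 : s.reg 0 = L.off) (h1 : s.reg 1 = L.K)
    (hs : a + b + g + 3 ≤ 40) :
    ComputesBdd L s (addrC p q r) ((((i * L.K + j) * L.K) + k) + L.off) (c + d + e + 11)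
      (a + b + g + 3) := by
  have hv1 := ComputesBdd.var hb (x := 1) (by norm_num)
  have hv0 := ComputesBdd.var hb (x := 0) (by norm_num)
  rw [h1] at hv1
  rw [h0] at hv0
  have := (((((hp.bin .mul hv1 (by omega)).bin .add hq (by omega)).bin .mul hv1
    (by omega)).bin .add hr (by omega)).bin .add hv0 (by omega))
  convert this using 1 <;> first | rfl | omega

def Expr.comp : Expr → ℕ → Prog
  | lit k => litC k
  | var x => varC x
  | bin o a b => binC o a.comp b.comp
  | inp a => loadC a.comp
  | mem i j k => loadC (addrC i.comp j.comp k.comp)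

theorem Expr.size_pos (e : Expr) : 1 ≤ e.size := by
  induction e <;> simp only [size] <;> omega

/-- Every operation at most adds the exponents of the bounds of its operands, so no intermediate
result, addresses included, exceeds `V ^ 40` and the machine never faults. -/
theorem Expr.computes {L : Layout} {s : Store} (hb : Bdd L s) (e : Expr) (hwf : e.wf = true)
    (hs : e.size ≤ 40) (hok : e.Ok L s) :
    ComputesBdd L s e.comp (e.eval s) (5 * e.size - 1) e.size := by
  have weaken : ∀ {p v c c' k}, ComputesBdd L s p v c k → c ≤ c' → ComputesBdd L s p v c' k := by
    intro p v c c' k h hc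
    refine ⟨fun r hr σ hσ => ?_, h.2⟩
    obtain ⟨t, σ', h1, h2, h3⟩ := h.1 r hr σ hσ
    exact ⟨t, σ', h1, h2.trans hc, h3⟩
  induction e with
  | lit k =>
    have hk : k < L.V := lt_of_lt_of_le (by simpa [wf] using hwf) L.hV
    exact weaken ⟨.lit (L.lt_B_of_lt_V hk), by simpa [size, eval] using hk, le_rfl⟩ (by simp [size])
  | var x =>
    exact weaken (.var hb (by simpa [wf] using hwf)) (by simp [size])
  | bin o a b iha ihb =>
    simp only [wf, Bool.and_eq_true] at hwf
    simp only [size] at hs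
    have ha := a.size_pos
    have hb' := b.size_pos
    exact weaken ((iha hwf.1 (by omega) hok.1).bin o (ihb hwf.2 (by omega) hok.2) hs)
      (by simp only [size]; omega)
  | inp a iha =>
    simp only [size] at hs
    have ha := a.size_pos
    have h := iha hwf (by omega) hok.1
    have hv := hb.inp (a.eval s)
    refine weaken ⟨h.1.load (fun σ hσ => hσ.inp _ hok.2) (L.lt_B_of_lt_V hv), ?_, ?_⟩
      (by simp only [size]; omega)
    · exact hv.trans_le (Nat.le_self_pow (by simp [size]) _)
    · simp [size]
  | mem i j k ihi ihj ihk =>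
    simp only [wf, Bool.and_eq_true] at hwf
    simp only [size] at hs
    obtain ⟨o1, o2, o3, hj, hk, h0, h1⟩ := hok
    have h := (ihi hwf.1.1 (by omega) o1).addr hb (ihj hwf.1.2 (by omega) o2)
      (ihk hwf.2 (by omega) o3) h0 h1 hs
    have hv := hb.mem (i.eval s) (j.eval s) (k.eval s)
    have h1 := i.size_pos
    have h2 := j.size_pos
    have h3 := k.size_pos
    refine weaken ⟨h.1.load (fun σ hσ => hσ.mem _ _ hj _ hk) (L.lt_B_of_lt_V hv), ?_, ?_⟩
      (by simp only [size]; omega)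
    · exact hv.trans_le (Nat.le_self_pow (by simp [size]) _)
    · simp [size]

/-! ### Statements and their specifications -/

def assign (x : ℕ) (e : Expr) : Prog := e.comp 100 ⨟ .const 101 0 ⨟ .arith .add x 100 101

def setMem (i j k e : Expr) : Prog :=
  addrC i.comp j.comp k.comp 100 ⨟ e.comp 101 ⨟ .store 100 101

def setInp (a e : Expr) : Prog := a.comp 100 ⨟ e.comp 101 ⨟ .store 100 101

def cond (a b : Expr) (p q : Prog) : Prog := a.comp 100 ⨟ b.comp 101 ⨟ .ite 100 101 p q

def forLoop (x y : ℕ) (p : Prog) : Prog :=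
  .const x 0 ⨟ .while x y (p ⨟ .const 100 1 ⨟ .arith .add x x 100)

/-- Started in the abstract state `s`, the program halts within `T` time units in a state that
satisfies `Q`. -/
def WP (L : Layout) (p : Prog) (T : ℕ) (s : Store) (Q : Store → Prop) : Prop :=
  Bdd L s → ∀ σ, Sim L σ s → ∃ t σ' s', Exec L.B p σ t σ' ∧ t ≤ 1000 * T ∧ Sim L σ' s' ∧
    Bdd L s' ∧ Q s'

namespace WP

variable {L : Layout} {p q : Prog} {T T' : ℕ} {s : Store} {Q Q' : Store → Prop}

theorem mono (h : WP L p T s Q) (hT : T ≤ T') (hQ : ∀ s', Bdd L s' → Q s' → Q' s') :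
    WP L p T' s Q' := by
  intro hb σ hσ
  obtain ⟨t, σ', s', h1, h2, h3, h4, h5⟩ := h hb σ hσ
  exact ⟨t, σ', s', h1, h2.trans (by omega), h3, h4, hQ s' h4 h5⟩

theorem le_time (h : WP L p T s Q) (hT : T ≤ T') : WP L p T' s Q := h.mono hT fun _ _ => id

theorem imp (h : WP L p T s Q) (hQ : ∀ s', Q s' → Q' s') : WP L p T s Q' :=
  h.mono le_rfl fun s' _ => hQ s'

theorem seq (h : WP L p T s fun s' => WP L q T' s' Q) : WP L (p ⨟ q) (T + T') s Q := by
  intro hb σ hσ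
  obtain ⟨t, σ1, s1, h1, h2, h3, h4, h5⟩ := h hb σ hσ
  obtain ⟨t', σ2, s2, h1', h2', h3', h4', h5'⟩ := h5 h4 σ1 h3
  exact ⟨_, σ2, s2, .seq h1 h1', by omega, h3', h4', h5'⟩

theorem skip (h : Q s) : WP L .skip 1 s Q :=
  fun hb σ hσ => ⟨1, σ, s, .skip σ, by omega, hσ, hb, h⟩

theorem good_iff {e : Expr} (h : e.good = true) : e.wf = true ∧ e.size ≤ 40 := by
  simpa [Expr.good] using h

theorem assign {x : ℕ} {e : Expr} (hok : e.Ok L s) (hv : e.eval s < L.V)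
    (hQ : Q (s.setReg x (e.eval s))) (hg : e.good = true := by rfl) :
    WP L (assign x e) 1 s Q := by
  intro hb σ hσ
  obtain ⟨hwf, hs⟩ := good_iff hg
  have hB := L.lt_B_of_lt_V hv
  obtain ⟨t, σ1, h1, ht, hm1, hv1, hr1⟩ := (e.computes hb hwf hs hok).1 100 le_rfl σ hσ
  have hval : Op.eval .add ((σ1.setReg 101 0).reg 100) ((σ1.setReg 101 0).reg 101) = e.eval s := by
    simp [State.setReg, Op.eval, hv1]
  refine ⟨_, _, _, .seq h1 (.seq (.const σ1 101 0 (by omega)) (.arith _ .add x 100 101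
    (by rw [hval]; exact hB))), by omega, ?_, hb.setReg x hv, hQ⟩
  rw [hval]
  refine ⟨fun y hy => ?_, ?_, ?_⟩
  · rw [Store.setReg_reg]
    simp only [State.setReg, Function.update_apply]
    by_cases hyx : y = x
    · simp [hyx]
    · rw [if_neg hyx, if_neg hyx, if_neg (by omega), hr1 y hy, hσ.reg y hy]
  · intro a ha
    exact (congrFun hm1 a).trans (hσ.inp a ha)
  · intro i j hj k hk
    exact (congrFun hm1 _).trans (hσ.mem i j hj k hk)

/-- Positional notation to the base K, with an unbounded leading digit. -/
theorem _root_.DPconv.RAM.address_inj {K i j k i' j' k' : ℕ} (hj : j < K) (hk : k < K)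
    (hj' : j' < K) (hk' : k' < K) (h : (i * K + j) * K + k = (i' * K + j') * K + k') :
    i = i' ∧ j = j' ∧ k = k' := by
  have hK : 0 < K := by omega
  have h1 : i * K + j = i' * K + j' := by
    have := congrArg (· / K) h
    simpa [Nat.mul_comm _ K, Nat.mul_add_div hK, Nat.div_eq_of_lt hk, Nat.div_eq_of_lt hk'] using this
  have h2 : i = i' := by
    have := congrArg (· / K) h1
    simpa [Nat.mul_comm _ K, Nat.mul_add_div hK, Nat.div_eq_of_lt hj, Nat.div_eq_of_lt hj'] using this
  subst h2
  rw [h1] at h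
  omega

theorem setMem {i j k e : Expr} (hok : (i.mem j k).Ok L s) (hok' : e.Ok L s)
    (hv : e.eval s < L.V) (hQ : Q (s.setMem (i.eval s) (j.eval s) (k.eval s) (e.eval s)))
    (hg : (i.mem j k).good = true := by rfl) (hg' : e.good = true := by rfl) :
    WP L (setMem i j k e) 1 s Q := by
  intro hb σ hσ
  obtain ⟨hwf, hs⟩ := good_iff hg
  obtain ⟨hwf', hs'⟩ := good_iff hg'
  simp only [Expr.size] at hs
  simp only [Expr.wf, Bool.and_eq_true] at hwf
  obtain ⟨o1, o2, o3, hj, hk, h0, hK⟩ := hok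
  obtain ⟨t, σ1, h1, ht, hm1, hv1, hr1⟩ :=
    ((i.computes hb hwf.1.1 (by omega) o1).addr hb (j.computes hb hwf.1.2 (by omega) o2)
      (k.computes hb hwf.2 (by omega) o3) h0 hK hs).1 100 le_rfl σ hσ
  have hσ1 := hσ.of_agree hm1 le_rfl hr1
  obtain ⟨t', σ2, h2, ht', hm2, hv2, hr2⟩ :=
    (e.computes hb hwf' hs' hok').1 101 (by norm_num) σ1 hσ1
  have hσ2 := hσ1.of_agree hm2 (by norm_num) hr2
  refine ⟨_, _, _, .seq h1 (.seq h2 (.store σ2 100 101)), by omega, ?_,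
    hb.setMem _ _ _ hv, hQ⟩
  rw [hr2 100 (by norm_num), hv1, hv2]
  refine ⟨hσ2.reg, ?_, ?_⟩
  · intro a ha
    rw [State.setMem]
    simp only [Function.update_apply]
    rw [if_neg (by omega)]
    exact hσ2.inp a ha
  · intro i' j' hj' k' hk'
    rw [State.setMem, Store.setMem_mem]
    simp only [Function.update_apply]
    by_cases hc : i' = i.eval s ∧ j' = j.eval s ∧ k' = k.eval s
    · rw [if_pos hc, if_pos (by rw [hc.1, hc.2.1, hc.2.2])]
    · rw [if_neg hc, if_neg, hσ2.mem i' j' hj' k' hk']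
      intro h
      exact hc (address_inj hj' hk' hj hk (by omega))

theorem setInp {a e : Expr} (hok : a.Ok L s) (hok' : e.Ok L s) (ha : a.eval s < L.off)
    (hv : e.eval s < L.V) (hQ : Q (s.setInp (a.eval s) (e.eval s)))
    (hg : a.good = true := by rfl) (hg' : e.good = true := by rfl) : WP L (setInp a e) 1 s Q := by
  intro hb σ hσ
  obtain ⟨hwf, hs⟩ := good_iff hg
  obtain ⟨hwf', hs'⟩ := good_iff hg'
  obtain ⟨t, σ1, h1, ht, hm1, hv1, hr1⟩ := (a.computes hb hwf hs hok).1 100 le_rfl σ hσ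
  have hσ1 := hσ.of_agree hm1 le_rfl hr1
  obtain ⟨t', σ2, h2, ht', hm2, hv2, hr2⟩ :=
    (e.computes hb hwf' hs' hok').1 101 (by norm_num) σ1 hσ1
  have hσ2 := hσ1.of_agree hm2 (by norm_num) hr2
  refine ⟨_, _, _, .seq h1 (.seq h2 (.store σ2 100 101)), by omega, ?_, hb.setInp _ hv, hQ⟩
  rw [hr2 100 (by norm_num), hv1, hv2]
  refine ⟨hσ2.reg, ?_, ?_⟩
  · intro b hb
    rw [State.setMem, Store.setInp_inp]
    simp only [Function.update_apply]
    split_ifs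
    · rfl
    · exact hσ2.inp b hb
  · intro i' j' hj' k' hk'
    rw [State.setMem]
    simp only [Function.update_apply]
    rw [if_neg (by omega)]
    exact hσ2.mem i' j' hj' k' hk'

/-- Both branches are charged; this spares maxima in the time bounds at the price of a constant
factor. -/
theorem cond {a b : Expr} (T T' : ℕ) (hok : a.Ok L s) (hok' : b.Ok L s)
    (hp : a.eval s < b.eval s → WP L p T s Q) (hq : ¬ a.eval s < b.eval s → WP L q T' s Q)
    (hg : a.good = true := by rfl) (hg' : b.good = true := by rfl) : WP L (cond a b p q) (T + T' + 1) s Q := by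
  intro hb σ hσ
  obtain ⟨hwf, hs⟩ := good_iff hg
  obtain ⟨hwf', hs'⟩ := good_iff hg'
  obtain ⟨t, σ1, h1, ht, hm1, hv1, hr1⟩ := (a.computes hb hwf hs hok).1 100 le_rfl σ hσ
  have hσ1 := hσ.of_agree hm1 le_rfl hr1
  obtain ⟨t', σ2, h2, ht', hm2, hv2, hr2⟩ :=
    (b.computes hb hwf' hs' hok').1 101 (by norm_num) σ1 hσ1
  have hσ2 := hσ1.of_agree hm2 (by norm_num) hr2
  have e1 : σ2.reg 100 = a.eval s := by rw [hr2 100 (by norm_num), hv1]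
  by_cases hlt : a.eval s < b.eval s
  · obtain ⟨t3, σ3, s3, h3, ht3, hrest⟩ := hp hlt hb σ2 hσ2
    exact ⟨_, σ3, s3, .seq h1 (.seq h2 (.iteTrue (by rw [e1, hv2]; exact hlt) h3)), by omega, hrest⟩
  · obtain ⟨t3, σ3, s3, h3, ht3, hrest⟩ := hq hlt hb σ2 hσ2
    exact ⟨_, σ3, s3, .seq h1 (.seq h2 (.iteFalse (by rw [e1, hv2]; exact hlt) h3)), by omega, hrest⟩

/-- The invariant `I i` speaks of the state whose counter is already i. The body has to preserve the
counter and the bound; the loop itself performs the increment, so `I (i + 1)` is required only after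
`setReg`. -/
theorem forLoop {x y : ℕ} (N T : ℕ) (I : ℕ → Store → Prop) (hN : s.reg y = N)
    (h0 : I 0 (s.setReg x 0))
    (step : ∀ i < N, ∀ s', Bdd L s' → I i s' → s'.reg x = i → s'.reg y = N →
      WP L p T s' fun s'' => s''.reg x = i ∧ s''.reg y = N ∧ I (i + 1) (s''.setReg x (i + 1)))
    (hQ : ∀ s', I N s' → s'.reg x = N → Q s')
    (hx : x < 100 := by norm_num) (hy : y < 100 := by norm_num) (hxy : y ≠ x := by norm_num) :
    WP L (forLoop x y p) (N * (T + 1) + 1) s Q := by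
  intro hb σ hσ
  have hNV : N < L.V := hN ▸ hb.reg y
  have hB := L.lt_B_of_lt_V hNV
  have hB1 : 1 < L.B := L.lt_B_of_lt_V (by have := L.hV; omega)
  have setx : ∀ (σ : State) (s : Store) (v w : ℕ), Sim L σ s →
      Sim L ((σ.setReg 100 w).setReg x v) (s.setReg x v) := by
    intro σ s v w h
    refine ⟨fun z hz => ?_, h.inp, h.mem⟩
    rw [Store.setReg_reg]
    simp only [State.setReg, Function.update_apply]
    split_ifs with h1 h2
    · rfl
    · omega
    · exact h.reg z hz
  -- Induction on the number d of rounds that remain.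
  have key : ∀ d i, i + d = N → ∀ s' σ', Bdd L s' → Sim L σ' s' → I i s' → s'.reg x = i →
      s'.reg y = N → ∃ t σ'' s'', Exec L.B
        (.while x y (p ⨟ .const 100 1 ⨟ .arith .add x x 100)) σ' t σ'' ∧
        t ≤ 1000 * (d * (T + 1)) + 1 ∧ Sim L σ'' s'' ∧ Bdd L s'' ∧ Q s'' := by
    intro d
    induction d with
    | zero =>
      intro i hi s' σ' hb' hσ' hI hix hiy
      refine ⟨1, σ', s', .whileFalse ?_, by omega, hσ', hb', hQ s' ?_ ?_⟩
      · rw [hσ'.reg x hx, hσ'.reg y hy]; omega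
      · rwa [show N = i by omega]
      · omega
    | succ d ih =>
      intro i hi s' σ' hb' hσ' hI hix hiy
      obtain ⟨t1, σ1, s1, h1, ht1, hσ1, hb1, hx1, hy1, hI1⟩ :=
        step i (by omega) s' hb' hI hix hiy hb' σ' hσ'
      have hval : Op.eval .add ((σ1.setReg 100 1).reg x) ((σ1.setReg 100 1).reg 100) = i + 1 := by
        have h100 : x ≠ 100 := by omega
        simp [State.setReg, Op.eval, h100, hσ1.reg x hx, hx1]
      have hsim := setx σ1 s1 (i + 1) 1 hσ1
      obtain ⟨t2, σ2, s2, h2, ht2, hσ2, hb2, hq2⟩ := ih (i + 1) (by omega) (s1.setReg x (i + 1))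
        ((σ1.setReg 100 1).setReg x (i + 1)) (hb1.setReg x (by omega)) hsim hI1 (by simp)
        (by simp [hxy, hy1])
      have harith := Exec.arith (B := L.B) (σ1.setReg 100 1) .add x x 100 (by rw [hval]; omega)
      rw [hval] at harith
      refine ⟨_, σ2, s2, .whileTrue (by rw [hσ'.reg x hx, hσ'.reg y hy]; omega)
        (.seq h1 (.seq (.const σ1 100 1 hB1) harith)) h2, ?_, hσ2, hb2, hq2⟩
      have : (d + 1) * (T + 1) = d * (T + 1) + T + 1 := by ring
      omega
  have hsim : Sim L (σ.setReg x 0) (s.setReg x 0) := by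
    refine ⟨fun z hz => ?_, hσ.inp, hσ.mem⟩
    rw [Store.setReg_reg]
    simp only [State.setReg, Function.update_apply]
    split_ifs with h1
    · rfl
    · exact hσ.reg z hz
  obtain ⟨t, σ', s', h1, h2, h3, h4, h5⟩ := key N 0 (by omega) (s.setReg x 0) (σ.setReg x 0)
    (hb.setReg x (by omega)) hsim h0 (by simp) (by simp [hxy, hN])
  refine ⟨_, σ', s', .seq (.const σ x 0 (by omega)) h1, ?_, h3, h4, h5⟩
  omega

end WP
end RAM
end DPconv

end

/-! ### Bit masks of sets, and the numerical code of ∞ -/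

section
open Finset

namespace DPconv

section Masks
variable {n : ℕ}
open Query

@[simp] theorem mem_ofMask {m : ℕ} {i : Fin n} : i ∈ ofMask n m ↔ m.testBit i = true := by
  simp [ofMask]

theorem testBit_iff_mod {m i : ℕ} : m.testBit i = true ↔ m / 2 ^ i % 2 = 1 := by
  rw [Nat.testBit_eq_decide_div_mod_eq, decide_eq_true_iff]

theorem testBit_iff_pos {m i : ℕ} : m.testBit i = true ↔ 0 < m / 2 ^ i % 2 := by
  rw [testBit_iff_mod]; omega

/-- Subtracting a submask never borrows, so subtraction of numbers is difference of sets. The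
induction strips the lowest bit. -/
theorem testBit_sub_of_subset (S T : ℕ) (h : ∀ i, T.testBit i = true → S.testBit i = true) :
    T ≤ S ∧ ∀ i, (S - T).testBit i = (S.testBit i && !T.testBit i) := by
  induction S using Nat.strong_induction_on generalizing T with
  | _ S ih =>
    have h0 := h 0
    rw [Nat.testBit_zero, Nat.testBit_zero, decide_eq_true_iff, decide_eq_true_iff] at h0
    by_cases hS : S = 0
    · have hT : T = 0 := by
        apply Nat.eq_of_testBit_eq
        intro i
        by_contra hc
        have h1 : T.testBit i = true := by simpa using hc
        have h2 := h i h1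
        rw [hS] at h2
        simp at h2
      simp [hS, hT]
    · obtain ⟨h1, h2⟩ := ih (S / 2) (by omega) (T / 2) (fun i => by
        rw [← Nat.testBit_add_one, ← Nat.testBit_add_one]; exact h (i + 1))
      refine ⟨by omega, fun i => ?_⟩
      cases i with
      | zero =>
        simp only [Nat.testBit_zero]
        by_cases ha : S % 2 = 1 <;> by_cases hb : T % 2 = 1 <;> simp [ha, hb] <;> omega
      | succ i =>
        rw [Nat.testBit_add_one, Nat.testBit_add_one, Nat.testBit_add_one, ← h2 i]
        congr 1
        omega

theorem testBit_imp_of_ofMask_subset {S T : ℕ} (hT : T < 2 ^ n) (h : ofMask n T ⊆ ofMask n S)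
    (i : ℕ) (hi : T.testBit i = true) : S.testBit i = true := by
  have hin : i < n := by
    by_contra hc
    have h1 : T < 2 ^ i := hT.trans_le (Nat.pow_le_pow_right (by norm_num) (by omega))
    rw [Nat.testBit_lt_two_pow h1] at hi
    exact absurd hi (by simp)
  exact mem_ofMask.1 (h ((mem_ofMask (i := ⟨i, hin⟩)).2 hi))

theorem le_of_ofMask_subset {S T : ℕ} (hT : T < 2 ^ n) (h : ofMask n T ⊆ ofMask n S) : T ≤ S :=
  (testBit_sub_of_subset S T (testBit_imp_of_ofMask_subset hT h)).1

theorem ofMask_sub {S T : ℕ} (hT : T < 2 ^ n) (h : ofMask n T ⊆ ofMask n S) :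
    ofMask n (S - T) = ofMask n S \ ofMask n T := by
  ext i
  rw [Finset.mem_sdiff, mem_ofMask, mem_ofMask, mem_ofMask,
    (testBit_sub_of_subset S T (testBit_imp_of_ofMask_subset hT h)).2]
  simp

theorem ofMask_injOn {S T : ℕ} (hS : S < 2 ^ n) (hT : T < 2 ^ n) (h : ofMask n S = ofMask n T) :
    S = T :=
  le_antisymm (le_of_ofMask_subset hS h.subset) (le_of_ofMask_subset hT h.superset)

theorem exists_ofMask (S : Finset (Fin n)) : ∃ m < 2 ^ n, ofMask n m = S := by
  have hinj : Function.Injective (fun m : Fin (2 ^ n) => ofMask n m.1) := fun a b h =>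
    Fin.ext (ofMask_injOn a.2 b.2 h)
  have hbij := (Fintype.bijective_iff_injective_and_card _).2 ⟨hinj, by simp⟩
  obtain ⟨m, hm⟩ := hbij.2 S
  exact ⟨m.1, m.2, hm⟩

theorem ofMask_two_pow (i : Fin n) : ofMask n (2 ^ (i : ℕ)) = {i} := by
  ext j
  rw [mem_ofMask, Nat.testBit_two_pow, decide_eq_true_iff, Finset.mem_singleton, Fin.ext_iff]
  exact eq_comm

theorem ofMask_full : ofMask n (2 ^ n - 1) = Finset.univ := by
  ext i; simp

theorem two_pow_lt (i : Fin n) : 2 ^ (i : ℕ) < 2 ^ n := Nat.pow_lt_pow_right (by norm_num) i.2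

theorem ofMask_erase {S : ℕ} {i : Fin n} (h : S.testBit i = true) :
    2 ^ (i : ℕ) ≤ S ∧ ofMask n (S - 2 ^ (i : ℕ)) = (ofMask n S).erase i := by
  have hs : ofMask n (2 ^ (i : ℕ)) ⊆ ofMask n S := by
    rw [ofMask_two_pow, Finset.singleton_subset_iff, mem_ofMask]; exact h
  refine ⟨le_of_ofMask_subset (two_pow_lt i) hs, ?_⟩
  rw [ofMask_sub (two_pow_lt i) hs, ofMask_two_pow, Finset.sdiff_singleton_eq_erase]

theorem card_ofMask (m : ℕ) : (ofMask n m).card = ∑ i ∈ Finset.range n, m / 2 ^ i % 2 := by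
  rw [ofMask, Finset.card_filter, Finset.sum_range]
  refine Finset.sum_congr rfl fun i _ => ?_
  split_ifs with h
  · exact (testBit_iff_mod.1 h).symm
  · rw [testBit_iff_pos] at h; omega

theorem ofMask_subset_iff {S T : ℕ} :
    ofMask n T ⊆ ofMask n S ↔ ∀ i < n, ¬ S / 2 ^ i % 2 < T / 2 ^ i % 2 := by
  constructor
  · intro h i hi hlt
    have h1 : T.testBit i = true := testBit_iff_pos.2 (by omega)
    have h2 := mem_ofMask.1 (h ((mem_ofMask (i := ⟨i, hi⟩)).2 h1))
    have : 0 < S / 2 ^ i % 2 := testBit_iff_pos.1 h2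
    omega
  · intro h i hi
    have h1 := testBit_iff_pos.1 (mem_ofMask.1 hi)
    exact mem_ofMask.2 (testBit_iff_pos.2 (by have := h i i.2; omega))

end Masks

section Encoding

/-- The number that stands for a value in `ℕ ∪ {∞}` when all finite values are at most `m`. -/
def code (m : ℕ) : ℕ∞ → ℕ
  | ⊤ => m + 1
  | (v : ℕ) => v

@[simp] theorem code_top (m : ℕ) : code m ⊤ = m + 1 := rfl
@[simp] theorem code_coe (m v : ℕ) : code m (v : ℕ∞) = v := rfl

/-- Finite values are at most `m`. -/
def Small (m : ℕ) (v : ℕ∞) : Prop := v ≠ ⊤ → v ≤ m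

theorem Small.top (m : ℕ) : Small m ⊤ := fun h => absurd rfl h

theorem small_coe {m v : ℕ} : Small m (v : ℕ∞) ↔ v ≤ m := by
  simp [Small]

theorem Small.code_le {m : ℕ} {v : ℕ∞} (h : Small m v) : code m v ≤ m + 1 := by
  induction v using ENat.recTopCoe with
  | top => simp
  | coe v => rw [small_coe] at h; simp; omega

theorem Small.code_lt {m : ℕ} {v : ℕ∞} (h : Small m v) : code m v < m + 1 ↔ v ≠ ⊤ := by
  induction v using ENat.recTopCoe with
  | top => simp
  | coe v => rw [small_coe] at h; simp; omega

theorem Small.coe_code {m : ℕ} {v : ℕ∞} (h : code m v < m + 1) : ((code m v : ℕ) : ℕ∞) = v := by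
  induction v using ENat.recTopCoe with
  | top => simp at h
  | coe v => simp

variable {n : ℕ}

/-- A split with an infinite part has a coded sum of at least m + 1, and a finite split has a sum of
at most m. Hence a running minimum of coded sums that starts at m + 1 ends at the code of the
minimum. -/
theorem code_minPlusConv {m : ℕ} {D : Finset (Fin n) → ℕ∞} {S : Finset (Fin n)} {r : ℕ}
    (hs : ∀ T ⊆ S, Small m (D T + D (S \ T))) (hr : r ≤ m + 1)
    (hle : ∀ T ⊆ S, r ≤ code m (D T) + code m (D (S \ T)))
    (hat : r < m + 1 → ∃ T ⊆ S, code m (D T) + code m (D (S \ T)) = r) :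
    r = code m (minPlusConv D D S) := by
  by_cases h : r < m + 1
  · obtain ⟨T, hT, hTr⟩ := hat h
    have : minPlusConv D D S = r := by
      apply le_antisymm
      · refine (iInf₂_le T (Finset.mem_powerset.2 hT)).trans ?_
        rw [← hTr]
        push_cast
        rw [Small.coe_code (by omega), Small.coe_code (by omega)]
      · refine le_iInf₂ fun U hU => ?_
        have hU := Finset.mem_powerset.1 hU
        have h1 := hle U hU
        by_cases ht : D U + D (S \ U) = ⊤
        · rw [ht]; exact le_top
        · have h2 := hs U hU
          rw [ENat.add_eq_top, not_or] at ht
          obtain ⟨a, ha⟩ := ENat.ne_top_iff_exists.1 ht.1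
          obtain ⟨b, hb⟩ := ENat.ne_top_iff_exists.1 ht.2
          rw [← ha, ← hb] at h1 ⊢
          simp only [code_coe] at h1
          exact_mod_cast h1
    rw [this]; rfl
  · have : minPlusConv D D S = ⊤ := by
      unfold minPlusConv
      rw [iInf₂_eq_top]
      intro U hU
      have hU := Finset.mem_powerset.1 hU
      have h1 := hle U hU
      have h2 := hs U hU
      by_contra ht
      have h3 := h2 ht
      rw [ENat.add_eq_top, not_or] at ht
      obtain ⟨a, ha⟩ := ENat.ne_top_iff_exists.1 ht.1
      obtain ⟨b, hb⟩ := ENat.ne_top_iff_exists.1 ht.2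
      rw [← ha, ← hb] at h1 h3
      simp only [code_coe] at h1
      have h4 : a + b ≤ m := by exact_mod_cast h3
      omega
    rw [this, code_top]; omega

end Encoding
end DPconv

end

/-! ### Tables of powers of two, cardinalities and connected sets -/

section
open Finset

namespace DPconv
namespace RAM
open DPconv.RAM.Expr DPconv.Query

/-- The contents of the registers with the dimensions of the instance. -/
structure Glob (L : Layout) (n m : ℕ) (s : Store) : Prop where
  r0 : s.reg 0 = L.off
  r1 : s.reg 1 = L.K
  r2 : s.reg 2 = n
  r3 : s.reg 3 = 2 ^ n
  r5 : s.reg 5 = m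
  r6 : s.reg 6 = m + 1
  r7 : s.reg 7 = m + 2
  r9 : s.reg 9 = 1 + n * n
  r10 : s.reg 10 = n + 1
  r11 : s.reg 11 = 2 * n - 1
  off : L.off = 1 + n * n + 2 ^ n
  K : L.K = m + n + 20
  hn : 2 ≤ n
  hm : n ≤ m
  V : 100 + 4 * 2 ^ n + 4 * m + n * n ≤ L.V

theorem Glob.of_frame' {L : Layout} {n m : ℕ} {s s' : Store} (h : Glob L n m s)
    (hf : ∀ z < 20, z ≠ 8 → s'.reg z = s.reg z) : Glob L n m s' where
  r0 := (hf 0 (by norm_num) (by norm_num)).trans h.r0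
  r1 := (hf 1 (by norm_num) (by norm_num)).trans h.r1
  r2 := (hf 2 (by norm_num) (by norm_num)).trans h.r2
  r3 := (hf 3 (by norm_num) (by norm_num)).trans h.r3
  r5 := (hf 5 (by norm_num) (by norm_num)).trans h.r5
  r6 := (hf 6 (by norm_num) (by norm_num)).trans h.r6
  r7 := (hf 7 (by norm_num) (by norm_num)).trans h.r7
  r9 := (hf 9 (by norm_num) (by norm_num)).trans h.r9
  r10 := (hf 10 (by norm_num) (by norm_num)).trans h.r10
  r11 := (hf 11 (by norm_num) (by norm_num)).trans h.r11
  off := h.off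
  K := h.K
  hn := h.hn
  hm := h.hm
  V := h.V

theorem Glob.of_frame {L : Layout} {n m lo : ℕ} {s s' : Store} (h : Glob L n m s)
    (hf : Frame lo s s') (hlo : 20 ≤ lo := by norm_num) : Glob L n m s' :=
  h.of_frame' fun z hz _ => hf z (by omega)

/-- The array agrees outside the column `k` of the plane `j`. -/
def SameBut (j k : ℕ) (s s' : Store) : Prop :=
  ∀ i' j' k', ¬ (j' = j ∧ k' = k) → s'.mem i' j' k' = s.mem i' j' k'

/-- Plane 0 collects the one-dimensional tables: column 1 for cardinalities, 2 for connectivity, 3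
for costs, 4 for powers of two, 5 for the stack of the tree output. Division by an entry of column 4
takes the place of a shift. -/
def powTable : Prog :=
  assign 21 1 ⨟ forLoop 20 2 (setMem (var 20) 0 4 (var 21) ⨟ assign 21 (var 21 + var 21))

theorem wp_powTable {L : Layout} {n m : ℕ} {s : Store} (hG : Glob L n m s) :
    WP L powTable (n * 3 + 2) s fun s' => Frame 20 s s' ∧ s'.inp = s.inp ∧ SameBut 0 4 s s' ∧
      ∀ i < n, s'.mem i 0 4 = 2 ^ i := by
  have hV := hG.V
  have hK := hG.K
  refine (WP.seq (WP.assign (by simp) (by simp; omega) (WP.forLoop n 2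
    (fun i s' => Frame 20 s s' ∧ s'.inp = s.inp ∧ SameBut 0 4 s s' ∧ s'.reg 21 = 2 ^ i ∧
      ∀ a < i, s'.mem a 0 4 = 2 ^ a) (by simp [hG.r2]) ?_ ?_ ?_))).le_time (by omega)
  · exact ⟨((Frame.refl _ _).setReg).setReg, rfl, fun _ _ _ _ => rfl, by simp, by simp⟩
  · rintro i hi s' hb ⟨hF, hin, hS, h21, hM⟩ h20 h2
    have hG' := hG.of_frame hF
    have hp : 2 ^ (i + 1) ≤ 2 ^ n := Nat.pow_le_pow_right (by norm_num) hi
    rw [pow_succ] at hp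
    refine WP.seq (WP.setMem (by simp [hG'.r0, hG'.r1]; omega) (by simp) (by simp [h21]; omega)
      (WP.assign (by simp) (by simp [h21]; omega) ?_))
    refine ⟨by simpa using h20, by simpa using h2, hF.setMem.setReg.setReg, hin, ?_, ?_, ?_⟩
    · intro a b c h
      simp only [Store.setReg_mem, Store.setMem_mem]
      rw [if_neg, hS a b c h]
      simp; omega
    · simp [h21, pow_succ]; omega
    · intro a ha
      simp only [Store.setReg_mem, Store.setMem_mem]
      split_ifs with h
      · simp [h, h20, h21]
      · refine hM a ?_
        simp [h20] at h
        omega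
  · rintro s' ⟨hF, hin, hS, h21, hM⟩ -
    exact ⟨hF, hin, hS, hM⟩

end RAM
end DPconv

end

section
open Finset

namespace DPconv
namespace RAM
open DPconv.RAM.Expr DPconv.Query

theorem Glob.two_pow_pos {L : Layout} {n m : ℕ} {s : Store} (_ : Glob L n m s) : 4 ≤ 2 ^ n :=
  (Nat.pow_le_pow_right (n := 2) (by norm_num) ‹Glob L n m s›.hn).trans' (by norm_num)

theorem SameBut.refl (j k : ℕ) (s : Store) : SameBut j k s s := fun _ _ _ _ => rfl

theorem SameBut.setMem {j k i v : ℕ} {s s' : Store} (h : SameBut j k s s') :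
    SameBut j k s (s'.setMem i j k v) := by
  intro a b c hn
  rw [Store.setMem_mem, if_neg, h a b c hn]
  exact fun h => hn h.2

theorem SameBut.setReg {j k x v : ℕ} {s s' : Store} (h : SameBut j k s s') :
    SameBut j k s (s'.setReg x v) := h

/-- The bit number `i` of `S`, by means of the table of the powers of two. -/
def bitE (S i : Expr) : Expr := S / mem i 0 4 % 2

@[simp] theorem eval_bitE (S i : Expr) (s : Store) :
    (bitE S i).eval s = S.eval s / s.mem (i.eval s) 0 4 % 2 := rfl

@[simp] theorem ok_bitE (L : Layout) (S i : Expr) (s : Store) :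
    (bitE S i).Ok L s ↔ (S.Ok L s ∧ i.Ok L s ∧ 0 < L.K ∧ 4 < L.K ∧ s.reg 0 = L.off ∧
      s.reg 1 = L.K) := by
  simp [bitE]

def popTable : Prog :=
  forLoop 20 3 (assign 21 0 ⨟ forLoop 22 2 (assign 21 (var 21 + bitE (var 20) (var 22))) ⨟
    setMem (var 20) 0 1 (var 21))

theorem wp_popTable {L : Layout} {n m : ℕ} {s : Store} (hG : Glob L n m s)
    (hP : ∀ i < n, s.mem i 0 4 = 2 ^ i) :
    WP L popTable (2 ^ n * (2 * n + 4) + 1) s fun s' => Frame 20 s s' ∧ s'.inp = s.inp ∧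
      SameBut 0 1 s s' ∧ ∀ S < 2 ^ n, s'.mem S 0 1 = (ofMask n S).card := by
  have hV := hG.V
  have hK := hG.K
  refine WP.le_time (WP.forLoop (2 ^ n) (2 * n + 3) (fun i s' => Frame 20 s s' ∧ s'.inp = s.inp ∧
    SameBut 0 1 s s' ∧ ∀ S < i, s'.mem S 0 1 = (ofMask n S).card) hG.r3 ?_ ?_ ?_) le_rfl
  · exact ⟨(Frame.refl _ _).setReg, rfl, SameBut.refl _ _ _, by simp⟩
  · rintro S hS s1 hb ⟨hF, hin, hB, hM⟩ h20 h3
    have hG1 := hG.of_frame hF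
    refine WP.le_time (WP.seq (WP.assign (by simp) (by simp; omega) (WP.seq
      (WP.forLoop n 1 (fun i s' => Frame 21 s1 s' ∧ s'.inp = s1.inp ∧ s'.mem = s1.mem ∧
        s'.reg 21 = ∑ i ∈ Finset.range i, S / 2 ^ i % 2) (by simp [hG1.r2]) ?_ ?_ ?_)))) (T := _ + (_ + 1)) (by omega)
    · exact ⟨((Frame.refl _ _).setReg).setReg, rfl, rfl, by simp⟩
    · rintro i hi s2 hb2 ⟨hF2, hin2, hm2, h21⟩ h22 h2
      have hG2 := hG1.of_frame hF2
      have hp : s2.mem i 0 4 = 2 ^ i := by rw [hm2, hB _ _ _ (by simp), hP i hi]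
      have e20 : s2.reg 20 = S := (hF2 20 (by norm_num)).trans h20
      have hle : ∑ j ∈ Finset.range i, S / 2 ^ j % 2 ≤ n := by
        refine (Finset.sum_le_card_nsmul _ _ 1 fun x _ => by omega).trans ?_
        simp; omega
      refine WP.assign (by simp [hG2.r0, hG2.r1]; omega) ?_ ?_
      · simp [h21, h22, e20, hp]; have := hG.hm; omega
      · refine ⟨by simpa using h22, by simpa using h2, hF2.setReg.setReg, hin2, hm2, ?_⟩
        simp [h21, h22, e20, hp, Finset.sum_range_succ]
    · rintro s2 ⟨hF2, hin2, hm2, h21⟩ h22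
      have hG2 := hG1.of_frame hF2
      have e20 : s2.reg 20 = S := (hF2 20 (by norm_num)).trans h20
      have hcard := card_ofMask (n := n) S
      have hcn : (ofMask n S).card ≤ n := (Finset.card_le_univ _).trans (by simp)
      have := hG.hm
      refine WP.setMem (by simp [hG2.r0, hG2.r1]; omega) (by simp)
        (by simp [h21, ← hcard]; omega) ?_
      refine ⟨by simpa using e20, by simpa using hG2.r3, ?_, ?_, ?_, ?_⟩
      · exact (hF.trans hF2).setMem.setReg
      · exact hin2.trans hin
      · intro a b c h
        simp only [Store.setReg_mem, Store.setMem_mem]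
        rw [if_neg, hm2, hB a b c h]
        simp; omega
      · intro T hT
        simp only [Store.setReg_mem, Store.setMem_mem]
        split_ifs with h
        · simp only [eval_var, e20] at h
          rw [h.1, hcard]; simp [h21]
        · rw [hm2]
          refine hM T ?_
          simp [e20] at h
          omega
  · rintro s' h -
    exact h

variable {n : ℕ}

/-- Adjacency of the relations with the given numbers. -/
def AdjNat (Q : Query n) (v u : ℕ) : Prop :=
  ∃ (hv : v < n) (hu : u < n), Q.graph.Adj ⟨v, hv⟩ ⟨u, hu⟩

def ConnMask (Q : Query n) (S : ℕ) : Prop := Q.Conn (ofMask n S)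

theorem connMask_iff (Q : Query n) {S : ℕ} (h : 2 ≤ (ofMask n S).card) :
    ConnMask Q S ↔ ∃ v < n, (S.testBit v = true ∧ ConnMask Q (S - 2 ^ v)) ∧
      ∃ u < n, S.testBit u = true ∧ AdjNat Q v u := by
  unfold ConnMask
  rw [Q.conn_iff h]
  constructor
  · rintro ⟨v, hv, hc, u, hu, huv⟩
    refine ⟨v, v.2, ⟨mem_ofMask.1 hv, ?_⟩, u, u.2, mem_ofMask.1 hu, v.2, u.2, huv⟩
    rwa [(ofMask_erase (mem_ofMask.1 hv)).2]
  · rintro ⟨v, hv, ⟨hvS, hc⟩, u, hu, huS, _, _, huv⟩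
    refine ⟨⟨v, hv⟩, mem_ofMask.2 hvS, ?_, ⟨u, hu⟩, mem_ofMask.2 huS, huv⟩
    rw [← (ofMask_erase (i := ⟨v, hv⟩) hvS).2]; exact hc

/-- The recursion of `Query.conn_iff`, with masks in increasing order. Products serve as
conjunctions; if the bit is 0, it does not matter which cell the truncated difference points to. -/
def connTable : Prog :=
  forLoop 20 3 (assign 21 0 ⨟
    cond (mem (var 20) 0 1) 2 (assign 21 (mem (var 20) 0 1))
      (forLoop 22 2 (cond 0 (bitE (var 20) (var 22) * mem (var 20 - mem (var 22) 0 4) 0 2)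
        (forLoop 23 2 (cond 0 (bitE (var 20) (var 23) * inp (1 + var 22 * var 2 + var 23))
          (assign 21 1) .skip)) .skip)) ⨟
    setMem (var 20) 0 2 (var 21))

open Classical in
theorem wp_connTable {L : Layout} {m : ℕ} {s : Store} (Q : Query n) (hG : Glob L n m s)
    (hP : ∀ i < n, s.mem i 0 4 = 2 ^ i) (hC : ∀ S < 2 ^ n, s.mem S 0 1 = (ofMask n S).card)
    (hA : ∀ v < n, ∀ u < n, s.inp (1 + v * n + u) = if AdjNat Q v u then 1 else 0) :
    WP L connTable (2 ^ n * (n * (4 * n + 4) + 6) + 1) s fun s' => Frame 20 s s' ∧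
      s'.inp = s.inp ∧ SameBut 0 2 s s' ∧
      ∀ S < 2 ^ n, s'.mem S 0 2 = if ConnMask Q S then 1 else 0 := by
  have hV := hG.V
  have hK := hG.K
  have h4 := hG.two_pow_pos
  refine WP.le_time (WP.forLoop (2 ^ n) (n * (4 * n + 4) + 5) (fun i s' => Frame 20 s s' ∧
    s'.inp = s.inp ∧ SameBut 0 2 s s' ∧
    ∀ S < i, s'.mem S 0 2 = if ConnMask Q S then 1 else 0) hG.r3 ?_ ?_ ?_) le_rfl
  · exact ⟨(Frame.refl _ _).setReg, rfl, SameBut.refl _ _ _, by simp⟩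
  · rintro S hS s1 hb ⟨hF, hin, hB, hM⟩ h20 h3
    have hG1 := hG.of_frame hF
    have hcS : s1.mem S 0 1 = (ofMask n S).card := by rw [hB _ _ _ (by simp), hC S hS]
    refine WP.le_time (WP.seq (WP.assign (by simp) (by simp; omega) (WP.seq
      (T := n * (4 * n + 4) + 3) (T' := 1) (WP.imp (Q := fun s' => Frame 21 s1 s' ∧
        s'.inp = s1.inp ∧ s'.mem = s1.mem ∧ s'.reg 21 = if ConnMask Q S then 1 else 0)
        ?_ ?_)))) (T := _ + (_ + 1)) (by omega)
    · refine WP.le_time (WP.cond 1 (n * (4 * n + 4) + 1) (by simp [hG1.r0, hG1.r1]; omega) (by simp)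
        ?_ ?_) (by omega)
      · intro hlt
        simp [h20, hcS] at hlt
        refine WP.assign (by simp [hG1.r0, hG1.r1]; omega) (by simp [h20, hcS]; omega) ?_
        refine ⟨(Frame.refl _ _).setReg.setReg, rfl, rfl, ?_⟩
        simp only [Store.setReg_reg, eval_mem, eval_var, Store.setReg_mem, eval_zero, eval_one]
        simp only [h20, if_true, show (20 : ℕ) ≠ 21 by norm_num, if_false, hcS]
        by_cases h1 : (ofMask n S).card = 1
        · rw [if_pos (show ConnMask Q S from Q.conn_of_card_eq_one h1), h1]
        · have h0 : (ofMask n S).card = 0 := by omega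
          rw [if_neg, h0]
          intro hc
          have := Finset.card_pos.2 hc.nonempty
          omega
      · intro hlt
        simp [h20, hcS] at hlt
        refine WP.forLoop n (4 * n + 3) (fun v s' => Frame 21 s1 s' ∧
          s'.inp = s1.inp ∧ s'.mem = s1.mem ∧ s'.reg 21 =
            if ∃ v' < v, (S.testBit v' = true ∧ ConnMask Q (S - 2 ^ v')) ∧
              ∃ u < n, S.testBit u = true ∧ AdjNat Q v' u then 1 else 0) (by simp [hG1.r2]) ?_ ?_ ?_
        · exact ⟨(Frame.refl _ _).setReg.setReg, rfl, rfl, by simp⟩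
        · rintro v hv s2 hb2 ⟨hF2, hin2, hm2, h21⟩ h22 h2
          have hG2 := hG1.of_frame hF2
          have hp : s2.mem v 0 4 = 2 ^ v := by rw [hm2, hB _ _ _ (by simp), hP v hv]
          have e20 : s2.reg 20 = S := (hF2 20 (by norm_num)).trans h20
          -- Only for a set bit is S - 2^v a smaller mask without v, whose entry is final.
          have hcv : S.testBit v = true →
              s2.mem (S - 2 ^ v) 0 2 = if ConnMask Q (S - 2 ^ v) then 1 else 0 := by
            intro h
            have h1 := (ofMask_erase (n := n) (i := ⟨v, hv⟩) h).1
            have h2 : 0 < 2 ^ v := by positivity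
            simp only at h1
            rw [hm2, hM _ (by omega)]
          refine WP.le_time (WP.cond (4 * n + 1) 1 (by simp)
            (by simp [hG2.r0, hG2.r1]; omega) ?_ ?_) (by omega)
          · intro hlt2
            simp [e20, h22, hp] at hlt2
            have hbit : S.testBit v = true := testBit_iff_pos.2 (by omega)
            have hconn : ConnMask Q (S - 2 ^ v) := by
              by_contra hcon
              rw [hcv hbit, if_neg hcon] at hlt2
              omega
            refine WP.le_time (WP.forLoop n 3 (fun j s' => Frame 21 s1 s' ∧
              s'.inp = s1.inp ∧ s'.mem = s1.mem ∧ s'.reg 22 = v ∧ s'.reg 21 =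
              if (∃ v' < v, (S.testBit v' = true ∧ ConnMask Q (S - 2 ^ v')) ∧
                ∃ u < n, S.testBit u = true ∧ AdjNat Q v' u) ∨
                ∃ u < j, S.testBit u = true ∧ AdjNat Q v u then 1 else 0) hG2.r2 ?_ ?_ ?_) (by omega)
            · refine ⟨hF2.setReg, hin2, hm2, by simpa using h22, ?_⟩
              simp only [Store.setReg_reg, show (21 : ℕ) ≠ 23 by norm_num, if_false, h21]
              simp
            · rintro u hu s3 hb3 ⟨hF3, hin3, hm3, h22', h21'⟩ h23 h2'
              have hG3 := hG1.of_frame hF3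
              have e20 : s3.reg 20 = S := (hF3 20 (by norm_num)).trans h20
              have hp : s3.mem u 0 4 = 2 ^ u := by rw [hm3, hB _ _ _ (by simp), hP u hu]
              have hvn : v * n + u < n * n := by nlinarith
              have ha : s3.inp (1 + v * n + u) = if AdjNat Q v u then 1 else 0 := by
                rw [hin3, hin, hA v hv u hu]
              refine WP.le_time (WP.cond 1 1 (by simp) (by
                simp [hG3.r0, hG3.r1, h22', h23, hG3.r2]
                have := hG3.off; omega) ?_ ?_) le_rfl
              · intro hlt3
                simp [e20, h23, hp, h22', hG3.r2, ha] at hlt3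
                split_ifs at hlt3 with hadj
                swap
                · omega
                have hbit' : S.testBit u = true := testBit_iff_pos.2 hlt3
                refine WP.assign (by simp) (by simp; omega) ?_
                refine ⟨by simpa using h23, by simpa using hG3.r2, hF3.setReg.setReg, hin3, hm3,
                  by simpa using h22', ?_⟩
                rw [if_pos]
                · simp
                · exact Or.inr ⟨u, by omega, hbit', hadj⟩
              · intro hlt3
                simp [e20, h23, hp, h22', hG3.r2, ha] at hlt3
                refine WP.skip ⟨h23, hG3.r2, hF3.setReg, hin3, hm3, by simpa using h22', ?_⟩
                simp only [Store.setReg_reg, show (21 : ℕ) ≠ 23 by norm_num, if_false, h21']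
                congr 1
                apply propext
                refine or_congr Iff.rfl ⟨?_, ?_⟩
                · rintro ⟨w, hw, h⟩; exact ⟨w, by omega, h⟩
                · rintro ⟨w, hw, h1, h2⟩
                  rcases Nat.lt_succ_iff_lt_or_eq.1 hw with h | rfl
                  · exact ⟨w, h, h1, h2⟩
                  · rw [testBit_iff_mod] at h1
                    have h3 := hlt3 h2
                    omega
            · rintro s3 ⟨hF3, hin3, hm3, h22', h21'⟩ h23
              have hG3 := hG1.of_frame hF3
              refine ⟨h22', hG3.r2, hF3.setReg, hin3, hm3, ?_⟩
              simp only [Store.setReg_reg, show (21 : ℕ) ≠ 22 by norm_num, if_false, h21']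
              congr 1
              apply propext
              constructor
              · rintro (⟨w, hw, h⟩ | h)
                · exact ⟨w, by omega, h⟩
                · exact ⟨v, by omega, ⟨hbit, hconn⟩, h⟩
              · rintro ⟨w, hw, h1, h2⟩
                rcases Nat.lt_succ_iff_lt_or_eq.1 hw with h | rfl
                · exact Or.inl ⟨w, h, h1, h2⟩
                · exact Or.inr h2
          · intro hlt2
            simp [e20, h22, hp] at hlt2
            refine WP.skip ⟨h22, hG2.r2, hF2.setReg, hin2, hm2, ?_⟩
            simp only [Store.setReg_reg, show (21 : ℕ) ≠ 22 by norm_num, if_false, h21]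
            congr 1
            apply propext
            constructor
            · rintro ⟨w, hw, h⟩; exact ⟨w, by omega, h⟩
            · rintro ⟨w, hw, ⟨h1, h1'⟩, h2⟩
              rcases Nat.lt_succ_iff_lt_or_eq.1 hw with h | rfl
              · exact ⟨w, h, ⟨h1, h1'⟩, h2⟩
              · have h3 := hcv h1
                rw [if_pos h1'] at h3
                rw [testBit_iff_mod] at h1
                rw [h1, h3] at hlt2
                omega
        · rintro s2 ⟨hF2, hin2, hm2, h21⟩ -
          refine ⟨hF2, hin2, hm2, ?_⟩
          rw [h21]
          congr 1
          exact propext (connMask_iff Q hlt).symm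
    · rintro s2 ⟨hF2, hin2, hm2, h21⟩
      have hG2 := hG1.of_frame hF2
      have e20 : s2.reg 20 = S := (hF2 20 (by norm_num)).trans h20
      refine WP.setMem (by simp [hG2.r0, hG2.r1]; omega) (by simp)
        (by simp [h21]; split_ifs <;> omega) ?_
      refine ⟨by simpa using e20, by simpa using hG2.r3, ?_, ?_, ?_, ?_⟩
      · exact (hF.trans hF2).setMem.setReg
      · exact hin2.trans hin
      · intro a b c h
        simp only [Store.setReg_mem, Store.setMem_mem]
        rw [if_neg, hm2, hB a b c h]
        simp; omega
      · intro T hT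
        simp only [Store.setReg_mem, Store.setMem_mem]
        split_ifs with h h'
        · simp only [eval_var, e20] at h
          rw [h.1] at h'
          simp [h21, h']
        · simp only [eval_var, e20] at h
          rw [h.1] at h'
          simp [h21, h']
        · rw [hm2, hM T, if_pos (by assumption)]
          simp [e20] at h; omega
        · rw [hm2, hM T, if_neg (by assumption)]
          simp [e20] at h; omega
  · rintro s' h -
    exact h

end RAM
end DPconv

end

/-! ### Bounds for costs, the initial table, and exhaustive search for a split -/

section
open Finset

namespace DPconv

section Bounds
variable {n : ℕ} (Q : Query n)

theorem small_optCost (S : Finset (Fin n)) : Small (Q.maxCard * n) (Q.optCost S) := by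
  intro h
  obtain ⟨v, hv, hle⟩ := Q.optCost_le_of_ne_top h
  have h1 : S.card ≤ n := (Finset.card_le_univ _).trans (by simp)
  have h2 := Nat.mul_le_mul_left Q.maxCard h1
  rw [hv]
  exact_mod_cast (by omega : v ≤ Q.maxCard * n)

/-- A table all of whose finite entries are optimal costs. -/
def PartialOpt (D : Finset (Fin n) → ℕ∞) : Prop := ∀ S, D S = ⊤ ∨ D S = Q.optCost S

variable {Q}

theorem PartialOpt.small {D : Finset (Fin n) → ℕ∞} (h : PartialOpt Q D) (S : Finset (Fin n)) :
    Small (Q.maxCard * n) (D S) := by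
  rcases h S with h | h <;> rw [h]
  exacts [Small.top _, small_optCost Q S]

/-- Trees for U and for T have |U ∪ T| - 2 joins altogether. This keeps the sum for a split below
the same bound m as a single cost, so degree m suffices for products. -/
theorem small_optCost_add {U T : Finset (Fin n)} (hd : Disjoint U T) :
    ∀ a b : ℕ, Q.optCost U = a → Q.optCost T = b →
      a + b + 2 * Q.maxCard ≤ Q.maxCard * (U ∪ T).card := by
  intro a b ha hb
  obtain ⟨a', ha', hle⟩ := Q.optCost_le_of_ne_top (S := U) (by rw [ha]; exact ENat.natCast_ne_top a)
  obtain ⟨b', hb', hle'⟩ := Q.optCost_le_of_ne_top (S := T) (by rw [hb]; exact ENat.natCast_ne_top b)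
  rw [ha] at ha'
  rw [hb] at hb'
  have h1 : a = a' := by exact_mod_cast ha'
  have h2 : b = b' := by exact_mod_cast hb'
  subst h1 h2
  rw [Finset.card_union_of_disjoint hd, mul_add]
  omega

theorem PartialOpt.small_add {D : Finset (Fin n) → ℕ∞} (h : PartialOpt Q D)
    (S T : Finset (Fin n)) : Small (Q.maxCard * n) (D T + D (S \ T)) := by
  intro hne
  rw [Ne, ENat.add_eq_top, not_or] at hne
  have h1 := (h T).resolve_left hne.1
  have h2 := (h (S \ T)).resolve_left hne.2
  obtain ⟨a, ha⟩ := ENat.ne_top_iff_exists.1 hne.1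
  obtain ⟨b, hb⟩ := ENat.ne_top_iff_exists.1 hne.2
  have h3 := small_optCost_add (Q := Q) (Finset.disjoint_sdiff (s := T) (t := S)) a b
    (by rw [← h1, ha]) (by rw [← h2, hb])
  have h4 : (T ∪ S \ T).card ≤ n := (Finset.card_le_univ _).trans (by simp)
  have h5 := Nat.mul_le_mul_left Q.maxCard h4
  rw [← ha, ← hb]
  exact_mod_cast (by omega : a + b ≤ Q.maxCard * n)

end Bounds

namespace RAM
open DPconv.RAM.Expr DPconv.Query

variable {n : ℕ}

/-- The column of the table of optimal costs holds the values of `D`. -/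
def DPCol (n m : ℕ) (D : Finset (Fin n) → ℕ∞) (s : Store) : Prop :=
  ∀ S < 2 ^ n, s.mem S 0 3 = code m (D (ofMask n S))

def initDP : Prog :=
  forLoop 20 3 (cond (mem (var 20) 0 1) 2
    (cond 0 (mem (var 20) 0 1) (setMem (var 20) 0 3 0) (setMem (var 20) 0 3 (var 6)))
    (setMem (var 20) 0 3 (var 6)))

theorem wp_initDP {L : Layout} {m : ℕ} {s : Store} (Q : Query n) (hG : Glob L n m s)
    (hC : ∀ S < 2 ^ n, s.mem S 0 1 = (ofMask n S).card) :
    WP L initDP (2 ^ n * 6 + 1) s fun s' => Frame 20 s s' ∧ s'.inp = s.inp ∧ SameBut 0 3 s s' ∧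
      DPCol n m (dpTable Q 1) s' := by
  have hV := hG.V
  have hK := hG.K
  refine WP.le_time (WP.forLoop (2 ^ n) 5 (fun i s' => Frame 20 s s' ∧ s'.inp = s.inp ∧
    SameBut 0 3 s s' ∧ ∀ S < i, s'.mem S 0 3 = code m (dpTable Q 1 (ofMask n S))) hG.r3 ?_ ?_ ?_)
    (by omega)
  · exact ⟨(Frame.refl _ _).setReg, rfl, SameBut.refl _ _ _, by simp⟩
  · rintro S hS s1 hb ⟨hF, hin, hB, hM⟩ h20 h3
    have hG1 := hG.of_frame hF
    have hcS : s1.mem S 0 1 = (ofMask n S).card := by rw [hB _ _ _ (by simp), hC S hS]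
    have post : ∀ v, v = code m (dpTable Q 1 (ofMask n S)) →
        (s1.setMem S 0 3 v).reg 20 = S ∧ (s1.setMem S 0 3 v).reg 3 = 2 ^ n ∧
        Frame 20 s ((s1.setMem S 0 3 v).setReg 20 (S + 1)) ∧
        ((s1.setMem S 0 3 v).setReg 20 (S + 1)).inp = s.inp ∧
        SameBut 0 3 s ((s1.setMem S 0 3 v).setReg 20 (S + 1)) ∧
        ∀ T < S + 1, ((s1.setMem S 0 3 v).setReg 20 (S + 1)).mem T 0 3 =
          code m (dpTable Q 1 (ofMask n T)) := by
      intro v hv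
      refine ⟨h20, h3, hF.setMem.setReg, hin, hB.setMem.setReg, ?_⟩
      intro T hT
      simp only [Store.setReg_mem, Store.setMem_mem]
      split_ifs with h
      · rw [hv, h.1]
      · exact hM T (by simp at h; omega)
    have hd : dpTable Q 1 (ofMask n S) = if (ofMask n S).card = 1 then 0 else ⊤ := rfl
    refine WP.le_time (WP.cond 3 1 (by simp [hG1.r0, hG1.r1]; omega) (by simp) ?_ ?_) (by omega)
    · intro h1
      refine WP.le_time (WP.cond 1 1 (by simp) (by simp [hG1.r0, hG1.r1]; omega) ?_ ?_) (by omega)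
      · intro h2
        simp [h20, hcS] at h1 h2
        refine WP.setMem (by simp [hG1.r0, hG1.r1]; omega) (by simp) (by simp; omega) ?_
        simp only [eval_var, eval_ofNat, h20]
        apply post
        rw [hd, if_pos]
        · rfl
        · have := Finset.card_pos.2 h2; omega
      · intro h2
        simp [h20, hcS] at h1 h2
        refine WP.setMem (by simp [hG1.r0, hG1.r1]; omega) (by simp) (by simp [hG1.r6]; omega) ?_
        simp only [eval_var, eval_ofNat, h20]
        apply post
        rw [hd, if_neg, hG1.r6]
        · rfl
        · simp [h2]
    · intro h1
      simp [h20, hcS] at h1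
      refine WP.setMem (by simp [hG1.r0, hG1.r1]; omega) (by simp) (by simp [hG1.r6]; omega) ?_
      simp only [eval_var, eval_ofNat, h20]
      apply post
      rw [hd, if_neg, hG1.r6]
      · rfl
      · omega
  · rintro s' h -
    exact h

/-- Given `S` in register 30, find the best split of `S` by inspecting all subsets. -/
def findMin : Prog :=
  assign 31 (var 6) ⨟ assign 32 0 ⨟ forLoop 33 3
    (assign 34 1 ⨟
      forLoop 35 2 (cond (bitE (var 30) (var 35)) (bitE (var 33) (var 35)) (assign 34 0) .skip) ⨟
      cond 0 (var 34) (assign 36 (mem (var 33) 0 3 + mem (var 30 - var 33) 0 3) ⨟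
        cond (var 36) (var 31) (assign 31 (var 36) ⨟ assign 32 (var 33)) .skip) .skip)

/-- Register 31 is a running minimum that starts at the code m + 1 of ∞, and register 32 is a mask
attaining it. Since updates need a strict decrease, register 32 is meaningful once register 31 is
below m + 1. -/
theorem wp_findMin {L : Layout} {m : ℕ} {s : Store} (hG : Glob L n m s)
    (hP : ∀ i < n, s.mem i 0 4 = 2 ^ i) {D : Finset (Fin n) → ℕ∞} (hD : DPCol n m D s)
    (hsm : ∀ S, Small m (D S)) {S : ℕ} (hS : S < 2 ^ n) (h30 : s.reg 30 = S)
    (hsa : ∀ T ⊆ ofMask n S, Small m (D T + D (ofMask n S \ T))) :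
    WP L findMin (2 ^ n * (4 * n + 10) + 3) s fun s' => Frame 31 s s' ∧ s'.inp = s.inp ∧
      s'.mem = s.mem ∧ s'.reg 31 = code m (minPlusConv D D (ofMask n S)) ∧
      (s'.reg 31 < m + 1 → s'.reg 32 < 2 ^ n ∧ ofMask n (s'.reg 32) ⊆ ofMask n S ∧
        code m (D (ofMask n (s'.reg 32))) + code m (D (ofMask n S \ ofMask n (s'.reg 32))) =
          s'.reg 31) := by
  have hV := hG.V
  have hK := hG.K
  let c : ℕ → ℕ := fun T => code m (D (ofMask n T)) + code m (D (ofMask n S \ ofMask n T))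
  have hcle : ∀ X, code m (D X) ≤ m + 1 := fun X => (hsm X).code_le
  refine WP.le_time (WP.seq (WP.assign (by simp) (by simp [hG.r6]; omega) (WP.seq
    (WP.assign (by simp) (by simp; omega) (WP.forLoop (2 ^ n) (4 * n + 9) (fun i s' =>
      Frame 31 s s' ∧ s'.inp = s.inp ∧ s'.mem = s.mem ∧ s'.reg 31 ≤ m + 1 ∧
      (∀ T < i, ofMask n T ⊆ ofMask n S → s'.reg 31 ≤ c T) ∧
      (s'.reg 31 < m + 1 → s'.reg 32 < 2 ^ n ∧ ofMask n (s'.reg 32) ⊆ ofMask n S ∧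
        c (s'.reg 32) = s'.reg 31)) (by simp [hG.r3]) ?_ ?_ ?_))))) (le_of_eq (by ring))
  · exact ⟨((Frame.refl _ _).setReg).setReg.setReg, rfl, rfl, by simp [hG.r6], by simp,
      by simp [hG.r6]⟩
  · rintro T hT s1 hb ⟨hF, hin, hm, h31, hle, hat⟩ h33 h3
    have hG1 := hG.of_frame hF
    have e30 : s1.reg 30 = S := (hF 30 (by norm_num)).trans h30
    refine WP.le_time (WP.seq (WP.assign (by simp) (by simp; omega) (WP.seq
      (WP.forLoop n 3 (fun i s' => Frame 34 s1 s' ∧ s'.inp = s1.inp ∧ s'.mem = s1.mem ∧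
        s'.reg 34 = if ∀ j < i, ¬ S / 2 ^ j % 2 < T / 2 ^ j % 2 then 1 else 0)
        (by simp [hG1.r2]) ?_ ?_ ?_)))) (T := 1 + ((n * (3 + 1) + 1) + 7)) (by omega)
    · exact ⟨((Frame.refl _ _).setReg).setReg, rfl, rfl, by simp⟩
    · rintro i hi s2 hb2 ⟨hF2, hin2, hm2, h34⟩ h35 h2
      have hG2 := hG1.of_frame hF2
      have hp : s2.mem i 0 4 = 2 ^ i := by rw [hm2, hm, hP i hi]
      have e30' : s2.reg 30 = S := (hF2 30 (by norm_num)).trans e30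
      have e33 : s2.reg 33 = T := (hF2 33 (by norm_num)).trans h33
      refine WP.cond 1 1 (by simp [hG2.r0, hG2.r1]; omega) (by simp [hG2.r0, hG2.r1]; omega) ?_ ?_
      · intro hlt
        simp [e30', e33, h35, hp] at hlt
        refine WP.assign (by simp) (by simp; omega) ?_
        refine ⟨by simpa using h35, by simpa using h2, hF2.setReg.setReg, hin2, hm2, ?_⟩
        rw [if_neg]
        · simp
        · intro h; exact h i (by omega) hlt
      · intro hlt
        simp only [eval_bitE, eval_var, e30', e33, h35, hp] at hlt
        refine WP.skip ⟨h35, h2, hF2.setReg, hin2, hm2, ?_⟩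
        simp only [Store.setReg_reg, show (34 : ℕ) ≠ 35 by norm_num, if_false, h34]
        congr 1
        apply propext
        constructor
        · intro h j hj
          rcases Nat.lt_succ_iff_lt_or_eq.1 hj with hj | rfl
          exacts [h j hj, hlt]
        · intro h j hj
          exact h j (by omega)
    · rintro s2 ⟨hF2, hin2, hm2, h34⟩ -
      have hG2 := hG1.of_frame hF2
      have e30' : s2.reg 30 = S := (hF2 30 (by norm_num)).trans e30
      have e33 : s2.reg 33 = T := (hF2 33 (by norm_num)).trans h33
      have e31 : s2.reg 31 = s1.reg 31 := hF2 31 (by norm_num)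
      have e32 : s2.reg 32 = s1.reg 32 := hF2 32 (by norm_num)
      have hF3 : Frame 31 s s2 := hF.trans (fun z hz => hF2 z (by omega))
      refine WP.le_time (WP.cond 5 1 (by simp) (by simp) ?_ ?_) (by omega)
      · intro hlt
        have hsub : ofMask n T ⊆ ofMask n S := by
          rw [ofMask_subset_iff]
          by_contra hcon
          rw [eval_var, h34, if_neg hcon] at hlt
          simp at hlt
        have hcell : s2.mem T 0 3 + s2.mem (S - T) 0 3 = c T := by
          have hle := Nat.sub_le S T
          rw [hm2, hm, hD T hT, hD (S - T) (by omega), ofMask_sub hT hsub]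
        have hcb : c T ≤ 2 * m + 2 := by
          have h1 := hcle (ofMask n T)
          have h2 := hcle (ofMask n S \ ofMask n T)
          simp only [c]; omega
        refine WP.le_time (WP.seq (WP.assign (by simp [hG2.r0, hG2.r1]; omega)
          (by simp [e30', e33, hcell]; omega) (WP.cond 2 1 (by simp) (by simp) ?_ ?_))) (by omega)
        · intro hlt2
          simp [e30', e33, hcell, e31] at hlt2
          refine WP.le_time (WP.seq (WP.assign (by simp) (by simp [e30', e33, hcell]; omega)
            (WP.assign (by simp) (by simp [e33]; omega) ?_))) (by omega)
          simp only [eval_add, eval_mem, eval_var, eval_sub, eval_ofNat, e30', e33, hcell]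
          refine ⟨by simp [e33], by simp [hG2.r3], hF3.setReg.setReg.setReg.setReg, hin2.trans hin,
            hm2.trans hm, ?_, ?_, ?_⟩
          · simp; omega
          · intro U hU hUS
            simp
            rcases Nat.lt_succ_iff_lt_or_eq.1 hU with h | rfl
            · exact hlt2.le.trans (hle U h hUS)
            · exact le_rfl
          · intro _
            simp [e33, hT, hsub]
        · intro hlt2
          simp [e30', e33, hcell, e31] at hlt2
          simp only [eval_add, eval_mem, eval_var, eval_sub, eval_ofNat, e30', e33, hcell]
          refine WP.skip ⟨by simp [e33], by simp [hG2.r3], hF3.setReg.setReg, hin2.trans hin,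
            hm2.trans hm, ?_, ?_, ?_⟩
          · simp [e31]; omega
          · intro U hU hUS
            simp [e31]
            rcases Nat.lt_succ_iff_lt_or_eq.1 hU with h | rfl
            · exact hle U h hUS
            · exact hlt2
          · simpa [e31, e32] using hat
      · intro hlt
        have hsub : ¬ ofMask n T ⊆ ofMask n S := by
          rw [ofMask_subset_iff]
          intro hcon
          rw [eval_var, h34, if_pos hcon] at hlt
          simp at hlt
        refine WP.skip ⟨by simp [e33], by simp [hG2.r3], hF3.setReg, hin2.trans hin,
            hm2.trans hm, ?_, ?_, ?_⟩
        · simp [e31]; omega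
        · intro U hU hUS
          simp [e31]
          rcases Nat.lt_succ_iff_lt_or_eq.1 hU with h | rfl
          · exact hle U h hUS
          · exact absurd hUS hsub
        · simpa [e31, e32] using hat
  · rintro s' ⟨hF, hin, hm, h31, hle, hat⟩ -
    refine ⟨hF, hin, hm, ?_, hat⟩
    apply code_minPlusConv hsa h31
    · intro X hX
      obtain ⟨T, hT, rfl⟩ := exists_ofMask X
      exact hle T hT hX
    · intro h
      exact ⟨_, (hat h).2.1, (hat h).2.2⟩

end RAM
end DPconv

end

/-! ### The dynamic program over all pairs of masks, for large costs -/

section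
open Finset

namespace DPconv
namespace RAM
open DPconv.RAM.Expr DPconv.Query

variable {n : ℕ}

/-- The dynamic program over all pairs of masks. -/
def quadraticDP : Prog :=
  forLoop 20 3 (cond 1 (mem (var 20) 0 1) (cond 0 (mem (var 20) 0 2)
    (assign 30 (var 20) ⨟ findMin ⨟ cond (var 31) (var 6)
      (setMem (var 20) 0 3 (var 31 + inp (var 9 + var 20))) .skip) .skip) .skip)

open Classical in
/-- The table in which the masks below `i` are done. -/
noncomputable def doneBelow (Q : Query n) (i : ℕ) (X : Finset (Fin n)) : ℕ∞ :=
  if ∃ T < i, ofMask n T = X then Q.optCost X else dpTable Q 1 X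

theorem doneBelow_ofMask (Q : Query n) {i T : ℕ} (hi : i ≤ 2 ^ n) (hT : T < 2 ^ n) :
    doneBelow Q i (ofMask n T) =
      if T < i then Q.optCost (ofMask n T) else dpTable Q 1 (ofMask n T) := by
  unfold doneBelow
  congr 1
  apply propext
  constructor
  · rintro ⟨U, hU, h⟩
    rwa [← ofMask_injOn (by omega) hT h]
  · intro h
    exact ⟨T, h, rfl⟩

theorem partialOpt_dpTable (Q : Query n) (k : ℕ) : PartialOpt Q (dpTable Q (k + 1)) := by
  intro S
  rw [dpTable_eq]
  split_ifs
  exacts [Or.inr rfl, Or.inl rfl]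

theorem partialOpt_doneBelow (Q : Query n) (i : ℕ) : PartialOpt Q (doneBelow Q i) := by
  intro S
  unfold doneBelow
  split_ifs
  exacts [Or.inr rfl, partialOpt_dpTable Q 0 S]

open Classical in
-- A proper subset has a smaller mask, so in increasing order all parts of S are final when S is
-- reached, and Bellman's equation gives the entry.
theorem wp_quadraticDP {L : Layout} {s : Store} (Q : Query n) (hG : Glob L n (Q.maxCard * n) s)
    (hP : ∀ i < n, s.mem i 0 4 = 2 ^ i) (hC : ∀ S < 2 ^ n, s.mem S 0 1 = (ofMask n S).card)
    (hN : ∀ S < 2 ^ n, s.mem S 0 2 = if ConnMask Q S then 1 else 0)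
    (hc : ∀ S < 2 ^ n, Q.Joinable (ofMask n S) → s.inp (1 + n * n + S) = Q.card (ofMask n S))
    (hD : DPCol n (Q.maxCard * n) (dpTable Q 1) s) :
    WP L quadraticDP (2 ^ n * (2 ^ n * (4 * n + 10) + 12) + 1) s fun s' => Frame 20 s s' ∧
      s'.inp = s.inp ∧ SameBut 0 3 s s' ∧ DPCol n (Q.maxCard * n) Q.optCost s' := by
  have hV := hG.V
  have hK := hG.K
  refine WP.le_time (WP.forLoop (2 ^ n) (2 ^ n * (4 * n + 10) + 11) (fun i s' => Frame 20 s s' ∧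
    s'.inp = s.inp ∧ SameBut 0 3 s s' ∧ DPCol n (Q.maxCard * n) (doneBelow Q i) s') hG.r3
    ?_ ?_ ?_) (by ring_nf; omega)
  · refine ⟨(Frame.refl _ _).setReg, rfl, SameBut.refl _ _ _, ?_⟩
    intro S hS
    rw [doneBelow_ofMask Q (by omega) hS]
    exact hD S hS
  · rintro S hS s1 hb ⟨hF, hin, hB, hM⟩ h20 h3
    have hG1 := hG.of_frame hF
    have hcS : s1.mem S 0 1 = (ofMask n S).card := by rw [hB _ _ _ (by simp), hC S hS]
    have hnS : s1.mem S 0 2 = if ConnMask Q S then 1 else 0 := by rw [hB _ _ _ (by simp), hN S hS]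
    have hsucc : ∀ T < 2 ^ n, T ≠ S →
        doneBelow Q (S + 1) (ofMask n T) = doneBelow Q S (ofMask n T) := by
      intro T hT hne
      rw [doneBelow_ofMask Q (by omega) hT, doneBelow_ofMask Q (by omega) hT]
      congr 1
      apply propext
      omega
    have hself : doneBelow Q (S + 1) (ofMask n S) = Q.optCost (ofMask n S) := by
      rw [doneBelow_ofMask Q (by omega) hS, if_pos (by omega)]
    have hself' : doneBelow Q S (ofMask n S) = dpTable Q 1 (ofMask n S) := by
      rw [doneBelow_ofMask Q (by omega) hS, if_neg (by omega)]
    -- Leaving the cell alone is right in three cases: at most one relation, a disconnected set, and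
    -- a set without a finite split.
    have stay : Q.optCost (ofMask n S) = dpTable Q 1 (ofMask n S) → ∀ s2 : Store,
        s2.mem = s1.mem → DPCol n (Q.maxCard * n) (doneBelow Q (S + 1)) s2 := by
      intro h s2 hm T hT
      rw [hm, hM T hT]
      by_cases hTS : T = S
      · rw [hTS, hself, hself', h]
      · rw [hsucc T hT hTS]
    have hd1 : dpTable Q 1 (ofMask n S) =
        if (ofMask n S).card ≤ 1 then Q.optCost (ofMask n S) else ⊤ := dpTable_eq Q 0 _
    refine WP.le_time (WP.cond (2 ^ n * (4 * n + 10) + 9) 1 (by simp)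
      (by simp [hG1.r0, hG1.r1]; omega) ?_ ?_) (by omega)
    · intro h1
      simp [h20, hcS] at h1
      refine WP.le_time (WP.cond (2 ^ n * (4 * n + 10) + 7) 1 (by simp)
        (by simp [hG1.r0, hG1.r1]; omega) ?_ ?_) (by omega)
      · intro h2
        have hconn : ConnMask Q S := by
          by_contra hcon
          simp [h20, hnS, hcon] at h2
        have hJ : Q.Joinable (ofMask n S) := ⟨h1, hconn⟩
        refine WP.le_time (WP.seq (WP.assign (by simp) (by simp [h20]; omega) (WP.seq
          (WP.imp (wp_findMin (m := Q.maxCard * n) (n := n) (S := S) (D := doneBelow Q S) ?_ ?_ ?_ ?_ hS ?_ ?_) ?_))))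
          (T := 1 + (_ + 3)) (by omega)
        · exact hG1.of_frame (Frame.refl 20 s1).setReg
        · intro i hi
          rw [Store.setReg_mem, hB _ _ _ (by simp), hP i hi]
        · exact hM
        · exact (partialOpt_doneBelow Q S).small
        · simp [h20]
        · exact fun T _ => (partialOpt_doneBelow Q S).small_add _ _
        · rintro s2 ⟨hF2, hin2, hm2, h31, -⟩
          have hF2' : Frame 20 s s2 := (hF.trans (Frame.refl 20 s1).setReg).trans hF2
          have hG2 := hG.of_frame hF2'
          have e20 : s2.reg 20 = S := by rw [hF2 20 (by norm_num)]; simp [h20]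
          have hopt : Q.optCost (ofMask n S) =
              minPlusConv (doneBelow Q S) (doneBelow Q S) (ofMask n S) + Q.card (ofMask n S) := by
            rw [Q.optCost_eq h1]
            have hjc : Q.joinCard (ofMask n S) = Q.card (ofMask n S) := by
              unfold Query.joinCard; exact if_pos hJ
            rw [hjc]
            congr 1
            apply minPlusConv_congr Q.optCost_empty
            · have := (partialOpt_doneBelow Q S) ∅
              rwa [Q.optCost_empty, or_self] at this
            · intro X hX hne
              obtain ⟨T, hT, rfl⟩ := exists_ofMask X
              have h5 := le_of_ofMask_subset hT hX
              have h6 : T ≠ S := fun h => hne (by rw [h])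
              rw [doneBelow_ofMask Q (by omega) hT, if_pos (by omega)]
          have hcS2 : s2.inp (1 + n * n + S) = Q.card (ofMask n S) := by
            rw [hin2, Store.setReg_inp, hin, hc S hS hJ]
          have hcle : Q.card (ofMask n S) ≤ Q.maxCard * n :=
            (Q.card_le_maxCard hJ).trans (Nat.le_mul_of_pos_right _ (by have := hG.hn; omega))
          refine WP.le_time (WP.cond 1 1 (by simp) (by simp) ?_ ?_) (by omega)
          · intro h5
            simp only [eval_var, hG2.r6] at h5
            refine WP.setMem (by simp [hG2.r0, hG2.r1]; omega)
              (by simp [hG2.r9, e20]; have := hG.off; omega)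
              (by simp [hG2.r9, e20, hcS2]; omega) ?_
            simp only [eval_var, eval_add, eval_inp, eval_ofNat, hG2.r9, e20, hcS2]
            refine ⟨by simpa using e20, by simpa using hG2.r3, hF2'.setMem.setReg,
              hin2.trans hin, ?_, ?_⟩
            · intro a b c h
              simp only [Store.setReg_mem, Store.setMem_mem]
              rw [if_neg, hm2]
              · exact hB a b c h
              · exact fun h' => h h'.2
            · intro T hT
              simp only [Store.setReg_mem, Store.setMem_mem]
              by_cases hTS : T = S
              · subst hTS
                rw [if_pos (by simp), hself, hopt]
                have := Small.coe_code (m := Q.maxCard * n) (h31 ▸ h5)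
                rw [← this, ← h31, ← Nat.cast_add, code_coe]
              · rw [if_neg (by simp [hTS]), hm2, Store.setReg_mem, hM T hT, hsucc T hT hTS]
          · intro h5
            simp only [eval_var, hG2.r6] at h5
            refine WP.skip ⟨e20, hG2.r3, hF2'.setReg, hin2.trans hin, ?_, ?_⟩
            · intro a b c h
              rw [Store.setReg_mem, hm2]
              exact hB a b c h
            · refine stay ?_ _ ?_
              · rw [hd1, if_neg (by omega), hopt]
                rw [h31, Small.code_lt, not_not] at h5
                · rw [h5]; rfl
                · intro hne
                  by_contra hcon
                  apply h5
                  rw [Small.code_lt]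
                  · exact hne
                  · have := small_optCost Q (ofMask n S)
                    rw [hopt] at this
                    intro _
                    refine le_self_add.trans (this ?_)
                    rw [Ne, ENat.add_eq_top, not_or]
                    exact ⟨hne, ENat.natCast_ne_top _⟩
              · rw [Store.setReg_mem, hm2, Store.setReg_mem]
      · intro h2
        have hconn : ¬ ConnMask Q S := by
          intro hcon
          simp [h20, hnS, hcon] at h2
        refine WP.skip ⟨h20, h3, hF.setReg, hin, hB.setReg, stay ?_ _ rfl⟩
        rw [hd1, if_neg (by omega), Q.optCost_eq_top_of_not_conn hconn]
    · intro h1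
      simp [h20, hcS] at h1
      refine WP.skip ⟨h20, h3, hF.setReg, hin, hB.setReg, stay ?_ _ rfl⟩
      rw [hd1, if_pos (by omega)]
  · rintro s' ⟨hF, hin, hB, hM⟩ -
    refine ⟨hF, hin, hB, fun S hS => ?_⟩
    rw [hM S hS, doneBelow_ofMask Q le_rfl hS, if_pos hS]

end RAM
end DPconv

end

/-! ### Writing an optimal tree in prefix notation -/

section
open Finset

namespace DPconv
namespace RAM
open DPconv.RAM.Expr DPconv.Query

variable {n : ℕ}

/-- A stack of numbers in a column of the array, listed from its top. -/
def StackHolds (s : Store) : List ℕ → Prop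
  | [] => True
  | S :: st => s.mem st.length 0 5 = S ∧ StackHolds s st

theorem StackHolds.congr {s s' : Store} {st : List ℕ} (h : StackHolds s st)
    (hm : ∀ i < st.length, s'.mem i 0 5 = s.mem i 0 5) : StackHolds s' st := by
  induction st with
  | nil => trivial
  | cons S st ih =>
    refine ⟨(hm _ (by simp)).trans h.1, ih h.2 fun i hi => hm i (by simp; omega)⟩

/-- An optimal join tree for the set of relations with mask `S`. -/
def OptTree (Q : Query n) (S : ℕ) (T : JoinTree n) : Prop :=
  T.Valid Q.graph ∧ T.rels = ofMask n S ∧ (T.costOut Q.card : ℕ∞) = Q.optCost (ofMask n S)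

/-- The split attains the minimum in Bellman's equation, and S is connected because its cost is
finite. -/
theorem OptTree.join {Q : Query n} {S T : ℕ} (hS : 2 ≤ (ofMask n S).card)
    (hT : T < 2 ^ n) (hne : Q.optCost (ofMask n S) ≠ ⊤) (hTS : ofMask n T ⊆ ofMask n S)
    (heq : Q.optCost (ofMask n T) + Q.optCost (ofMask n S \ ofMask n T) =
      minPlusConv Q.optCost Q.optCost (ofMask n S))
    {l r : JoinTree n} (hl : OptTree Q T l) (hr : OptTree Q (S - T) r) :
    OptTree Q S (.join l r) := by
  have hconn : Q.Conn (ofMask n S) := by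
    by_contra hcon
    exact hne (Q.optCost_eq_top_of_not_conn hcon)
  have hJ : Q.Joinable (ofMask n S) := ⟨hS, hconn⟩
  obtain ⟨hl1, hl2, hl3⟩ := hl
  obtain ⟨hr1, hr2, hr3⟩ := hr
  rw [ofMask_sub hT hTS] at hr2 hr3
  obtain ⟨hv, hrel⟩ := Q.valid_join_of_split hconn hTS hl1 hr1 hl2 hr2
  refine ⟨hv, hrel, ?_⟩
  have h3 : (JoinTree.join l r).costOut Q.card
      = Q.card (ofMask n S) + l.costOut Q.card + r.costOut Q.card := by
    rw [← hrel]; rfl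
  have hjc : Q.joinCard (ofMask n S) = Q.card (ofMask n S) := by
    unfold Query.joinCard; exact if_pos hJ
  rw [h3, Q.optCost_eq hS, ← heq, ← hl3, ← hr3, hjc]
  push_cast; ring

/-- Number of nodes of the trees for the masks on the stack. -/
def stackWeight (n : ℕ) (st : List ℕ) : ℕ := (st.map fun S => 2 * (ofMask n S).card - 1).sum

theorem Query.one_le_card_of_optCost {Q : Query n} {S : Finset (Fin n)} (h : Q.optCost S ≠ ⊤) :
    1 ≤ S.card := by
  rw [Nat.one_le_iff_ne_zero, Ne, Finset.card_eq_zero]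
  rintro rfl
  exact h Q.optCost_empty

/-- Every pending tree has at least one node; this bounds the height of the stack, which the machine
keeps in a register. -/
theorem length_le_stackWeight {st : List ℕ} (h : ∀ S ∈ st, 1 ≤ (ofMask n S).card) :
    st.length ≤ stackWeight n st := by
  induction st with
  | nil => simp
  | cons S st ih =>
    have h1 := h S (by simp)
    have h2 := ih fun X hX => h X (List.mem_cons_of_mem _ hX)
    simp only [stackWeight, List.map_cons, List.sum_cons, List.length_cons] at h2 ⊢
    omega

def writeLeaf : Prog :=
  forLoop 23 2 (cond 0 (bitE (var 30) (var 23)) (setInp (var 22) (var 23 + 1)) .skip)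

theorem wp_writeLeaf {L : Layout} {m : ℕ} {s : Store} (hG : Glob L n m s)
    (hP : ∀ i < n, s.mem i 0 4 = 2 ^ i) {S : ℕ} {i : Fin n} (hi : ofMask n S = {i})
    (h30 : s.reg 30 = S) (h22 : s.reg 22 < L.off) :
    WP L writeLeaf (4 * n + 1) s fun s' => Frame 23 s s' ∧ s'.mem = s.mem ∧
      s'.inp (s.reg 22) = i + 1 ∧ ∀ a, a ≠ s.reg 22 → s'.inp a = s.inp a := by
  have hV := hG.V
  have hK := hG.K
  have hm := hG.hm
  refine WP.le_time (WP.forLoop n 3 (fun j s' => Frame 23 s s' ∧ s'.reg 30 = S ∧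
    s'.mem = s.mem ∧ (i < j → s'.inp (s.reg 22) = i + 1) ∧
      ∀ a, a ≠ s.reg 22 → s'.inp a = s.inp a) hG.r2 ?_ ?_ ?_) (by omega)
  · exact ⟨(Frame.refl _ _).setReg, by simpa using h30, rfl, by simp, by simp⟩
  · rintro j hj s1 hb ⟨hF, e30, hm, hw, ho⟩ h23 h2
    have hG1 := hG.of_frame hF
    have hp : s1.mem j 0 4 = 2 ^ j := by rw [hm, hP j hj]
    have e22 : s1.reg 22 = s.reg 22 := hF 22 (by norm_num)
    have hbit : 0 < S / 2 ^ j % 2 ↔ j = i := by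
      rw [← testBit_iff_pos]
      have h := mem_ofMask (n := n) (m := S) (i := ⟨j, hj⟩)
      rw [hi, Finset.mem_singleton, Fin.ext_iff] at h
      exact h.symm
    refine WP.cond 1 1 (by simp) (by simp [hG1.r0, hG1.r1]; omega) ?_ ?_
    · intro hlt
      simp only [eval_zero, eval_bitE, eval_var, e30, h23, hp] at hlt
      have hji := hbit.1 hlt
      refine WP.setInp (by simp) (by simp) (by simpa [e22] using h22) (by simp [h23]; omega) ?_
      simp only [eval_add, eval_var, eval_one, h23, e22]
      refine ⟨by simpa using h23, by simpa using h2, hF.setInp.setReg, by simpa using e30, hm, ?_, ?_⟩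
      · intro _
        simp [hji]
      · intro a ha
        simp [ha, ho a ha]
    · intro hlt
      simp only [eval_zero, eval_bitE, eval_var, e30, h23, hp] at hlt
      rw [hbit] at hlt
      refine WP.skip ⟨h23, h2, hF.setReg, by simpa using e30, hm, ?_, ho⟩
      intro h
      exact hw (by omega)
  · rintro s1 ⟨hF, e30, hm, hw, ho⟩ -
    exact ⟨hF, hm, hw i.2, ho⟩

/-- Preorder traversal with an explicit stack. The complement S \ T is pushed below T, so the left
subtree is written first. The output overwrites the input, which is no longer read. A full tree has
2 n - 1 nodes, so the number of rounds is known beforehand. -/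
def writeTree : Prog :=
  assign 21 1 ⨟ assign 22 2 ⨟ setMem 0 0 5 (var 3 - 1) ⨟ setInp 0 1 ⨟
  setInp 1 (mem (var 3 - 1) 0 3) ⨟
  forLoop 20 11 (assign 21 (var 21 - 1) ⨟ assign 30 (mem (var 21) 0 5) ⨟
    cond 1 (mem (var 30) 0 1)
      (findMin ⨟ setInp (var 22) 0 ⨟ setMem (var 21) 0 5 (var 30 - var 32) ⨟
        setMem (var 21 + 1) 0 5 (var 32) ⨟ assign 21 (var 21 + 2))
      writeLeaf ⨟
    assign 22 (var 22 + 1))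

/-- The state after `t` nodes have been written. -/
def WriteInv (Q : Query n) (s : Store) (t : ℕ) (s' : Store) : Prop :=
  ∃ st out : List ℕ, Frame 20 s s' ∧ s'.reg 21 = st.length ∧ s'.reg 22 = 2 + t ∧
    StackHolds s' st ∧ out.length = t ∧ (∀ i (h : i < out.length), s'.inp (2 + i) = out[i]) ∧
    s'.inp 0 = 1 ∧ s'.inp 1 = s.mem (2 ^ n - 1) 0 3 ∧ SameBut 0 5 s s' ∧
    (∀ S ∈ st, S < 2 ^ n ∧ Q.optCost (ofMask n S) ≠ ⊤) ∧ stackWeight n st + t = 2 * n - 1 ∧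
    ∀ ts, List.Forall₂ (OptTree Q) st ts →
      ∃ T, OptTree Q (2 ^ n - 1) T ∧ T.code = out ++ ts.flatMap JoinTree.code

/-- The invariant treats the stack as a continuation: any optimal trees for the pending masks
complete the output to the code of an optimal tree for all relations. A round, be it a split or a
leaf, lowers the weight of the stack by exactly 1, so the stack is empty after 2 n - 1 rounds. -/
theorem wp_writeTree {L : Layout} {s : Store} (Q : Query n) (hG : Glob L n (Q.maxCard * n) s)
    (hP : ∀ i < n, s.mem i 0 4 = 2 ^ i) (hC : ∀ S < 2 ^ n, s.mem S 0 1 = (ofMask n S).card)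
    (hD : DPCol n (Q.maxCard * n) Q.optCost s) (hne : Q.optCost Finset.univ ≠ ⊤) :
    WP L writeTree ((2 * n - 1) * (2 ^ n * (4 * n + 10) + 4 * n + 13) + 6) s fun s' =>
      ∃ T, OptTree Q (2 ^ n - 1) T ∧ s'.inp 0 = 1 ∧ s'.inp 1 = s.mem (2 ^ n - 1) 0 3 ∧
        ∀ i (h : i < T.code.length), s'.inp (2 + i) = T.code[i] := by
  have hV := hG.V
  have hK := hG.K
  have hn := hG.hn
  have hmn := hG.hm
  have h4 := hG.two_pow_pos
  have hoff := hG.off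
  have hnn : 2 * n ≤ n * n := Nat.mul_le_mul_right n hn
  refine WP.le_time (WP.seq (WP.assign (by simp) (by simp; omega) (WP.seq
    (WP.assign (by simp) (by simp; omega) (WP.seq
    (WP.setMem (by simp [hG.r0, hG.r1]; omega) (by simp) (by simp [hG.r3]; omega) (WP.seq
    (WP.setInp (by simp) (by simp) (by simp; omega) (by simp; omega) (WP.seq
    (WP.setInp (by simp) (by simp [hG.r0, hG.r1]; omega) (by simp; omega)
      ?_ (WP.forLoop (2 * n - 1) (2 ^ n * (4 * n + 10) + 4 * n + 12) (WriteInv Q s)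
    (by simp [hG.r11]) ?_ ?_ ?_)))))))))))
      (T := 1 + (1 + (1 + (1 + (1 + (_ + 1)))))) (le_of_eq (by ring))
  · have : s.mem (2 ^ n - 1) 0 3 ≤ Q.maxCard * n + 1 := by
      rw [hD _ (by omega)]
      exact (small_optCost Q _).code_le
    simp [hG.r3]; omega
  · refine ⟨[2 ^ n - 1], [], ?_, by simp, by simp, ?_, rfl, by simp, by simp, ?_, ?_, ?_, ?_, ?_⟩
    · exact ((((Frame.refl 20 s).setReg).setReg).setMem).setInp.setInp.setReg
    · simp [StackHolds, hG.r3]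
    · simp [hG.r3]
    · intro a b c h
      simp only [Store.setReg_mem, Store.setInp_mem, Store.setMem_mem]
      rw [if_neg]
      exact fun h' => h h'.2
    · intro S hS
      rw [List.mem_singleton] at hS
      subst hS
      rw [ofMask_full]
      exact ⟨by omega, hne⟩
    · simp [stackWeight, ofMask_full]
    · intro ts hts
      obtain ⟨T, ts', hT, hts', rfl⟩ := List.forall₂_cons_left_iff.1 hts
      rw [List.forall₂_nil_left_iff] at hts'
      subst hts'
      exact ⟨T, hT, by simp⟩
  · rintro t ht s1 hb ⟨st, out, hF, h21, h22, hst, hlen, hout, hi0, hi1, hB, hmem, hw, htr⟩ h20 h11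
    have hG1 := hG.of_frame hF
    cases st with
    -- An empty stack would mean that all 2 n - 1 nodes have been written.
    | nil => simp [stackWeight] at hw; omega
    | cons S st =>
      have hSm := hmem S (by simp)
      have hst' : ∀ X ∈ st, X < 2 ^ n ∧ Q.optCost (ofMask n X) ≠ ⊤ :=
        fun X hX => hmem X (List.mem_cons_of_mem _ hX)
      have hcard := Query.one_le_card_of_optCost hSm.2
      have hcS : s1.mem S 0 1 = (ofMask n S).card := by rw [hB _ _ _ (by simp), hC S hSm.1]
      have hcn : (ofMask n S).card ≤ n := (Finset.card_le_univ _).trans (by simp)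
      have hw' : 2 * (ofMask n S).card - 1 + stackWeight n st + t = 2 * n - 1 := by
        rw [← hw]; simp [stackWeight]
      have hlenV : st.length ≤ 2 * n := by
        have := length_le_stackWeight fun X hX => Query.one_le_card_of_optCost (hst' X hX).2
        omega
      refine WP.le_time (WP.seq (WP.assign (by simp) (by simp [h21]; omega) (WP.seq
        (WP.assign (by simp [hG1.r0, hG1.r1]; omega) (by simp [h21, hst.1]; omega) (WP.seq
        (T := 2 ^ n * (4 * n + 10) + 4 * n + 9) (T' := 1) ?_))))) (T := 1 + (1 + (_ + 1)))
        (by omega)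
      simp only [eval_sub, eval_var, eval_mem, eval_ofNat, Store.setReg_reg,
        Store.setReg_mem, h21, List.length_cons, Nat.add_sub_cancel, if_true, hst.1]
      have hGs := hG1.of_frame (((Frame.refl 20 s1).setReg (x := 21) (v := st.length)).setReg
        (x := 30) (v := S))
      refine WP.le_time (WP.cond (2 ^ n * (4 * n + 10) + 7) (4 * n + 1) (by simp)
        (by simp [hG1.r0, hG1.r1]; omega) ?_ ?_) (by omega)
      · intro h1
        simp [hcS] at h1
        refine WP.le_time (WP.seq (T' := 4) (WP.imp (wp_findMin (n := n) (m := Q.maxCard * n) (S := S)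
          (D := Q.optCost) hGs ?_ ?_ (small_optCost Q) hSm.1 (by simp) ?_) ?_)) le_rfl
        · intro i hi
          simp only [Store.setReg_mem]
          rw [hB _ _ _ (by simp), hP i hi]
        · intro X hX
          simp only [Store.setReg_mem]
          rw [hB _ _ _ (by simp), hD X hX]
        · exact fun T _ => PartialOpt.small_add (Q := Q) (fun _ => Or.inr rfl) _ _
        · rintro s2 ⟨hF2, hin2, hm2, h31, hmin⟩
          have hG2 := hGs.of_frame hF2
          have e20 : s2.reg 20 = t := by rw [hF2 20 (by norm_num)]; simp [h20]
          have e21 : s2.reg 21 = st.length := by rw [hF2 21 (by norm_num)]; simp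
          have e22 : s2.reg 22 = 2 + t := by rw [hF2 22 (by norm_num)]; simp [h22]
          have e30 : s2.reg 30 = S := by rw [hF2 30 (by norm_num)]; simp
          have hin2' : s2.inp = s1.inp := hin2
          have hm2' : s2.mem = s1.mem := hm2
          have hmp : minPlusConv Q.optCost Q.optCost (ofMask n S) ≠ ⊤ := by
            intro h
            apply hSm.2
            rw [Q.optCost_eq h1, h, top_add]
          have hlt : s2.reg 31 < Q.maxCard * n + 1 := by
            rw [h31, Small.code_lt]
            · exact hmp
            · intro _
              refine le_trans ?_ (small_optCost Q (ofMask n S) hSm.2)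
              rw [Q.optCost_eq h1]
              exact le_self_add
          obtain ⟨hT, hTS, hsum⟩ := hmin hlt
          have e31 : ((s2.reg 31 : ℕ) : ℕ∞) = minPlusConv Q.optCost Q.optCost (ofMask n S) := by
            rw [h31]
            exact Small.coe_code (h31 ▸ hlt)
          have c1 := Small.coe_code (m := Q.maxCard * n) (v := Q.optCost (ofMask n (s2.reg 32)))
            (by omega)
          have c2 := Small.coe_code (m := Q.maxCard * n)
            (v := Q.optCost (ofMask n S \ ofMask n (s2.reg 32))) (by omega)
          have heq : Q.optCost (ofMask n (s2.reg 32)) +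
              Q.optCost (ofMask n S \ ofMask n (s2.reg 32)) =
              minPlusConv Q.optCost Q.optCost (ofMask n S) := by
            rw [← c1, ← c2, ← Nat.cast_add, hsum, e31]
          have hle : s2.reg 32 ≤ S := le_of_ofMask_subset hT hTS
          have hf1 : Q.optCost (ofMask n (s2.reg 32)) ≠ ⊤ := by
            rw [← c1]; exact ENat.natCast_ne_top _
          have hf2 : Q.optCost (ofMask n (S - s2.reg 32)) ≠ ⊤ := by
            rw [ofMask_sub hT hTS, ← c2]; exact ENat.natCast_ne_top _
          have hSlt := hSm.1
          have hcd : (ofMask n (s2.reg 32)).card + (ofMask n (S - s2.reg 32)).card =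
              (ofMask n S).card := by
            rw [ofMask_sub hT hTS, add_comm, Finset.card_sdiff_add_card_eq_card hTS]
          have hk1 := Query.one_le_card_of_optCost hf1
          have hk2 := Query.one_le_card_of_optCost hf2
          refine WP.le_time (WP.seq (WP.setInp (by simp) (by simp) (by simp [e22]; omega)
            (by simp; omega) (WP.seq (WP.setMem (by simp [hG2.r0, hG2.r1]; omega) (by simp)
            (by simp [e30]; omega) (WP.seq (WP.setMem (by simp [hG2.r0, hG2.r1]; omega) (by simp)
            (by simp; omega) (WP.assign (by simp) (by simp [e21]; omega) ?_))))))) (by omega)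
          refine WP.assign (by simp) (by simp [e22]; omega) ?_
          refine ⟨by simp [e20], by simp [hG2.r11], s2.reg 32 :: (S - s2.reg 32) :: st, out ++ [0],
            ?_, by simp [e21], by simp [e22]; omega, ?_, by simp [hlen], ?_, ?_, ?_, ?_, ?_, ?_, ?_⟩
          · exact ((hF.trans ((Frame.refl 20 s1).setReg (x := 21) (v := st.length)).setReg).trans
              hF2).setInp.setMem.setMem.setReg.setReg.setReg
          · refine ⟨by simp [e21], by simp [e21, e30], ?_⟩
            refine hst.2.congr fun i hi => ?_
            simp [e21, hm2', show i ≠ st.length + 1 by omega, show i ≠ st.length by omega]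
          · intro i hi
            simp only [Store.setReg_inp, Store.setMem_inp, Store.setInp_inp, eval_var, e22,
              eval_zero]
            rw [List.getElem_append]
            split_ifs with ha hb' hb'
            · omega
            · simp
            · rw [hin2', hout i hb']
            · simp at hi; omega
          · simp [e22, hin2', hi0]; omega
          · simp only [Store.setReg_inp, Store.setMem_inp, Store.setInp_inp, eval_var, e22]
            rw [if_neg (by omega), hin2', hi1]
          · intro a b c h
            simp only [Store.setReg_mem, Store.setInp_mem, Store.setMem_mem]
            rw [if_neg (fun h' => h h'.2), if_neg (fun h' => h h'.2), hm2', hB a b c h]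
          · intro X hX
            rw [List.mem_cons, List.mem_cons] at hX
            rcases hX with rfl | rfl | hX
            · exact ⟨hT, hf1⟩
            · exact ⟨by omega, hf2⟩
            · exact hst' X hX
          · simp only [stackWeight, List.map_cons, List.sum_cons] at hw' ⊢
            omega
          · intro ts hts
            obtain ⟨l, ts1, hl, hts1, rfl⟩ := List.forall₂_cons_left_iff.1 hts
            obtain ⟨r, ts2, hr, hts2, rfl⟩ := List.forall₂_cons_left_iff.1 hts1
            -- Trees for the two new masks are handed to the old invariant as the single tree `join
            -- l r` for S.
            obtain ⟨T, hTo, hTc⟩ := htr (.join l r :: ts2)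
              (.cons (OptTree.join h1 hT hSm.2 hTS heq hl hr) hts2)
            refine ⟨T, hTo, ?_⟩
            rw [hTc]
            simp [JoinTree.code]
      · intro h1
        simp [hcS] at h1
        obtain ⟨i, hi⟩ := Finset.card_eq_one.1 (show (ofMask n S).card = 1 by omega)
        refine WP.imp (wp_writeLeaf (n := n) (m := Q.maxCard * n) (S := S) (i := i) hGs ?_ hi
          (by simp) (by simp [h22]; omega)) ?_
        · intro i hi
          simp only [Store.setReg_mem]
          rw [hB _ _ _ (by simp), hP i hi]
        · rintro s2 ⟨hF2, hm2, hwr, hoth⟩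
          have hG2 := hGs.of_frame hF2
          have e20 : s2.reg 20 = t := by rw [hF2 20 (by norm_num)]; simp [h20]
          have e21 : s2.reg 21 = st.length := by rw [hF2 21 (by norm_num)]; simp
          have e22 : s2.reg 22 = 2 + t := by rw [hF2 22 (by norm_num)]; simp [h22]
          have hm2' : s2.mem = s1.mem := hm2
          simp [h22] at hwr hoth
          refine WP.assign (by simp) (by simp [e22]; omega) ?_
          refine ⟨by simp [e20], by simp [hG2.r11], st, out ++ [(i : ℕ) + 1],
            ?_, by simp [e21], by simp [e22]; omega, ?_, by simp [hlen], ?_, ?_, ?_, ?_, hst', ?_, ?_⟩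
          · exact ((hF.trans ((Frame.refl 20 s1).setReg (x := 21) (v := st.length)).setReg).trans
              hF2).setReg.setReg
          · refine hst.2.congr fun i hi => ?_
            simp [hm2']
          · intro j hj
            simp only [Store.setReg_inp]
            rw [List.getElem_append]
            split_ifs with hb'
            · rw [hoth _ (by omega), hout j hb']
            · simp at hj
              rw [show 2 + j = 2 + t by omega, hwr]
              simp
          · simp only [Store.setReg_inp]
            rw [hoth _ (by omega), hi0]
          · simp only [Store.setReg_inp]
            rw [hoth _ (by omega), hi1]
          · intro a b c h
            simp only [Store.setReg_mem]
            rw [hm2', hB a b c h]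
          · simp only [stackWeight] at hw' ⊢
            omega
          · intro ts hts
            have hleaf : OptTree Q S (.leaf i) := by
              refine ⟨trivial, hi.symm, ?_⟩
              rw [Q.optCost_of_card_eq_one (by rw [hi]; simp)]
              rfl
            obtain ⟨T, hTo, hTc⟩ := htr (.leaf i :: ts) (.cons hleaf hts)
            refine ⟨T, hTo, ?_⟩
            rw [hTc]
            simp [JoinTree.code]
  · rintro s1 ⟨st, out, hF, h21, h22, hst, hlen, hout, hi0, hi1, hB, hmem, hw, htr⟩ -
    cases st with
    | cons S st =>
      have hSm := hmem S (by simp)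
      have hcard := Query.one_le_card_of_optCost hSm.2
      simp only [stackWeight, List.map_cons, List.sum_cons] at hw
      omega
    | nil =>
      obtain ⟨T, hTo, hTc⟩ := htr [] .nil
      simp at hTc
      subst hTc
      exact ⟨T, hTo, hi0, hi1, hout⟩

end RAM
end DPconv

end

/-! ### Stepwise transforms, interpolation functionals and decoding -/

section
open Finset

namespace DPconv

section Transform
variable {n : ℕ} {R : Type*} [CommRing R]

/-- The zeta (`σ = 1`) or Möbius (`σ = -1`) transform with respect to the first `i` relations. -/
def partialTransform (σ : R) (g : Finset (Fin n) → R) (i : ℕ) (S : Finset (Fin n)) : R :=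
  ∑ T ∈ S.powerset with ∀ x ∈ S \ T, (x : ℕ) < i, σ ^ (S \ T).card * g T

theorem partialTransform_zero (σ : R) (g : Finset (Fin n) → R) (S : Finset (Fin n)) :
    partialTransform σ g 0 S = g S := by
  have : S.powerset.filter (fun T => ∀ x ∈ S \ T, (x : ℕ) < 0) = {S} := by
    ext T
    simp only [Finset.mem_filter, Finset.mem_powerset, Finset.mem_singleton]
    constructor
    · rintro ⟨h1, h2⟩
      refine Finset.Subset.antisymm h1 fun x hx => ?_
      by_contra hc
      exact absurd (h2 x (Finset.mem_sdiff.2 ⟨hx, hc⟩)) (by omega)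
    · rintro rfl; simp
  rw [partialTransform, this]; simp

theorem partialTransform_all (σ : R) (g : Finset (Fin n) → R) (S : Finset (Fin n)) :
    partialTransform σ g n S = ∑ T ∈ S.powerset, σ ^ (S \ T).card * g T := by
  rw [partialTransform, Finset.filter_true_of_mem]
  intro T _ x _
  exact x.2

/-- Either T keeps the relation i or it drops it; dropping it costs one factor σ and leaves a sum
for `S.erase i`. This is one round of Yates' algorithm, for the zeta and the Möbius transform alike.
-/
theorem partialTransform_succ (σ : R) (g : Finset (Fin n) → R) (i : Fin n) (S : Finset (Fin n)) :
    partialTransform σ g (i + 1) S = partialTransform σ g i S +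
      if i ∈ S then σ * partialTransform σ g i (S.erase i) else 0 := by
  unfold partialTransform
  rw [← Finset.sum_filter_add_sum_filter_not _ (fun T => ∀ x ∈ S \ T, (x : ℕ) < i)]
  congr 1
  · refine Finset.sum_congr ?_ fun _ _ => rfl
    ext T
    simp only [Finset.mem_filter]
    constructor
    · rintro ⟨⟨h1, -⟩, h3⟩; exact ⟨h1, h3⟩
    · rintro ⟨h1, h3⟩; exact ⟨⟨h1, fun x hx => (h3 x hx).trans (by omega)⟩, h3⟩
  · split_ifs with hi
    · rw [Finset.mul_sum]
      refine Finset.sum_congr ?_ fun T hT => ?_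
      · ext T
        simp only [Finset.mem_filter, Finset.mem_powerset, not_forall]
        constructor
        · rintro ⟨⟨h1, h2⟩, x, hx, hxi⟩
          have hxe : x = i := Fin.ext (by have := h2 x hx; omega)
          subst hxe
          have hxT := (Finset.mem_sdiff.1 hx).2
          refine ⟨Finset.subset_erase.2 ⟨h1, hxT⟩, fun y hy => ?_⟩
          have hy' := Finset.mem_sdiff.1 hy
          have h3 := Finset.mem_erase.1 hy'.1
          have h4 := h2 y (Finset.mem_sdiff.2 ⟨h3.2, hy'.2⟩)
          have h5 : (y : ℕ) ≠ x := fun h => h3.1 (Fin.ext h)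
          omega
        · rintro ⟨h1, h2⟩
          obtain ⟨h3, h4⟩ := Finset.subset_erase.1 h1
          refine ⟨⟨h3, fun y hy => ?_⟩, i, Finset.mem_sdiff.2 ⟨hi, h4⟩, by simp⟩
          have hy' := Finset.mem_sdiff.1 hy
          by_cases hyi : y = i
          · subst hyi; omega
          · have := h2 y (Finset.mem_sdiff.2 ⟨Finset.mem_erase.2 ⟨hyi, hy'.1⟩, hy'.2⟩)
            omega
      · have h1 : T ⊆ S.erase i := Finset.mem_powerset.1 (Finset.mem_filter.1 hT).1
        have hx : i ∈ S \ T := Finset.mem_sdiff.2 ⟨hi, (Finset.subset_erase.1 h1).2⟩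
        have hc : (S \ T).card = (S.erase i \ T).card + 1 := by
          have : S.erase i \ T = (S \ T).erase i := by
            ext y
            simp only [Finset.mem_sdiff, Finset.mem_erase]
            tauto
          rw [this, Finset.card_erase_add_one hx]
        rw [hc, pow_succ]
        ring
    · refine Finset.sum_eq_zero fun T hT => ?_
      simp only [Finset.mem_filter, Finset.mem_powerset, not_forall] at hT
      obtain ⟨⟨h1, h2⟩, x, hx, hxi⟩ := hT
      have hxe : x = i := Fin.ext (by have := h2 x hx; omega)
      subst hxe
      exact absurd (Finset.mem_sdiff.1 hx).1 hi

theorem partialTransform_one (f : Finset (Fin n) → R) (r : ℕ) (S : Finset (Fin n)) :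
    partialTransform 1 (fun T => if T.card = r then f T else 0) n S = rankedZeta f r S := by
  rw [partialTransform_all, rankedZeta, Finset.sum_filter]
  simp

theorem partialTransform_neg_one (f : Finset (Fin n) → R) (S : Finset (Fin n)) :
    partialTransform (-1) f n S = moebius f S := partialTransform_all _ _ _

end Transform

section Functional
open Polynomial

/-- The product of the `X - b` over `b < k`. -/
noncomputable def nodePoly (k : ℕ) : ℤ[X] := ∏ b ∈ Finset.range k, (X - C (b : ℤ))

/-- The product of the `X - b` over all `b ≤ m` except `a`. -/
noncomputable def coPoly (m a : ℕ) : ℤ[X] := ∏ b ∈ (Finset.range (m + 1)).erase a, (X - C (b : ℤ))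

theorem nodePoly_eq (m : ℕ) {a : ℕ} (ha : a ≤ m) :
    nodePoly (m + 1) = (X - C (a : ℤ)) * coPoly m a :=
  (Finset.mul_prod_erase _ _ (by simp; omega)).symm

/-- Comparison of the coefficients of X^(j+1) in `nodePoly_eq`. Read as a recurrence it is Horner's
scheme, running downwards from the top degree. -/
theorem coPoly_coeff (m : ℕ) {a : ℕ} (ha : a ≤ m) (j : ℕ) :
    (coPoly m a).coeff j = (nodePoly (m + 1)).coeff (j + 1) + a * (coPoly m a).coeff (j + 1) := by
  rw [nodePoly_eq m ha, sub_mul, coeff_sub, coeff_X_mul, coeff_C_mul]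
  ring

theorem coPoly_degree_lt (m : ℕ) {a : ℕ} (ha : a ≤ m) : (coPoly m a).degree < (m + 1 : ℕ) := by
  have hc : ((Finset.range (m + 1)).erase a).card = m := by
    rw [Finset.card_erase_of_mem (by simp; omega)]; simp
  rw [coPoly, degree_prod]
  simp only [degree_X_sub_C, Finset.sum_const, hc, nsmul_eq_mul, mul_one]
  exact_mod_cast Nat.lt_succ_self m

/-- Multiplying by X makes the coefficient at index 0 vanish, so the recurrence for appending a
linear factor has no boundary case. -/
theorem X_mul_coeff_succ (P : ℤ[X]) (w : ℤ) (j : ℕ) :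
    (X * (P * (X - C w))).coeff (j + 1) = (X * P).coeff j - w * (X * P).coeff (j + 1) := by
  rw [coeff_X_mul, coeff_X_mul, mul_sub, coeff_sub, mul_comm P X, mul_comm P (C w), coeff_C_mul]

/-- The coefficient of `X ^ a` in `(X - 1) ^ m`, which is a signed binomial coefficient. -/
noncomputable def weight (m a : ℕ) : ℤ := ((X - C 1 : ℤ[X]) ^ m).coeff a

theorem coPoly_eval_self (m : ℕ) {a : ℕ} (ha : a ≤ m) :
    (coPoly m a).eval (a : ℤ) = (a.factorial : ℤ) * ((-1) ^ (m - a) * (m - a).factorial) := by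
  have h1 : (Finset.range (m + 1)).erase a = Finset.range a ∪ Finset.Ico (a + 1) (m + 1) := by
    ext x; simp; omega
  have hd : Disjoint (Finset.range a) (Finset.Ico (a + 1) (m + 1)) := by
    rw [Finset.disjoint_left]; intro x; simp; omega
  rw [coPoly, eval_prod, h1, Finset.prod_union hd]
  simp only [eval_sub, eval_X, eval_C]
  congr 1
  · rw [← Finset.prod_range_reflect, ← Finset.prod_range_add_one_eq_factorial]
    push_cast
    refine Finset.prod_congr rfl fun x hx => ?_
    have := Finset.mem_range.1 hx
    rw [show a - 1 - x = a - (x + 1) by omega, Nat.cast_sub (by omega)]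
    push_cast; ring
  · rw [Finset.prod_Ico_eq_prod_range, ← Finset.prod_range_add_one_eq_factorial,
      show m + 1 - (a + 1) = m - a by omega]
    have : ∀ x ∈ Finset.range (m - a), (a : ℤ) - ((a + 1 + x : ℕ) : ℤ) = (-1) * ((x + 1 : ℕ) : ℤ) := by
      intro x _; push_cast; ring
    rw [Finset.prod_congr rfl this, Finset.prod_mul_distrib]
    push_cast
    simp

/-- The Lagrange denominator at a is ± a! (m - a)!, and the weight is m! divided by it, with the
same sign. Scaled by m!, interpolation needs no division. -/
theorem weight_mul_eval (m : ℕ) {a : ℕ} (ha : a ≤ m) :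
    weight m a * (coPoly m a).eval (a : ℤ) = m.factorial := by
  have hw : weight m a = (-1) ^ (m - a) * (m.choose a : ℤ) := by
    have : (X - C 1 : ℤ[X]) = X + C (-1) := by simp [sub_eq_add_neg]
    rw [weight, this, coeff_X_add_C_pow]
  rw [hw, coPoly_eval_self m ha]
  have h2 : ((-1 : ℤ) ^ (m - a)) * (-1) ^ (m - a) = 1 := by
    rw [← mul_pow]; simp
  have h3 : (m.choose a : ℤ) * a.factorial * (m - a).factorial = m.factorial := by
    exact_mod_cast Nat.choose_mul_factorial_mul_factorial ha
  calc _ = ((-1 : ℤ) ^ (m - a) * (-1) ^ (m - a)) *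
        ((m.choose a : ℤ) * a.factorial * (m - a).factorial) := by ring
    _ = _ := by rw [h2, h3, one_mul]

/-- Lagrange interpolation of X^u at the nodes 0, …, m, multiplied by m!. Both sides have degree at
most m and agree at the m + 1 nodes. -/
theorem sum_weight_coPoly (m : ℕ) {u : ℕ} (hu : u ≤ m) :
    ∑ a ∈ Finset.range (m + 1), C (weight m a * (a : ℤ) ^ u) * coPoly m a =
      C (m.factorial : ℤ) * X ^ u := by
  have hinj : Set.InjOn (fun a : ℕ => (a : ℤ)) (Finset.range (m + 1)) :=
    Nat.cast_injective.injOn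
  refine eq_of_degrees_lt_of_eval_index_eq (s := Finset.range (m + 1)) (v := fun a : ℕ => (a : ℤ))
    hinj ?_ ?_ ?_
  · rw [Finset.card_range]
    refine (degree_sum_le _ _).trans_lt ((Finset.sup_lt_iff (WithBot.bot_lt_coe _)).2 ?_)
    intro a ha
    refine (degree_mul_le _ _).trans_lt ?_
    refine (add_le_add_left degree_C_le _).trans_lt ?_
    rw [zero_add]
    exact coPoly_degree_lt m (by simpa [Nat.lt_succ_iff] using ha)
  · rw [Finset.card_range]
    refine (degree_C_mul_X_pow_le _ _).trans_lt ?_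
    exact_mod_cast Nat.lt_succ_of_le hu
  · intro c hc
    rw [eval_finsetSum, Finset.sum_eq_single c]
    · rw [eval_mul, eval_C, eval_mul, eval_C, eval_pow, eval_X]
      have := weight_mul_eval m (a := c) (by simpa [Nat.lt_succ_iff] using hc)
      linear_combination (c : ℤ) ^ u * this
    · intro b _ hbc
      rw [eval_mul, coPoly, eval_prod, Finset.prod_eq_zero (i := c), mul_zero]
      · exact Finset.mem_erase.2 ⟨hbc.symm, hc⟩
      · simp
    · intro h; exact absurd hc h

/-- The functionals that extract, up to the factor `m!`, the sum of the coefficients below `v` of a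
polynomial of degree at most `m` from its values at `0, …, m`. -/
noncomputable def functional (m v a : ℕ) : ℤ :=
  weight m a * ∑ u ∈ Finset.range v, (coPoly m a).coeff u

/-- Add up the coefficients below v on both sides of the interpolation identity. -/
theorem sum_functional_mul_pow (m v : ℕ) {u : ℕ} (hu : u ≤ m) :
    ∑ a ∈ Finset.range (m + 1), functional m v a * (a : ℤ) ^ u =
      if u < v then (m.factorial : ℤ) else 0 := by
  have h := congrArg (fun P : ℤ[X] => ∑ j ∈ Finset.range v, P.coeff j) (sum_weight_coPoly m hu)
  simp only [finsetSum_coeff, coeff_C_mul, coeff_X_pow] at h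
  rw [Finset.sum_comm] at h
  have h2 : ∑ j ∈ Finset.range v, (m.factorial : ℤ) * (if j = u then 1 else 0) =
      if u < v then (m.factorial : ℤ) else 0 := by
    simp
  rw [← h2, ← h]
  refine Finset.sum_congr rfl fun a _ => ?_
  rw [functional, mul_assoc, mul_comm (∑ _ ∈ _, _), ← mul_assoc, Finset.mul_sum]

end Functional

section Decode
variable {N : ℕ}

/-- The value at `a` of the monomial that embeds `v`. -/
def evalEmbed (N : ℕ) (a : ℕ) : ℕ∞ → ZMod N
  | ⊤ => 0
  | (v : ℕ) => (a : ZMod N) ^ v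

theorem evalEmbed_top (a : ℕ) : evalEmbed N a ⊤ = 0 := rfl

theorem evalEmbed_coe (a v : ℕ) : evalEmbed N a (v : ℕ∞) = (a : ZMod N) ^ v := rfl

theorem evalEmbed_mul (k : ℕ) (a b : ℕ∞) :
    evalEmbed N k a * evalEmbed N k b = evalEmbed N k (a + b) := by
  induction a using ENat.recTopCoe with
  | top => simp [evalEmbed_top]
  | coe a =>
    induction b using ENat.recTopCoe with
    | top => simp [evalEmbed_top]
    | coe b => rw [evalEmbed_coe, evalEmbed_coe, ← Nat.cast_add, evalEmbed_coe, pow_add]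

theorem sum_functional_evalEmbed {m v : ℕ} {x : ℕ∞} (hx : Small m x) :
    ∑ a ∈ Finset.range (m + 1), (functional m v a : ZMod N) * evalEmbed N a x =
      if x < v then (m.factorial : ZMod N) else 0 := by
  induction x using ENat.recTopCoe with
  | top => simp [evalEmbed_top]
  | coe x =>
    rw [small_coe] at hx
    have h := congrArg (fun z : ℤ => (z : ZMod N)) (sum_functional_mul_pow m v hx)
    simp only [evalEmbed_coe, Nat.cast_lt]
    push_cast at h
    rw [h]

variable {n : ℕ}

/-- The sum equals m! times the number of splits of value below v. This number is at most 2^n < N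
and m! is coprime to N, so the residue vanishes only if the number does. A prefix sum of
coefficients is tested, which is monotone in v and so allows bisection. -/
theorem decode_eq_zero_iff {m v : ℕ} (hN : 2 ^ n < N)
    (hco : Nat.Coprime m.factorial N) {D : Finset (Fin n) → ℕ∞} {S : Finset (Fin n)}
    (hs : ∀ T ⊆ S, Small m (D T + D (S \ T))) :
    ∑ a ∈ Finset.range (m + 1), (functional m v a : ZMod N) *
      fscLayer (fun T => evalEmbed N a (D T)) (fun T => evalEmbed N a (D T)) S.card S = 0 ↔
      (v : ℕ∞) ≤ minPlusConv D D S := by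
  classical
  have h1 : ∑ a ∈ Finset.range (m + 1), (functional m v a : ZMod N) *
      fscLayer (fun T => evalEmbed N a (D T)) (fun T => evalEmbed N a (D T)) S.card S =
      (m.factorial * (S.powerset.filter fun T => D T + D (S \ T) < v).card : ℕ) := by
    -- The convolution identity holds in every commutative ring, here for the values in `ZMod N`.
    simp only [fscLayer_card, evalEmbed_mul, Finset.mul_sum]
    rw [Finset.sum_comm, Finset.sum_congr rfl fun T hT =>
      sum_functional_evalEmbed (hs T (Finset.mem_powerset.1 hT)), ← Finset.sum_filter]
    simp [mul_comm]
  rw [h1, ZMod.natCast_eq_zero_iff]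
  have hle : (S.powerset.filter fun T => D T + D (S \ T) < v).card < N := by
    refine ((Finset.card_filter_le _ _).trans ?_).trans_lt hN
    rw [Finset.card_powerset]
    exact Nat.pow_le_pow_right (by norm_num) ((Finset.card_le_univ _).trans (by simp))
  have h2 : N ∣ m.factorial * (S.powerset.filter fun T => D T + D (S \ T) < v).card ↔
      (S.powerset.filter fun T => D T + D (S \ T) < v).card = 0 := by
    constructor
    · intro h
      exact Nat.eq_zero_of_dvd_of_lt (hco.symm.dvd_of_dvd_mul_left h) hle
    · intro h; rw [h]; simp
  rw [h2, Finset.card_eq_zero, Finset.filter_eq_empty_iff]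
  unfold minPlusConv
  rw [le_iInf₂_iff]
  simp

end Decode
end DPconv

end

/-! ### Filling rectangular parts of the array -/

section
open Finset

namespace DPconv
namespace RAM
open DPconv.RAM.Expr DPconv.Query

/-- The geometry of a filled part of the array: the cell `(r, c)` of a grid with `R` rows and
`C` columns is kept in row `r + δ` and column `κ c` of the plane `J`. -/
structure Grid where
  R : ℕ
  C : ℕ
  δ : ℕ
  J : ℕ
  κ : ℕ → ℕ
  inj : ∀ c < C, ∀ c' < C, κ c = κ c' → c = c'

/-- The state after the cells of the grid before `(r, c)` in row-major order have been filled. -/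
structure Grid.Written (G : Grid) (val : ℕ → ℕ → ℕ) (s : Store) (r c : ℕ) (s' : Store) : Prop where
  frame : Frame 40 s s'
  inp : s'.inp = s.inp
  done : ∀ r' < G.R, ∀ c' < G.C, (r' < r ∨ r' = r ∧ c' < c) →
    s'.mem (r' + G.δ) G.J (G.κ c') = val r' c'
  rest : ∀ i j k, (∀ r' < G.R, ∀ c' < G.C, (r' < r ∨ r' = r ∧ c' < c) →
    ¬ (i = r' + G.δ ∧ j = G.J ∧ k = G.κ c')) → s'.mem i j k = s.mem i j k

theorem Grid.Written.todo {G : Grid} {val : ℕ → ℕ → ℕ} {s s' : Store} {r c : ℕ}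
    (h : G.Written val s r c s') {r' c' : ℕ} (hc : c' < G.C)
    (hn : ¬ (r' < r ∨ r' = r ∧ c' < c)) :
    s'.mem (r' + G.δ) G.J (G.κ c') = s.mem (r' + G.δ) G.J (G.κ c') := by
  refine h.rest _ _ _ fun r'' _ c'' hc'' hb he => hn ?_
  rw [G.inj c' hc c'' hc'' he.2.2, show r' = r'' by omega]
  exact hb

theorem Grid.Written.plane {G : Grid} {val : ℕ → ℕ → ℕ} {s s' : Store} {r c : ℕ}
    (h : G.Written val s r c s') (i : ℕ) {j : ℕ} (k : ℕ) (hj : j ≠ G.J) :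
    s'.mem i j k = s.mem i j k :=
  h.rest _ _ _ fun _ _ _ _ _ he => hj he.2.1

/-- The state after the grid has been filled. -/
structure Grid.Filled (G : Grid) (val : ℕ → ℕ → ℕ) (s s' : Store) : Prop where
  frame : Frame 40 s s'
  inp : s'.inp = s.inp
  done : ∀ r < G.R, ∀ c < G.C, s'.mem (r + G.δ) G.J (G.κ c) = val r c
  rest : ∀ i j k, (∀ r < G.R, ∀ c < G.C, ¬ (i = r + G.δ ∧ j = G.J ∧ k = G.κ c)) →
    s'.mem i j k = s.mem i j k

theorem Grid.Filled.plane {G : Grid} {val : ℕ → ℕ → ℕ} {s s' : Store}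
    (h : G.Filled val s s') (i : ℕ) {j : ℕ} (k : ℕ) (hj : j ≠ G.J) :
    s'.mem i j k = s.mem i j k :=
  h.rest _ _ _ fun _ _ _ _ he => hj he.2.1

def fill (y y' : ℕ) (p : Prog) : Prog := forLoop 40 y (forLoop 41 y' p)

/-- When the body runs at the cell (r, c), the earlier cells have their final values and all others
their old ones. This covers recurrences within a table as well as updates in place. The counters
occupy registers 40 and 41, so the body is free to use those from 42 on. -/
theorem wp_fill {L : Layout} {s : Store} {y y' : ℕ} {p : Prog} (G : Grid) (val : ℕ → ℕ → ℕ) (T : ℕ)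
    (hy : s.reg y = G.R) (hy' : s.reg y' = G.C)
    (step : ∀ r < G.R, ∀ c < G.C, ∀ s', Bdd L s' → G.Written val s r c s' → s'.reg 40 = r →
      s'.reg 41 = c → WP L p T s' fun s'' => Frame 42 s' s'' ∧ s''.inp = s'.inp ∧
        s''.mem = (s'.setMem (r + G.δ) G.J (G.κ c) (val r c)).mem)
    (hyl : y < 40 := by norm_num) (hyl' : y' < 40 := by norm_num) :
    WP L (fill y y' p) (G.R * (G.C * (T + 1) + 2) + 1) s (G.Filled val s) := by
  refine WP.forLoop G.R (G.C * (T + 1) + 1) (fun r s' => G.Written val s r 0 s') hy ?_ ?_ ?_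
    (by norm_num) (by omega) (by omega)
  · exact ⟨(Frame.refl _ _).setReg, rfl, by omega, fun _ _ _ _ => rfl⟩
  · rintro r hr s1 hb1 hW1 h40 h1y
    refine WP.forLoop G.C T (fun c s' => G.Written val s r c s' ∧ s'.reg 40 = r)
      ((hW1.frame y' hyl').trans hy') ?_ ?_ ?_ (by norm_num) (by omega) (by omega)
    · exact ⟨⟨hW1.frame.setReg, hW1.inp, hW1.done, hW1.rest⟩, by simpa using h40⟩
    · rintro c hc s2 hb2 ⟨hW2, h40'⟩ h41 h2y
      refine WP.imp (step r hr c hc s2 hb2 hW2 h40' h41) ?_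
      rintro s3 ⟨hF, hin, hm⟩
      refine ⟨(hF 41 (by norm_num)).trans h41, (hF y' (by omega)).trans h2y, ⟨?_, ?_, ?_, ?_⟩, ?_⟩
      · exact (hW2.frame.trans (hF : Frame 42 s2 s3)).setReg
      · exact hin.trans hW2.inp
      · intro r' hr' c' hc' hbef
        simp only [Store.setReg_mem, hm, Store.setMem_mem]
        split_ifs with h
        · rw [G.inj c' hc' c hc h.2.2, show r' = r by omega]
        · refine hW2.done r' hr' c' hc' ?_
          rcases hbef with h1 | ⟨h1, h2⟩
          · exact Or.inl h1
          · refine Or.inr ⟨h1, ?_⟩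
            by_contra hcon
            exact h ⟨by omega, trivial, by rw [show c' = c by omega]⟩
      · intro i j k h
        simp only [Store.setReg_mem, hm, Store.setMem_mem]
        rw [if_neg (h r hr c hc (Or.inr ⟨rfl, by omega⟩))]
        exact hW2.rest i j k fun r' hr' c' hc' hbef => h r' hr' c' hc' (by omega)
      · simpa using (hF 40 (by norm_num)).trans h40'
    · rintro s2 ⟨hW2, h40'⟩ -
      refine ⟨h40', (hW2.frame y hyl).trans hy, hW2.frame.setReg, hW2.inp, ?_, ?_⟩
      · intro r' hr' c' hc' hbef
        exact hW2.done r' hr' c' hc' (by omega)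
      · intro i j k h
        exact hW2.rest i j k fun r' hr' c' hc' hbef => h r' hr' c' hc' (by omega)
  · rintro s' hW -
    exact ⟨hW.frame, hW.inp, fun r hr c hc => hW.done r hr c hc (Or.inl hr),
      fun i j k h => hW.rest i j k fun r' hr' c' hc' _ => h r' hr' c' hc'⟩

section Residues
variable {N : ℕ} [NeZero N]

theorem val_add_mul (a b c : ZMod N) : (a.val + b.val * c.val) % N = (a + b * c).val := by
  rw [ZMod.val_add, ZMod.val_mul, Nat.add_mod_mod]

theorem val_add_natCast_mul (a b : ZMod N) (c : ℕ) :
    (a.val + c * b.val) % N = (a + (c : ZMod N) * b).val := by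
  rw [ZMod.val_add, ZMod.val_mul, ZMod.val_natCast, Nat.add_mod_mod]
  exact (((Nat.mod_modEq c N).mul_right _).add_left _).symm

/-- Subtraction on the machine is truncated, so negation modulo N is multiplication by N - 1. -/
theorem natCast_sub_one_mul (w : ℕ) : (((N - 1) * w : ℕ) : ZMod N) = -(w : ZMod N) := by
  have : 1 ≤ N := Nat.one_le_iff_ne_zero.2 (NeZero.ne N)
  push_cast [this]
  simp

end Residues

end RAM
end DPconv

end

/-! ### The modulus and tables of polynomial coefficients -/

section
open Finset

namespace DPconv
namespace RAM
open DPconv.RAM.Expr DPconv.Query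

/-- The dimensions of the instance together with a modulus for the evaluated polynomials. -/
structure ModGlob (L : Layout) (n m N : ℕ) (s : Store) : Prop extends Glob L n m s where
  r8 : s.reg 8 = N
  hN : 2 ^ n < N
  hN' : N ≤ 2 * 2 ^ n
  hco : Nat.Coprime m.factorial N
  hm' : m ≤ 2 ^ n

theorem ModGlob.of_frame {L : Layout} {n m N lo : ℕ} {s s' : Store} (h : ModGlob L n m N s)
    (hf : Frame lo s s') (hlo : 20 ≤ lo := by norm_num) : ModGlob L n m N s' where
  toGlob := h.toGlob.of_frame hf hlo
  r8 := (hf 8 (by omega)).trans h.r8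
  hN := h.hN
  hN' := h.hN'
  hco := h.hco
  hm' := h.hm'

theorem ModGlob.neZero {L : Layout} {n m N : ℕ} {s : Store} (h : ModGlob L n m N s) : NeZero N :=
  ⟨(Nat.zero_lt_of_lt h.hN).ne'⟩

theorem ModGlob.val_lt {L : Layout} {n m N : ℕ} {s : Store} (h : ModGlob L n m N s) (x : ZMod N) :
    x.val < L.V := by
  have := h.neZero
  have := x.val_lt
  have := h.hN'
  have := h.V
  omega

/-- The array agrees outside the plane `J`. -/
def Keep (J : ℕ) (s s' : Store) : Prop := ∀ i j k, j ≠ J → s'.mem i j k = s.mem i j k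

theorem Grid.Filled.keep {G : Grid} {val : ℕ → ℕ → ℕ} {s s' : Store}
    (h : G.Filled val s s') : Keep G.J s s' := fun i _ k hj => h.plane i k hj

theorem wp_cell {L : Layout} {s : Store} {i j k e : Expr} {i' j' k' v : ℕ}
    (hok : (i.mem j k).Ok L s) (hok' : e.Ok L s) (hi : i.eval s = i') (hj : j.eval s = j')
    (hk : k.eval s = k') (he : e.eval s = v) (hv : v < L.V)
    (hg : (i.mem j k).good = true := by rfl) (hg' : e.good = true := by rfl) :
    WP L (setMem i j k e) 1 s fun s' => Frame 42 s s' ∧ s'.inp = s.inp ∧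
      s'.mem = (s.setMem i' j' k' v).mem := by
  refine WP.setMem hok hok' (he ▸ hv) ?_ hg hg'
  rw [hi, hj, hk, he]
  exact ⟨(Frame.refl _ _).setMem, rfl, rfl⟩

section Triangle
open scoped Polynomial
open Polynomial (X C coeff_X coeff_X_mul_zero)

/-- The rows of coefficients of products of linear factors `X - (β r + γ)`, shifted by one, where
`β`, `γ` and the plane are given by the registers 22, 23 and 25. -/
def coeffTable (y : ℕ) : Prog :=
  setMem 0 (var 25) 1 1 ⨟ fill y 7 (setMem (var 40 + 1) (var 25) (var 41 + 1)
    ((mem (var 40) (var 25) (var 41) +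
      (var 8 - 1) * (var 22 * var 40 + var 23) * mem (var 40) (var 25) (var 41 + 1)) % var 8))

/-- Row r + 1 arises from row r by one linear factor. The choice β = 0, γ = 1 yields the powers of X
- 1, whose m-th row consists of the weights; β = 1, γ = 0 yields the node polynomials. Coefficients
are shifted by one column, with zeros in column 0. -/
theorem wp_coeffTable {L : Layout} {n m N y R J β γ : ℕ} {s : Store} (hG : ModGlob L n m N s)
    (hy : s.reg y = R) (hR : R ≤ m + 1) (hJ : s.reg 25 = J) (hJ' : J < 20) (hβ : s.reg 22 = β)
    (hγ : s.reg 23 = γ) (h0 : ∀ i k, s.mem i J k = 0) (P : ℕ → ℤ[X]) (hP0 : P 0 = 1)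
    (hP : ∀ r, P (r + 1) = P r * (X - C ((β * r + γ : ℕ) : ℤ)))
    (hyl : y < 40 := by norm_num) :
    WP L (coeffTable y) (R * ((m + 2) * 2 + 2) + 2) s fun s' => Frame 40 s s' ∧ s'.inp = s.inp ∧
      Keep J s s' ∧ ∀ r ≤ R, ∀ c < m + 3, s'.mem r J c = (((X * P r).coeff c : ℤ) : ZMod N).val := by
  have hV := hG.V
  have hK := hG.K
  have hN := hG.hN
  have hp := hG.toGlob.two_pow_pos
  have : Fact (1 < N) := ⟨by omega⟩
  let G : Grid := ⟨R, m + 2, 1, J, fun c => c + 1, fun c _ c' _ h => by simpa using h⟩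
  let val : ℕ → ℕ → ℕ := fun r c => (((X * P (r + 1)).coeff (c + 1) : ℤ) : ZMod N).val
  have row0 : ∀ c, (s.setMem 0 J 1 1).mem 0 J c = (((X * P 0).coeff c : ℤ) : ZMod N).val := by
    intro c
    rw [hP0, mul_one, coeff_X, Store.setMem_mem, h0]
    by_cases hc : c = 1
    · subst hc; simp [ZMod.val_one]
    · rw [if_neg (by simp [hc]), if_neg (by omega)]; simp
  have col0 : ∀ r, (s.setMem 0 J 1 1).mem r J 0 = (((X * P r).coeff 0 : ℤ) : ZMod N).val := by
    intro r
    rw [Store.setMem_mem, h0, coeff_X_mul_zero]; simp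
  refine (WP.seq (WP.setMem (by simp [hG.r0, hG.r1, hJ]; omega) (by simp) (by simp; omega)
    (WP.imp (wp_fill (y := y) (y' := 7) G val 1 hy hG.r7 ?_ hyl) ?_))).le_time
    (by change 1 + (R * ((m + 2) * (1 + 1) + 2) + 1) ≤ _; exact le_of_eq (by ring))
  · intro r hr c hc s' hb hW h40 h41
    change r < R at hr
    change c < m + 2 at hc
    simp only [eval_var, eval_zero, eval_one, hJ] at hW
    have hF : Frame 40 s s' := (Frame.refl 40 s).setMem.trans hW.frame
    have hG' := hG.of_frame hF
    have get : ∀ c' < m + 3, s'.mem r J c' = (((X * P r).coeff c' : ℤ) : ZMod N).val := by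
      intro c' hc'
      rcases Nat.eq_zero_or_pos r with rfl | hr0
      · rw [← row0]
        exact hW.rest _ _ _ fun r' _ _ _ _ h => by
          have : 0 = r' + 1 := h.1
          omega
      rcases Nat.eq_zero_or_pos c' with rfl | hc0
      · rw [← col0]
        exact hW.rest _ _ _ fun r' _ c'' _ _ h => by
          have : 0 = c'' + 1 := h.2.2
          omega
      have := hW.done (r - 1) (by change _ < R; omega) (c' - 1) (by change _ < m + 2; omega)
        (by omega)
      simp only [G, val] at this
      rwa [show r - 1 + 1 = r by omega, show c' - 1 + 1 = c' by omega] at this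
    have e25 : s'.reg 25 = J := (hF 25 (by norm_num)).trans hJ
    have e22 : s'.reg 22 = β := (hF 22 (by norm_num)).trans hβ
    have e23 : s'.reg 23 = γ := (hF 23 (by norm_num)).trans hγ
    have key : (s'.mem r J c + (N - 1) * (β * r + γ) * s'.mem r J (c + 1)) % N = val r c := by
      rw [get c (by omega), get (c + 1) (by omega), val_add_natCast_mul, natCast_sub_one_mul]
      simp only [val]
      rw [hP, X_mul_coeff_succ]
      congr 1
      push_cast
      ring
    exact wp_cell (by simp [hG'.r0, hG'.r1, e25, h41]; omega)
      (by simp [hG'.r0, hG'.r1, e25, h41]; omega) (by simp [h40, G]) (by simp [e25, G])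
      (by simp [h41, G]) (by simp [h40, h41, e22, e23, e25, hG'.r8, key]) (hG.val_lt _)
  · intro s' hW
    simp only [eval_var, eval_zero, eval_one, hJ] at hW
    refine ⟨(Frame.refl 40 s).setMem.trans hW.frame, hW.inp, ?_, ?_⟩
    · intro i j k hj
      rw [hW.keep i j k hj, Store.setMem_mem, if_neg fun h => hj h.2.1]
    · intro r hr c hc
      rcases Nat.eq_zero_or_pos r with rfl | hr0
      · rw [← row0]
        exact hW.rest _ _ _ fun r' _ _ _ h => by
          have : 0 = r' + 1 := h.1
          omega
      rcases Nat.eq_zero_or_pos c with rfl | hc0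
      · rw [← col0]
        exact hW.rest _ _ _ fun r' _ c'' _ h => by
          have : 0 = c'' + 1 := h.2.2
          omega
      have := hW.done (r - 1) (by change _ < R; omega) (c - 1) (by change _ < m + 2; omega)
      simp only [G, val] at this
      rwa [show r - 1 + 1 = r by omega, show c - 1 + 1 = c by omega] at this

end Triangle

end RAM
end DPconv

end

/-! ### Quotients, functionals and monomials modulo N -/

section
open Finset

namespace DPconv
namespace RAM
open DPconv.RAM.Expr DPconv.Query

variable {L : Layout} {n m N : ℕ} {s : Store}

/-- Synthetic division of the product of all `X - b` by the `X - a`. -/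
def quotientTable : Prog :=
  fill 6 6 (setMem (var 40) 3 (var 5 - var 41)
    ((mem (var 6) 2 (var 5 - var 41 + 2) + var 40 * mem (var 40) 3 (var 5 - var 41 + 1)) % var 8))

theorem wp_quotientTable (hG : ModGlob L n m N s) (h0 : ∀ i k, s.mem i 3 k = 0)
    (hM : ∀ j < m + 1, s.mem (m + 1) 2 (j + 2) = (((nodePoly (m + 1)).coeff (j + 1) : ℤ) : ZMod N).val) :
    WP L quotientTable ((m + 1) * ((m + 1) * 2 + 2) + 1) s fun s' => Frame 40 s s' ∧
      s'.inp = s.inp ∧ Keep 3 s s' ∧ ∀ a < m + 1, ∀ j < m + 1,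
        s'.mem a 3 j = (((coPoly m a).coeff j : ℤ) : ZMod N).val := by
  have hK := hG.K
  have := hG.neZero
  -- The columns are visited from degree m downwards, as Horner's scheme demands. It starts from
  -- column m + 1, which still holds the initial 0.
  let G : Grid := ⟨m + 1, m + 1, 0, 3, fun c => m - c, fun c _ c' _ h => by
    omega⟩
  let val : ℕ → ℕ → ℕ := fun a t => (((coPoly m a).coeff (m - t) : ℤ) : ZMod N).val
  refine (wp_fill G val 1 hG.r6 hG.r6 ?_).imp ?_
  · intro a ha t ht s' hb hW h40 h41
    change a < m + 1 at ha
    change t < m + 1 at ht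
    have hG' := hG.of_frame hW.frame
    have h1 := hM (m - t) (by omega)
    rw [← hW.plane _ _ (by simp [G])] at h1
    have h2 : s'.mem a 3 (m - t + 1) = (((coPoly m a).coeff (m - t + 1) : ℤ) : ZMod N).val := by
      rcases Nat.eq_zero_or_pos t with rfl | ht0
      · rw [hW.rest, h0, Nat.sub_zero,
          Polynomial.coeff_eq_zero_of_degree_lt (coPoly_degree_lt m (by omega))]
        · simp
        · rintro r' - c' hc' - ⟨-, -, h⟩
          simp only [G] at h
          omega
      · have := hW.done a ha (t - 1) (by change _ < m + 1; omega) (by omega)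
        simp only [G, val] at this
        rwa [show m - (t - 1) = m - t + 1 by omega] at this
    have key : (s'.mem (m + 1) 2 (m - t + 2) + a * s'.mem a 3 (m - t + 1)) % N = val a t := by
      rw [h1, h2, val_add_natCast_mul]
      simp only [val]
      rw [coPoly_coeff m (by omega) (m - t)]
      push_cast
      rfl
    exact wp_cell (by simp [hG'.r0, hG'.r1, hG'.r5, h41]; omega)
      (by simp [hG'.r0, hG'.r1, hG'.r5, h41]; omega) (by simp [h40, G]) (by simp [G])
      (by simp [h41, G, hG'.r5]) (by simp [h40, h41, hG'.r5, hG'.r6, hG'.r8, key]) (hG.val_lt _)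
  · intro s' hW
    refine ⟨hW.frame, hW.inp, hW.keep, fun a ha j hj => ?_⟩
    have := hW.done a ha (m - j) (by change _ < m + 1; omega)
    simp only [G, val] at this
    rwa [show m - (m - j) = j by omega] at this

/-- The functionals that decode the smallest exponent. -/
def functionalTable : Prog :=
  fill 6 6 (setMem (var 40 + 1) 4 (var 41)
    ((mem (var 40) 4 (var 41) + mem (var 5) 1 (var 41 + 1) * mem (var 41) 3 (var 40)) % var 8))

/-- The functionals are prefix sums in v: passing from v to v + 1 adds the weight of a times one
coefficient of `coPoly m a`. Row 0 is the untouched zero memory. -/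
theorem wp_functionalTable (hG : ModGlob L n m N s) (h0 : ∀ i k, s.mem i 4 k = 0)
    (hw : ∀ a < m + 1, s.mem m 1 (a + 1) = ((weight m a : ℤ) : ZMod N).val)
    (hq : ∀ a < m + 1, ∀ j < m + 1, s.mem a 3 j = (((coPoly m a).coeff j : ℤ) : ZMod N).val) :
    WP L functionalTable ((m + 1) * ((m + 1) * 2 + 2) + 1) s fun s' => Frame 40 s s' ∧
      s'.inp = s.inp ∧ Keep 4 s s' ∧ ∀ v < m + 2, ∀ a < m + 1,
        s'.mem v 4 a = ((functional m v a : ℤ) : ZMod N).val := by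
  have hK := hG.K
  have := hG.neZero
  let G : Grid := ⟨m + 1, m + 1, 1, 4, id, fun c _ c' _ h => h⟩
  let val : ℕ → ℕ → ℕ := fun v a => ((functional m (v + 1) a : ℤ) : ZMod N).val
  have f0 : ∀ a, functional m 0 a = 0 := fun a => by simp [functional]
  refine (wp_fill G val 1 hG.r6 hG.r6 ?_).imp ?_
  · intro v hv a ha s' hb hW h40 h41
    change v < m + 1 at hv
    change a < m + 1 at ha
    have hG' := hG.of_frame hW.frame
    have h1 := hw a ha
    rw [← hW.plane _ _ (by simp [G])] at h1
    have h2 := hq a ha v hv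
    rw [← hW.plane _ _ (by simp [G])] at h2
    have h3 : s'.mem v 4 a = ((functional m v a : ℤ) : ZMod N).val := by
      rcases Nat.eq_zero_or_pos v with rfl | hv0
      · rw [hW.rest, h0, f0]
        · simp
        · rintro r' - c' - - ⟨h, -⟩
          simp only [G] at h
          omega
      · have := hW.done (v - 1) (by change _ < m + 1; omega) a ha (by omega)
        simp only [G, val, id] at this
        rwa [show v - 1 + 1 = v by omega] at this
    have key : (s'.mem v 4 a + s'.mem m 1 (a + 1) * s'.mem a 3 v) % N = val v a := by
      rw [h1, h2, h3, val_add_mul]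
      simp only [val, functional, Finset.sum_range_succ]
      push_cast
      congr 1
      ring
    exact wp_cell (by simp [hG'.r0, hG'.r1, h41]; omega)
      (by simp [hG'.r0, hG'.r1, h40, h41]; omega) (by simp [h40, G]) (by simp [G])
      (by simp [h41, G]) (by simp [h40, h41, hG'.r5, hG'.r8, key]) (hG.val_lt _)
  · intro s' hW
    refine ⟨hW.frame, hW.inp, hW.keep, fun v hv a ha => ?_⟩
    rcases Nat.eq_zero_or_pos v with rfl | hv0
    · rw [hW.rest, h0, f0]
      · simp
      · rintro r' - c' - ⟨h, -⟩
        simp only [G] at h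
        omega
    · have := hW.done (v - 1) (by change _ < m + 1; omega) a ha
      simp only [G, val, id] at this
      rwa [show v - 1 + 1 = v by omega] at this

/-- The values of the monomials. -/
def monomialTable : Prog :=
  forLoop 40 6 (setMem 0 5 (var 40) 1) ⨟ fill 5 6 (setMem (var 40 + 1) 5 (var 41)
    (var 41 * mem (var 40) 5 (var 41) % var 8))

/-- Row m + 1, which belongs to the code of ∞, is never written; its initial zeros are the values of
the zero polynomial. Row 0 is 1 at every point, at a = 0 too. -/
theorem wp_monomialTable (hG : ModGlob L n m N s) (h0 : ∀ i k, s.mem i 5 k = 0) :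
    WP L monomialTable ((m + 1) * 2 + 1 + (m * ((m + 1) * 2 + 2) + 1)) s fun s' => Frame 40 s s' ∧
      s'.inp = s.inp ∧ Keep 5 s s' ∧ ∀ v : ℕ∞, Small m v → ∀ a < m + 1,
        s'.mem (code m v) 5 a = (evalEmbed N a v).val := by
  have hK := hG.K
  have hV := hG.V
  have hN := hG.hN
  have hp := hG.toGlob.two_pow_pos
  have : Fact (1 < N) := ⟨by omega⟩
  let G : Grid := ⟨m, m + 1, 1, 5, id, fun c _ c' _ h => h⟩
  let val : ℕ → ℕ → ℕ := fun v a => ((a : ZMod N) ^ (v + 1)).val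
  refine WP.seq (WP.forLoop (m + 1) 1 (fun i s' => Frame 40 s s' ∧ s'.inp = s.inp ∧ Keep 5 s s' ∧
    ∀ r a, s'.mem r 5 a = if r = 0 ∧ a < i then 1 else 0) hG.r6 ?_ ?_ ?_)
  · exact ⟨(Frame.refl _ _).setReg, rfl, fun _ _ _ _ => rfl, fun r a => by simp [h0]⟩
  · rintro i hi s1 hb ⟨hF, hin, hk, hM⟩ h40 h6
    have hG1 := hG.of_frame hF
    refine WP.setMem (by simp [hG1.r0, hG1.r1, h40]; omega) (by simp) (by simp; omega) ?_
    simp only [eval_var, eval_ofNat, h40]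
    refine ⟨h40, h6, hF.setMem.setReg, hin, ?_, ?_⟩
    · intro a b c hne
      rw [Store.setReg_mem, Store.setMem_mem, if_neg fun h => hne h.2.1]
      exact hk a b c hne
    · intro r a
      rw [Store.setReg_mem, Store.setMem_mem, hM]
      split_ifs <;> omega
  · rintro s1 ⟨hF, hin, hk, hM⟩ -
    have hG1 := hG.of_frame hF
    refine (wp_fill G val 1 hG1.r5 hG1.r6 ?_).imp ?_
    · intro v hv a ha s' hb hW h40 h41
      change v < m at hv
      change a < m + 1 at ha
      have hG' := hG1.of_frame hW.frame
      have h3 : s'.mem v 5 a = ((a : ZMod N) ^ v).val := by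
        rcases Nat.eq_zero_or_pos v with rfl | hv0
        · rw [hW.rest, hM, if_pos ⟨rfl, ha⟩, pow_zero, ZMod.val_one]
          rintro r' - c' - - ⟨h, -⟩
          simp only [G] at h
          omega
        · have := hW.done (v - 1) (by change _ < m; omega) a ha (by omega)
          simp only [G, val, id] at this
          rwa [show v - 1 + 1 = v by omega] at this
      have key : a * s'.mem v 5 a % N = val v a := by
        have := val_add_natCast_mul (0 : ZMod N) ((a : ZMod N) ^ v) a
        rw [ZMod.val_zero, zero_add, zero_add] at this
        rw [h3, this]
        simp only [val, pow_succ']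
      exact wp_cell (by simp [hG'.r0, hG'.r1, h41]; omega)
        (by simp [hG'.r0, hG'.r1, h41]; omega) (by simp [h40, G]) (by simp [G])
        (by simp [h41, G]) (by simp [h40, h41, hG'.r8, key]) (hG.val_lt _)
    · intro s' hW
      refine ⟨hF.trans hW.frame, hW.inp.trans hin, ?_, fun v hv a ha => ?_⟩
      · intro i j k hj
        rw [hW.keep i j k hj, hk i j k hj]
      · induction v using ENat.recTopCoe with
        | top =>
          rw [code_top, evalEmbed_top, ZMod.val_zero, hW.rest, hM, if_neg (by omega)]
          rintro r' hr' c' - ⟨h, -⟩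
          simp only [G] at h hr'
          omega
        | coe v =>
          rw [small_coe] at hv
          rw [code_coe, evalEmbed_coe]
          rcases Nat.eq_zero_or_pos v with rfl | hv0
          · rw [hW.rest, hM, if_pos ⟨rfl, ha⟩, pow_zero, ZMod.val_one]
            rintro r' - c' - ⟨h, -⟩
            simp only [G] at h
            omega
          · have := hW.done (v - 1) (by change _ < m; omega) a ha
            simp only [G, val, id] at this
            rwa [show v - 1 + 1 = v by omega] at this

end RAM
end DPconv

end

/-! ### The search for a modulus, and all tables for interpolation -/

section
open Finset

namespace DPconv
namespace RAM
open DPconv.RAM.Expr DPconv.Query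

variable {L : Layout} {n m : ℕ} {s : Store}

/-- A modulus that is divisible by none of the numbers from `2` to `m`. -/
def GoodModulus (n m N : ℕ) : Prop :=
  2 ^ n < N ∧ N ≤ 2 * 2 ^ n ∧ ∀ d < m - 1, N % (d + 2) ≠ 0

/-- A prime that divides m! is at most m. So N need not be prime, and trial division by 2, …, m is
enough. -/
theorem GoodModulus.coprime {N : ℕ} (h : GoodModulus n m N) : Nat.Coprime m.factorial N := by
  refine Nat.coprime_of_dvd fun p hp h1 h2 => ?_
  have h3 := (hp.dvd_factorial).1 h1
  have h4 := hp.two_le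
  refine h.2.2 (p - 2) (by omega) ?_
  rw [show p - 2 + 2 = p by omega]
  exact Nat.mod_eq_zero_of_dvd h2

/-- Bertrand's postulate gives a prime between 2^n and 2^(n+1); it exceeds m, so no number from 2 to
m divides it. -/
theorem exists_goodModulus (n : ℕ) (hm : m ≤ 2 ^ n) : ∃ t < 2 ^ n, GoodModulus n m (2 ^ n + 1 + t) := by
  have hpos : 0 < 2 ^ n := by positivity
  obtain ⟨p, hp, h1, h2⟩ := Nat.exists_prime_lt_and_le_two_mul (2 ^ n) (by omega)
  refine ⟨p - 2 ^ n - 1, by omega, ?_⟩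
  rw [show 2 ^ n + 1 + (p - 2 ^ n - 1) = p by omega]
  refine ⟨h1, h2, fun d hd h => ?_⟩
  rcases (Nat.dvd_prime hp).1 (Nat.dvd_of_mod_eq_zero h) with h3 | h3 <;> omega

def modulusSearch : Prog :=
  assign 22 (var 5 - 1) ⨟ forLoop 20 3 (assign 23 (var 3 + 1 + var 20) ⨟ assign 24 1 ⨟
    forLoop 21 22 (cond (var 23 % (var 21 + 2)) 1 (assign 24 0) .skip) ⨟
    cond 0 (var 24) (assign 8 (var 23)) .skip)

/-- All candidates are tested and the last good one remains in register 8. The invariant only says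
that register 8 is good once a good candidate has been met. -/
theorem wp_modulusSearch (hG : Glob L n m s) (hm : m ≤ 2 ^ n) :
    WP L modulusSearch (2 ^ n * (m * 4 + 8) + 2) s fun s' => ∃ N, ModGlob L n m N s' ∧
      (∀ z < 20, z ≠ 8 → s'.reg z = s.reg z) ∧ s'.inp = s.inp ∧ s'.mem = s.mem := by
  have hV := hG.V
  have hm2 := hG.hm
  have hn2 := hG.hn
  have hp := hG.two_pow_pos
  refine (WP.seq (WP.assign (by simp) (by simp [hG.r5]; omega) (WP.forLoop (2 ^ n) ((m - 1) * 4 + 6)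
    (fun i s' => (∀ z < 20, z ≠ 8 → s'.reg z = s.reg z) ∧ s'.inp = s.inp ∧ s'.mem = s.mem ∧
      s'.reg 22 = m - 1 ∧
      ((∃ t < i, GoodModulus n m (2 ^ n + 1 + t)) → GoodModulus n m (s'.reg 8)))
    (by simp [hG.r3]) ?_ ?_ ?_))).le_time ?_
  · refine ⟨fun z hz _ => ?_, rfl, rfl, by simp [hG.r5], by simp⟩
    rw [Store.setReg_reg, if_neg (by omega), Store.setReg_reg, if_neg (by omega)]
  · rintro t ht s1 hb1 ⟨hF, hin, hm1, h22, hgood⟩ h20 h3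
    have h1 : 2 ^ n + 1 + t < L.V := by omega
    refine (WP.seq (WP.assign (by simp) (by simp [h20, h3]; omega)
      (WP.seq (WP.assign (by simp) (by simp; omega) (WP.seq (WP.forLoop (m - 1) 3
        (fun d s' => Frame 21 s1 s' ∧ s'.inp = s1.inp ∧ s'.mem = s1.mem ∧ s'.reg 22 = m - 1 ∧
          s'.reg 23 = 2 ^ n + 1 + t ∧
          s'.reg 24 = if ∀ e < d, (2 ^ n + 1 + t) % (e + 2) ≠ 0 then 1 else 0)
        (by simp [h22]) ?_ ?_ ?_)))))).le_time (T := 1 + (1 + ((m - 1) * (3 + 1) + 1 + 3))) (by omega)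
    · exact ⟨(((Frame.refl _ _).setReg).setReg).setReg, rfl, rfl, by simp [h22],
        by simp [h20, h3], by simp⟩
    · rintro d hd s2 hb2 ⟨hF2, hin2, hm2, h22', h23, h24⟩ h21 -
      refine (WP.cond 1 1 (by simp) (by simp) ?_ ?_).le_time (by omega)
      · intro h
        simp only [eval_mod, eval_var, eval_add, eval_ofNat, h21, h23] at h
        refine WP.assign (by simp) (by simp; omega) ?_
        refine ⟨by simpa using h21, by simpa using h22', hF2.setReg.setReg, hin2, hm2,
          by simpa using h22', by simpa using h23, ?_⟩
        rw [if_neg fun hc => hc d (by omega) (by simpa using h)]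
        simp
      · intro h
        simp only [eval_mod, eval_var, eval_add, eval_ofNat, h21, h23] at h
        refine WP.skip ⟨h21, h22', hF2.setReg, hin2, hm2,
          by simpa using h22', by simpa using h23, ?_⟩
        simp only [Store.setReg_reg]
        rw [if_neg (by norm_num), h24]
        congr 1
        apply propext
        constructor
        · intro hc e he
          rcases Nat.lt_succ_iff_lt_or_eq.1 he with h5 | rfl
          · exact hc e h5
          · intro h6
            exact h (by rw [h6]; exact one_pos)
        · exact fun hc e he => hc e (by omega)
    · rintro s2 ⟨hF2, hin2, hm2, h22', h23, h24⟩ -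
      have e20 : s2.reg 20 = t := (hF2 20 (by norm_num)).trans h20
      have e3 : s2.reg 3 = 2 ^ n := (hF2 3 (by norm_num)).trans h3
      have hrange : 2 ^ n < 2 ^ n + 1 + t ∧ 2 ^ n + 1 + t ≤ 2 * 2 ^ n := by omega
      refine (WP.cond 1 1 (by simp) (by simp) ?_ ?_).le_time (by omega)
      · intro h
        simp only [eval_var, eval_zero, h24] at h
        have hg : GoodModulus n m (2 ^ n + 1 + t) := by
          refine ⟨hrange.1, hrange.2, ?_⟩
          by_contra hc
          rw [if_neg hc] at h
          exact lt_irrefl _ h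
        refine WP.assign (by simp) (by simp [h23]; omega) ?_
        refine ⟨by simpa using e20, by simpa using e3, fun z hz hz8 => ?_, hin2.trans hin,
          hm2.trans hm1, by simpa using h22', fun _ => ?_⟩
        · rw [Store.setReg_reg, if_neg (by omega), Store.setReg_reg, if_neg hz8,
            hF2 z (by omega), hF z hz hz8]
        · simpa [h23] using hg
      · intro h
        simp only [eval_var, eval_zero, h24] at h
        refine WP.skip ⟨e20, e3, fun z hz hz8 => ?_, hin2.trans hin, hm2.trans hm1,
          by simpa using h22', ?_⟩
        · rw [Store.setReg_reg, if_neg (by omega), hF2 z (by omega), hF z hz hz8]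
        · rintro ⟨u, hu, hg⟩
          rcases Nat.lt_succ_iff_lt_or_eq.1 hu with h5 | rfl
          · have := hgood ⟨u, h5, hg⟩
            simpa [hF2 8 (by norm_num)] using this
          · rw [if_pos hg.2.2] at h
            exact absurd one_pos h
  · rintro s' ⟨hF, hin, hm1, h22, hgood⟩ -
    have hg := hgood (exists_goodModulus n hm)
    exact ⟨_, ⟨hG.of_frame' hF, rfl, hg.1, hg.2.1, hg.coprime, hm⟩, hF, hin, hm1⟩
  · have : (m - 1) * 4 + 6 + 1 ≤ m * 4 + 8 := by omega
    have := Nat.mul_le_mul_left (2 ^ n) this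
    omega

/-- All tables that do not depend on the instance. -/
def interpolationTables : Prog :=
  assign 22 0 ⨟ assign 23 1 ⨟ assign 25 1 ⨟ coeffTable 5 ⨟
  assign 22 1 ⨟ assign 23 0 ⨟ assign 25 2 ⨟ coeffTable 6 ⨟
  quotientTable ⨟ functionalTable ⨟ monomialTable

/-- The tables for decoding and encoding are in place. -/
structure Tables (m N : ℕ) (s : Store) : Prop where
  dec : ∀ v < m + 2, ∀ a < m + 1, s.mem v 4 a = ((functional m v a : ℤ) : ZMod N).val
  enc : ∀ v : ℕ∞, Small m v → ∀ a < m + 1, s.mem (code m v) 5 a = (evalEmbed N a v).val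

theorem wp_interpolationTables {N : ℕ} (hG : ModGlob L n m N s)
    (h0 : ∀ i j k, 1 ≤ j → s.mem i j k = 0) :
    WP L interpolationTables (6 * ((m + 1) * (2 * m + 6)) + 20) s fun s' => Frame 20 s s' ∧
      s'.inp = s.inp ∧ (∀ i j k, (j = 0 ∨ 6 ≤ j) → s'.mem i j k = s.mem i j k) ∧
      Tables m N s' := by
  have hV := hG.V
  have hK := hG.K
  refine (WP.seq (WP.assign (by simp) (by simp; omega) (WP.seq (WP.assign (by simp) (by simp; omega)
    (WP.seq (WP.assign (by simp) (by simp; omega) (WP.seq (WP.imp (wp_coeffTable (n := n) (m := m)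
      (N := N) (R := m) (J := 1) (β := 0) (γ := 1) ?_ ?_ (by omega) (by simp) (by norm_num) (by simp)
      (by simp) ?_ (fun r => (Polynomial.X - Polynomial.C 1) ^ r) (pow_zero _) ?_) ?_)))))))).le_time
    (T := 1 + (1 + (1 + (m * ((m + 2) * 2 + 2) + 2 + (1 + (1 + (1 + ((m + 1) * ((m + 2) * 2 + 2) + 2
      + ((m + 1) * ((m + 1) * 2 + 2) + 1 + ((m + 1) * ((m + 1) * 2 + 2) + 1 + ((m + 1) * 2 + 1 + (m * ((m + 1) * 2 + 2) + 1)))))))))))) ?_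
  · exact hG.of_frame (((Frame.refl 20 s).setReg).setReg).setReg
  · simp [hG.r5]
  · exact fun i k => h0 i 1 k le_rfl
  · intro r; simp [pow_succ]
  · rintro s1 ⟨hF1, hin1, hk1, hM1⟩
    have hF1' : Frame 20 s s1 :=
      (((Frame.refl 20 s).setReg).setReg).setReg.trans (hF1 : Frame 40 _ s1)
    have hG1 := hG.of_frame hF1'
    refine WP.seq (WP.assign (by simp) (by simp; omega) (WP.seq (WP.assign (by simp) (by simp; omega)
      (WP.seq (WP.assign (by simp) (by simp; omega) (WP.seq (WP.imp (wp_coeffTable (n := n) (m := m)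
        (N := N) (R := m + 1) (J := 2) (β := 1) (γ := 0) ?_ ?_ (by omega) (by simp) (by norm_num) (by simp)
        (by simp) ?_ nodePoly ?_ ?_) ?_)))))))
    · exact hG1.of_frame (((Frame.refl 20 s1).setReg).setReg).setReg
    · simp [hG1.r6]
    · intro i k
      rw [Store.setReg_mem, Store.setReg_mem, Store.setReg_mem, hk1 _ _ _ (by norm_num)]
      exact h0 i 2 k (by norm_num)
    · simp [nodePoly]
    · intro r; simp [nodePoly, Finset.prod_range_succ]
    · rintro s2 ⟨hF2, hin2, hk2, hM2⟩
      have hF2' : Frame 20 s s2 :=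
        hF1'.trans ((((Frame.refl 20 s1).setReg).setReg).setReg.trans (hF2 : Frame 40 _ s2))
      have hG2 := hG.of_frame hF2'
      refine WP.seq ((wp_quotientTable hG2 ?_ ?_).imp ?_)
      · intro i k
        rw [hk2 _ _ _ (by norm_num), Store.setReg_mem, Store.setReg_mem, Store.setReg_mem,
          hk1 _ _ _ (by norm_num)]
        exact h0 i 3 k (by norm_num)
      · intro j hj
        rw [hM2 (m + 1) le_rfl (j + 2) (by omega), Polynomial.coeff_X_mul]
      · rintro s3 ⟨hF3, hin3, hk3, hM3⟩
        have hF3' := hF2'.trans hF3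
        refine WP.seq ((wp_functionalTable (hG.of_frame hF3') ?_ ?_ hM3).imp ?_)
        · intro i k
          rw [hk3 _ _ _ (by norm_num), hk2 _ _ _ (by norm_num), Store.setReg_mem, Store.setReg_mem,
            Store.setReg_mem, hk1 _ _ _ (by norm_num)]
          exact h0 i 4 k (by norm_num)
        · intro a ha
          rw [hk3 _ _ _ (by norm_num), hk2 _ _ _ (by norm_num), Store.setReg_mem, Store.setReg_mem,
            Store.setReg_mem, hM1 m le_rfl (a + 1) (by omega), Polynomial.coeff_X_mul]
          rfl
        · rintro s4 ⟨hF4, hin4, hk4, hM4⟩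
          have hF4' := hF3'.trans hF4
          refine (wp_monomialTable (hG.of_frame hF4') ?_).imp ?_
          · intro i k
            rw [hk4 _ _ _ (by norm_num), hk3 _ _ _ (by norm_num), hk2 _ _ _ (by norm_num),
              Store.setReg_mem, Store.setReg_mem, Store.setReg_mem, hk1 _ _ _ (by norm_num)]
            exact h0 i 5 k (by norm_num)
          · rintro s5 ⟨hF5, hin5, hk5, hM5⟩
            refine ⟨hF4'.trans hF5, ?_, ?_, ?_, hM5⟩
            · rw [hin5, hin4, hin3, hin2]; exact hin1
            · intro i j k hj
              rw [hk5 _ _ _ (by omega), hk4 _ _ _ (by omega), hk3 _ _ _ (by omega),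
                hk2 _ _ _ (by omega), Store.setReg_mem, Store.setReg_mem, Store.setReg_mem,
                hk1 _ _ _ (by omega)]
              rfl
            · intro v hv a ha
              rw [hk5 _ _ _ (by norm_num), hM4 v hv a ha]
  · nlinarith

end RAM
end DPconv

end

/-! ### Fast transforms in place, and the ranked product -/

section
open Finset

namespace DPconv
namespace RAM
open DPconv.RAM.Expr DPconv.Query

variable {L : Layout} {n m N : ℕ} {s : Store}

/-- The zeta or Möbius transform, in place, of all functions in the columns of the plane given by
register 25; the sign is given by register 26. -/
def transform : Prog :=
  forLoop 27 2 (assign 28 (mem (var 27) 0 4) ⨟ fill 3 6 (setMem (var 40) (var 25) (var 41)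
    ((mem (var 40) (var 25) (var 41) + var 40 / var 28 % 2 * var 26 *
      mem (var 40 - var 40 / var 28 % 2 * var 28) (var 25) (var 41)) % var 8)))

/-- With the bit b of S at position i as a factor, one formula without a branch covers both cases;
for b = 0 the cell read is that of S itself and its contribution is 0. -/
theorem partialTransform_ofMask {R : Type*} [CommRing R] (σ : R) (g : Finset (Fin n) → R) {i : ℕ}
    (hi : i < n) (S : ℕ) :
    partialTransform σ g (i + 1) (ofMask n S) = partialTransform σ g i (ofMask n S) +
      ((S / 2 ^ i % 2 : ℕ) : R) * σ *
        partialTransform σ g i (ofMask n (S - S / 2 ^ i % 2 * 2 ^ i)) := by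
  have h := partialTransform_succ σ g ⟨i, hi⟩ (ofMask n S)
  simp only at h
  rw [h]
  congr 1
  by_cases hb : S.testBit i = true
  · have h1 := testBit_iff_mod.1 hb
    rw [if_pos (by simpa using hb), h1, one_mul, Nat.cast_one, one_mul,
      (ofMask_erase (i := ⟨i, hi⟩) hb).2]
  · have h1 : S / 2 ^ i % 2 = 0 := Nat.mod_two_ne_one.1 fun h => hb (testBit_iff_mod.2 h)
    rw [if_neg (by simpa using hb), h1]
    simp

theorem wp_transform {J σ : ℕ} (hG : ModGlob L n m N s) (hP : ∀ i < n, s.mem i 0 4 = 2 ^ i)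
    (hJ : s.reg 25 = J) (hJ0 : J ≠ 0) (hJK : J < L.K) (hσ : s.reg 26 = σ)
    (g : ℕ → Finset (Fin n) → ZMod N)
    (hg : ∀ S < 2 ^ n, ∀ a < m + 1, s.mem S J a = (g a (ofMask n S)).val) :
    WP L transform (n * (2 ^ n * (2 * m + 4) + 3) + 1) s fun s' => Frame 27 s s' ∧ s'.inp = s.inp ∧
      Keep J s s' ∧ ∀ S < 2 ^ n, ∀ a < m + 1,
        s'.mem S J a = (partialTransform (σ : ZMod N) (g a) n (ofMask n S)).val := by
  have hK := hG.K
  have hV := hG.V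
  have := hG.neZero
  refine (WP.forLoop n (1 + (2 ^ n * ((m + 1) * (1 + 1) + 2) + 1)) (fun i s' => Frame 27 s s' ∧
    s'.inp = s.inp ∧ Keep J s s' ∧ ∀ S < 2 ^ n, ∀ a < m + 1,
      s'.mem S J a = (partialTransform (σ : ZMod N) (g a) i (ofMask n S)).val) hG.r2
      ?_ ?_ ?_).le_time (le_of_eq (by ring))
  · refine ⟨(Frame.refl _ _).setReg, rfl, fun _ _ _ _ => rfl, fun S hS a ha => ?_⟩
    rw [partialTransform_zero, Store.setReg_mem, hg S hS a ha]
  · rintro i hi s1 hb1 ⟨hF, hin, hk, hM⟩ h27 h2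
    have hG1 := hG.of_frame hF
    have hp : s1.mem i 0 4 = 2 ^ i := by rw [hk _ _ _ hJ0.symm, hP i hi]
    have hpn : 2 ^ i < 2 ^ n := Nat.pow_lt_pow_right (by norm_num) hi
    let G : Grid := ⟨2 ^ n, m + 1, 0, J, id, fun c _ c' _ h => h⟩
    let val : ℕ → ℕ → ℕ := fun S a =>
      (partialTransform (σ : ZMod N) (g a) (i + 1) (ofMask n S)).val
    have hF1 : Frame 28 s1 (s1.setReg 28 (2 ^ i)) := (Frame.refl _ _).setReg
    refine WP.seq (WP.assign (by simp [hG1.r0, hG1.r1]; omega) (by simp [h27, hp]; omega)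
      ((wp_fill G val 1 (by simp [hG1.r3, G]) (by simp [hG1.r6, G]) ?_).imp ?_))
    · intro S hS a ha s' hb hW h40 h41
      change S < 2 ^ n at hS
      change a < m + 1 at ha
      simp only [eval_mem, eval_var, eval_ofNat, h27, hp] at hW
      have hF2 : Frame 28 s1 s' := hF1.trans hW.frame
      have hG2 := hG1.of_frame hF2
      have e25 : s'.reg 25 = J := by rw [hF2 25 (by norm_num), hF 25 (by norm_num), hJ]
      have e26 : s'.reg 26 = σ := by rw [hF2 26 (by norm_num), hF 26 (by norm_num), hσ]
      have e28 : s'.reg 28 = 2 ^ i := by rw [hW.frame 28 (by norm_num)]; simp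
      have h1 : s'.mem S J a = (partialTransform (σ : ZMod N) (g a) i (ofMask n S)).val := by
        rw [← hM S hS a ha]
        exact hW.todo ha (by omega)
      have key : (s'.mem S J a + S / 2 ^ i % 2 * σ * s'.mem (S - S / 2 ^ i % 2 * 2 ^ i) J a) % N =
          val S a := by
        simp only [val]
        rw [partialTransform_ofMask _ _ hi, h1]
        rcases Nat.mod_two_eq_zero_or_one (S / 2 ^ i) with hb0 | hb1
        · rw [hb0]
          simp only [zero_mul, add_zero, Nat.cast_zero]
          exact Nat.mod_eq_of_lt (ZMod.val_lt _)
        · have hle : 2 ^ i ≤ S := by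
            by_contra hc
            rw [Nat.div_eq_of_lt (by omega)] at hb1
            omega
          have hpos : 0 < 2 ^ i := by positivity
          -- The cell of S - 2^i has been visited earlier in this round. Since that mask lacks the
          -- bit i, the visit did not change its value, so the transform may be done in place.
          have h2 := hW.done (S - 2 ^ i) (by change _ < 2 ^ n; omega) a ha (Or.inl (by omega))
          simp only [G, val, id, add_zero] at h2
          have hb2 : (S - 2 ^ i) / 2 ^ i % 2 = 0 := by
            have h3 := Nat.add_div_left (S - 2 ^ i) hpos
            rw [Nat.add_sub_of_le hle] at h3
            omega
          rw [partialTransform_ofMask _ _ hi, hb2] at h2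
          simp only [Nat.cast_zero, zero_mul, add_zero] at h2
          rw [hb1, one_mul, one_mul, h2, val_add_natCast_mul, Nat.cast_one, one_mul]
      exact wp_cell (by simp [hG2.r0, hG2.r1, e25, h41]; omega)
        (by simp [hG2.r0, hG2.r1, e25, h41]; omega) (by simp [h40, G]) (by simp [e25, G])
        (by simp [h41, G]) (by simp [h40, h41, e25, e26, e28, hG2.r8, key]) (hG.val_lt _)
    · intro s' hW
      simp only [eval_mem, eval_var, eval_ofNat, h27, hp] at hW
      have hF2 : Frame 28 s1 s' := hF1.trans hW.frame
      refine ⟨by rw [hF2 27 (by norm_num), h27], by rw [hF2 2 (by norm_num), h2],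
        ((hF.trans hF2).setReg), hW.inp.trans hin, ?_, ?_⟩
      · intro a b c hne
        rw [Store.setReg_mem, hW.keep a b c hne]
        exact hk a b c hne
      · exact fun S hS a ha => hW.done S hS a ha
  · rintro s' h -
    exact h

/-- The planes from 10 on hold, for all ranks, the evaluated transforms of the embedding of `D`. -/
def Planes (m N : ℕ) (D : Finset (Fin n) → ℕ∞) (d : ℕ) (s : Store) : Prop :=
  ∀ S < 2 ^ n, ∀ a < m + 1, s.mem S (10 + d) a =
    (rankedZeta (fun T => evalEmbed N a (D T)) d (ofMask n S)).val

/-- The ranked convolution in layer `k`, where `k` and `k + 1` are given by the registers 22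
and 23. -/
def rankedProduct : Prog :=
  fill 3 6 (assign 42 0 ⨟ forLoop 43 23 (assign 42 ((var 42 +
    mem (var 40) (10 + var 43) (var 41) * mem (var 40) (10 + var 22 - var 43) (var 41)) % var 8)) ⨟
    setMem (var 40) 6 (var 41) (var 42))

/-- The planes hold values, not coefficients, so a product of polynomials of degree up to m costs
one multiplication per evaluation point. -/
theorem wp_rankedProduct {k : ℕ} {D : Finset (Fin n) → ℕ∞} (hG : ModGlob L n m N s) (hk : k ≤ n)
    (h22 : s.reg 22 = k) (h23 : s.reg 23 = k + 1) (hD : ∀ d ≤ n, Planes m N D d s) :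
    WP L rankedProduct (2 ^ n * ((m + 1) * (2 * n + 6) + 2) + 1) s fun s' => Frame 40 s s' ∧
      s'.inp = s.inp ∧ Keep 6 s s' ∧ ∀ S < 2 ^ n, ∀ a < m + 1, s'.mem S 6 a =
        (rankedConv (fun T => evalEmbed N a (D T)) (fun T => evalEmbed N a (D T)) k
          (ofMask n S)).val := by
  have hK := hG.K
  have hV := hG.V
  have := hG.neZero
  let G : Grid := ⟨2 ^ n, m + 1, 0, 6, id, fun c _ c' _ h => h⟩
  let ζ : ℕ → ℕ → ℕ → ZMod N := fun S a d =>
    rankedZeta (fun T => evalEmbed N a (D T)) d (ofMask n S)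
  let val : ℕ → ℕ → ℕ := fun S a => (∑ d ∈ Finset.range (k + 1), ζ S a d * ζ S a (k - d)).val
  refine ((wp_fill G val (2 * n + 5) hG.r3 hG.r6 ?_).imp ?_).le_time le_rfl
  · intro S hS a ha s1 hb1 hW h40 h41
    change S < 2 ^ n at hS
    change a < m + 1 at ha
    refine (WP.seq (WP.assign (by simp) (by simp; omega) (WP.seq (WP.forLoop (k + 1) 1
      (fun d s' => Frame 42 s1 s' ∧ s'.inp = s1.inp ∧ s'.mem = s1.mem ∧ s'.reg 42 =
        (∑ d ∈ Finset.range d, ζ S a d * ζ S a (k - d)).val) ?_ ?_ ?_ ?_)))).le_time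
      (T := 1 + ((k + 1) * 2 + 1 + 1)) (by omega)
    · simp [hW.frame 23 (by norm_num), h23]
    · exact ⟨((Frame.refl _ _).setReg).setReg, rfl, rfl, by simp⟩
    · rintro d hd s2 hb2 ⟨hF2, hin2, hm2, h42⟩ h43 h23'
      have hG2 := hG.of_frame (hW.frame.trans hF2)
      have e40 : s2.reg 40 = S := (hF2 40 (by norm_num)).trans h40
      have e41 : s2.reg 41 = a := (hF2 41 (by norm_num)).trans h41
      have e22 : s2.reg 22 = k := by rw [hF2 22 (by norm_num), hW.frame 22 (by norm_num), h22]
      have hp : ∀ d ≤ n, s2.mem S (10 + d) a = (ζ S a d).val := by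
        intro d hd
        rw [hm2, hW.plane _ _ (by simp only [G]; omega)]
        exact hD d hd S hS a ha
      have key : (s2.reg 42 + s2.mem S (10 + d) a * s2.mem S (10 + k - d) a) % N =
          (∑ d ∈ Finset.range (d + 1), ζ S a d * ζ S a (k - d)).val := by
        rw [h42, hp d (by omega), show 10 + k - d = 10 + (k - d) by omega, hp _ (by omega),
          val_add_mul, Finset.sum_range_succ]
      refine WP.assign (by simp [hG2.r0, hG2.r1, e41, e22, h43]; omega) ?_ ?_
      · simp only [eval_mod, eval_add, eval_mul, eval_sub, eval_mem, eval_var, eval_ofNat, h43,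
          e40, e41, e22, hG2.r8, key]
        exact hG.val_lt _
      · refine ⟨by simpa using h43, by simpa using h23', hF2.setReg.setReg, hin2, hm2, ?_⟩
        simp only [eval_mod, eval_add, eval_mul, eval_sub, eval_mem, eval_var, eval_ofNat, h43,
          e40, e41, e22, hG2.r8, key]
        simp
    · rintro s2 ⟨hF2, hin2, hm2, h42⟩ -
      have hG2 := hG.of_frame (hW.frame.trans hF2)
      have e40 : s2.reg 40 = S := (hF2 40 (by norm_num)).trans h40
      have e41 : s2.reg 41 = a := (hF2 41 (by norm_num)).trans h41
      refine (wp_cell (by simp [hG2.r0, hG2.r1, e41]; omega) (by simp) (i := var 40) (j := 6) (k := var 41)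
        (i' := S) (j' := 6) (k' := a)
        (e := var 42)
        (v := val S a) (by simp [e40]) (by simp) (by simp [e41]) h42 (hG.val_lt _)).imp ?_
      rintro s3 ⟨hF3, hin3, hm3⟩
      refine ⟨hF2.trans hF3, hin3.trans hin2, ?_⟩
      rw [hm3]
      funext i j c
      rw [Store.setMem_mem, Store.setMem_mem, hm2]
      rfl
  · intro s' hW
    exact ⟨hW.frame, hW.inp, hW.keep, fun S hS a ha => hW.done S hS a ha⟩

end RAM
end DPconv

end

/-! ### Decoding a layer by bisection -/

section
open Finset

namespace DPconv
namespace RAM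
open DPconv.RAM.Expr DPconv.Query

variable {L : Layout} {n m N : ℕ} {s : Store}

/-- Binary search for the smallest exponent of the polynomial in row `reg 27` of plane 6. -/
def decode : Prog :=
  assign 31 0 ⨟ assign 32 (var 7) ⨟ forLoop 33 10 (
    assign 34 ((var 31 + var 32) / 2) ⨟ assign 35 0 ⨟
    forLoop 36 6 (assign 35 ((var 35 + mem (var 34) 4 (var 36) * mem (var 27) 6 (var 36)) % var 8)) ⨟
    cond 0 (var 35) (assign 32 (var 34)) (assign 31 (var 34)))

/-- Bisection with lo ≤ code x < hi. The initial gap m + 2 is at most 2^(n+1), because m ≤ 2^n, so n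
+ 1 rounds reduce it to 1. The value ∞ passes every test up to v = m + 1, which is its code, so the
functionals with v < m + 2 suffice. -/
theorem wp_decode {S : ℕ} {x : ℕ∞} {z : ℕ → ZMod N} (hG : ModGlob L n m N s) (hT : Tables m N s)
    (h27 : s.reg 27 = S) (hz : ∀ a < m + 1, s.mem S 6 a = (z a).val) (hx : Small m x)
    (hdec : ∀ v : ℕ, ∑ a ∈ Finset.range (m + 1), ((functional m v a : ℤ) : ZMod N) * z a = 0 ↔
      (v : ℕ∞) ≤ x) :
    WP L decode ((n + 1) * (2 * m + 9) + 3) s fun s' => Frame 31 s s' ∧ s'.inp = s.inp ∧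
      s'.mem = s.mem ∧ s'.reg 31 = code m x := by
  have hK := hG.K
  have hV := hG.V
  have hm' := hG.hm'
  have := hG.neZero
  have hcode : ∀ v < m + 2, (v : ℕ∞) ≤ x ↔ v ≤ code m x := by
    intro v hv
    induction x using ENat.recTopCoe with
    | top => simp; omega
    | coe x => simp
  have hle := hx.code_le
  refine (WP.seq (WP.assign (by simp) (by simp; omega) (WP.seq (WP.assign (by simp)
    (by simp [hG.r7]; omega) (WP.forLoop (n + 1) (2 * m + 8) (fun i s' => Frame 31 s s' ∧
      s'.inp = s.inp ∧ s'.mem = s.mem ∧ s'.reg 31 ≤ code m x ∧ code m x < s'.reg 32 ∧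
      s'.reg 32 ≤ m + 2 ∧ s'.reg 32 ≤ s'.reg 31 + 2 ^ (n + 1 - i)) ?_ ?_ ?_ ?_))))).le_time
    (T := 1 + (1 + ((n + 1) * (2 * m + 8 + 1) + 1))) (le_of_eq (by ring))
  · simp [hG.r10]
  · refine ⟨(((Frame.refl _ _).setReg).setReg).setReg, rfl, rfl, by simp, ?_, by simp [hG.r7], ?_⟩
    · simp [hG.r7]; omega
    · have := hG.toGlob.two_pow_pos
      simp [hG.r7, pow_succ]; omega
  · rintro i hi s1 hb1 ⟨hF1, hin1, hm1, hlo, hhi, hhi', hgap⟩ h33 h10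
    set lo := s1.reg 31
    set hi := s1.reg 32
    set mid := (lo + hi) / 2 with hmid
    have hmlt : mid < m + 2 := by omega
    refine (WP.seq (WP.assign (by simp) ?_ (WP.seq (WP.assign (by simp) (by simp; omega) (WP.seq
      (WP.forLoop (m + 1) 1 (fun a s' => Frame 33 s1 s' ∧ s'.inp = s.inp ∧ s'.mem = s.mem ∧
        s'.reg 33 = i ∧ s'.reg 34 = mid ∧
        s'.reg 35 = (∑ a ∈ Finset.range a, ((functional m mid a : ℤ) : ZMod N) * z a).val)
        ?_ ?_ ?_ ?_)))))).le_time (T := 1 + (1 + ((m + 1) * 2 + 1 + 3))) (by omega)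
    · simp only [eval_div, eval_add, eval_var, eval_ofNat]
      change mid < _
      omega
    · simp [hG.of_frame hF1 |>.r6]
    · exact ⟨((Frame.refl _ _).setReg.setReg).setReg, hin1, hm1, by simpa using h33,
        by simp [hmid, lo, hi], by simp⟩
    · rintro a ha s2 hb2 ⟨hF2, hin2, hm2, h33', h34, h35⟩ h36 h6
      have hG2 := hG.of_frame (hF1.trans hF2)
      have e27 : s2.reg 27 = S := by rw [hF2 27 (by norm_num), hF1 27 (by norm_num), h27]
      have key : (s2.reg 35 + s2.mem mid 4 a * s2.mem S 6 a) % N =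
          (∑ a ∈ Finset.range (a + 1), ((functional m mid a : ℤ) : ZMod N) * z a).val := by
        rw [h35, hm2, hT.dec mid hmlt a ha, hz a ha, val_add_mul, Finset.sum_range_succ]
      refine WP.assign (by simp [hG2.r0, hG2.r1, h36]; omega) ?_ ?_
      · simp only [eval_mod, eval_add, eval_mul, eval_mem, eval_var, eval_ofNat, h34, h36, e27,
          hG2.r8, key]
        exact hG.val_lt _
      · refine ⟨by simpa using h36, by simpa using h6, hF2.setReg.setReg, hin2, hm2,
          by simpa using h33', by simpa using h34, ?_⟩
        simp only [eval_mod, eval_add, eval_mul, eval_mem, eval_var, eval_ofNat, h34, h36, e27,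
          hG2.r8, key]
        simp
    · rintro s2 ⟨hF2, hin2, hm2, h33', h34, h35⟩ -
      have e10 : s2.reg 10 = n + 1 := (hF2 10 (by norm_num)).trans h10
      have e31 : s2.reg 31 = lo := hF2 31 (by norm_num)
      have e32 : s2.reg 32 = hi := hF2 32 (by norm_num)
      have hFs : Frame 31 s s2 := hF1.trans hF2
      have hpow : 2 ^ (n + 1 - i) = 2 * 2 ^ (n + 1 - (i + 1)) := by
        rw [← pow_succ']; congr 1; omega
      rw [Nat.add_sub_add_right] at hpow
      have htest : 0 < s2.reg 35 ↔ ¬ mid ≤ code m x := by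
        rw [h35, Nat.pos_iff_ne_zero, Ne, ZMod.val_eq_zero, hdec, hcode mid hmlt]
      refine (WP.cond 1 1 (by simp) (by simp) ?_ ?_).le_time (by omega)
      · intro h
        have h' := htest.1 (by simpa using h)
        refine WP.assign (by simp) (by simp [h34]; omega) ?_
        refine ⟨by simpa using h33', by simpa using e10, hFs.setReg.setReg, hin2, hm2, ?_⟩
        simp [h34, e31]
        omega
      · intro h
        have h' : mid ≤ code m x := not_not.1 fun hc => h (by simpa using htest.2 hc)
        refine WP.assign (by simp) (by simp [h34]; omega) ?_
        refine ⟨by simpa using h33', by simpa using e10, hFs.setReg.setReg, hin2, hm2, ?_⟩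
        simp [h34, e32]
        omega
  · rintro s' ⟨hF, hin, hm, hlo, hhi, -, hgap⟩ -
    refine ⟨hF, hin, hm, ?_⟩
    simp at hgap
    omega

/-- The values of the minimum over the sets of size `k` (register 22) are completed. -/
def decodeLayer : Prog :=
  forLoop 27 3 (cond 0 ((1 - ((mem (var 27) 0 1 - var 22) + (var 22 - mem (var 27) 0 1))) *
      mem (var 27) 0 2)
    (decode ⨟ cond (var 31) (var 6)
      (setMem (var 27) 0 3 (var 31 + inp (var 9 + var 27))) .skip) .skip)

open Classical in
/-- The parts of the state that do not change any more. -/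
structure Ready (L : Layout) (Q : Query n) (N : ℕ) (s : Store) : Prop extends
    ModGlob L n (Q.maxCard * n) N s where
  tables : Tables (Q.maxCard * n) N s
  pow : ∀ i < n, s.mem i 0 4 = 2 ^ i
  pop : ∀ S < 2 ^ n, s.mem S 0 1 = (ofMask n S).card
  conn : ∀ S < 2 ^ n, s.mem S 0 2 = if ConnMask Q S then 1 else 0
  card : ∀ S < 2 ^ n, Q.Joinable (ofMask n S) → s.inp (1 + n * n + S) = Q.card (ofMask n S)

theorem Ready.of_frame {Q : Query n} {lo : ℕ} {s' : Store} (h : Ready L Q N s) (hf : Frame lo s s')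
    (hin : s'.inp = s.inp)
    (hm : ∀ i j k, ((j = 0 ∧ k ≠ 3) ∨ j = 4 ∨ j = 5) → s'.mem i j k = s.mem i j k)
    (hlo : 20 ≤ lo := by norm_num) : Ready L Q N s' where
  toModGlob := h.toModGlob.of_frame hf hlo
  tables := ⟨fun v hv a ha => by rw [hm _ _ _ (by simp), h.tables.dec v hv a ha],
    fun v hv a ha => by rw [hm _ _ _ (by simp), h.tables.enc v hv a ha]⟩
  pow := fun i hi => by rw [hm _ _ _ (by simp), h.pow i hi]
  pop := fun i hi => by rw [hm _ _ _ (by simp), h.pop i hi]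
  conn := fun i hi => by rw [hm _ _ _ (by simp), h.conn i hi]
  card := fun i hi => by rw [hin]; exact h.card i hi

/-- With truncated subtraction the inner sum is |a - b|; this allows a test of equality inside an
expression. -/
theorem indicator_eq (a b : ℕ) : 1 - ((a - b) + (b - a)) = if a = b then 1 else 0 := by
  split_ifs <;> omega

/-- The convolution is read off only at connected sets of size k + 2. Sets of other sizes keep their
entries by definition of the recursion, and disconnected sets of this size stay at ∞. Decoding looks
at planes 4 and 6 only, so overwriting the column of costs during the loop is harmless. -/
theorem wp_decodeLayer {Q : Query n} {k : ℕ} (hR : Ready L Q N s)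
    (h22 : s.reg 22 = k + 2) (hD : DPCol n (Q.maxCard * n) (dpTable Q (k + 1)) s)
    (hz : ∀ S < 2 ^ n, ∀ a < Q.maxCard * n + 1, s.mem S 6 a =
      (fscLayer (fun T => evalEmbed N a (dpTable Q (k + 1) T))
        (fun T => evalEmbed N a (dpTable Q (k + 1) T)) (k + 2) (ofMask n S)).val) :
    WP L decodeLayer (2 ^ n * ((n + 1) * (2 * (Q.maxCard * n) + 9) + 9) + 1) s fun s' =>
      Frame 27 s s' ∧ s'.inp = s.inp ∧ SameBut 0 3 s s' ∧
      DPCol n (Q.maxCard * n) (dpTable Q (k + 2)) s' := by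
  set m := Q.maxCard * n with hm
  have hK := hR.K
  have hV := hR.V
  refine (WP.forLoop (2 ^ n) ((n + 1) * (2 * m + 9) + 8) (fun i s' => Frame 27 s s' ∧
    s'.inp = s.inp ∧ SameBut 0 3 s s' ∧ ∀ S < 2 ^ n, s'.mem S 0 3 =
      if S < i then code m (dpTable Q (k + 2) (ofMask n S))
      else code m (dpTable Q (k + 1) (ofMask n S))) hR.r3 ?_ ?_ ?_).le_time le_rfl
  · exact ⟨(Frame.refl _ _).setReg, rfl, SameBut.refl _ _ _, fun S hS => by simp [hD S hS]⟩
  · rintro S hS s1 hb1 ⟨hF, hin, hB, hM⟩ h27 h3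
    have hR1 : Ready L Q N s1 := hR.of_frame hF hin fun i j c h => hB _ _ _ (by omega)
    have hG1 := hR1.toModGlob
    have e22 : s1.reg 22 = k + 2 := (hF 22 (by norm_num)).trans h22
    have step : ∀ s2 : Store, (∀ T, T ≠ S → s2.mem T 0 3 = s1.mem T 0 3) →
        s2.mem S 0 3 = code m (dpTable Q (k + 2) (ofMask n S)) → ∀ T < 2 ^ n, s2.mem T 0 3 =
          if T < S + 1 then code m (dpTable Q (k + 2) (ofMask n T))
          else code m (dpTable Q (k + 1) (ofMask n T)) := by
      intro s2 h1 h2 T hT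
      by_cases hTS : T = S
      · rw [hTS, h2, if_pos (by omega)]
      · rw [h1 T hTS, hM T hT]
        congr 1
        apply propext
        omega
    have hstay : dpTable Q (k + 2) (ofMask n S) = dpTable Q (k + 1) (ofMask n S) →
        s1.mem S 0 3 = code m (dpTable Q (k + 2) (ofMask n S)) := by
      intro h
      rw [hM S hS, if_neg (lt_irrefl _), h]
    have heq : ((1 : Expr) - ((mem (var 27) 0 1 - var 22) + (var 22 - mem (var 27) 0 1))).eval s1 =
        if (ofMask n S).card = k + 2 then 1 else 0 := by
      simp only [eval_sub, eval_add, eval_one, eval_mem, eval_var, eval_zero, h27, e22,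
        hR1.pop S hS]
      exact indicator_eq _ _
    have hrec := dpTable_eq Q (k + 1) (ofMask n S)
    have hrec' := dpTable_eq Q k (ofMask n S)
    refine (WP.cond ((n + 1) * (2 * m + 9) + 6) 1 (by simp)
      (by simp [hG1.r0, hG1.r1]; omega) ?_ ?_).le_time (by omega)
    · intro h
      rw [eval_mul, heq] at h
      simp only [eval_mem, eval_var, eval_ofNat, h27, hR1.conn S hS] at h
      have hcard : (ofMask n S).card = k + 2 := by
        by_contra hc
        simp [hc] at h
      have hconn : ConnMask Q S := by
        by_contra hc
        simp [hc] at h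
      have hJ : Q.Joinable (ofMask n S) := ⟨by omega, hconn⟩
      set x := minPlusConv (dpTable Q (k + 1)) (dpTable Q (k + 1)) (ofMask n S) with hxdef
      have hsa := (partialOpt_dpTable Q k).small_add (ofMask n S)
      have hdp : dpTable Q (k + 2) (ofMask n S) = x + Q.card (ofMask n S) := by
        change (if _ then _ else _) = _
        rw [if_pos hcard, ← hcard, fscLayerMinPlus_card]
        congr 1
        unfold Query.joinCard
        exact if_pos hJ
      -- If x is finite, so is the new entry x + c(S); this entry is an optimal cost, hence at most
      -- m, and bounds x.
      have hx : Small m x := by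
        intro hne
        have h1 : dpTable Q (k + 2) (ofMask n S) ≠ ⊤ := by
          rw [hdp, Ne, ENat.add_eq_top, not_or]
          exact ⟨hne, ENat.natCast_ne_top _⟩
        have := (partialOpt_dpTable Q (k + 1)).small (ofMask n S) h1
        rw [hdp] at this
        exact le_self_add.trans this
      refine (WP.seq (WP.imp (wp_decode (S := S) (x := x) (z := fun a =>
        fscLayer (fun T => evalEmbed N a (dpTable Q (k + 1) T))
          (fun T => evalEmbed N a (dpTable Q (k + 1) T)) (k + 2) (ofMask n S)) hG1 hR1.tables h27
          ?_ hx ?_) ?_)).le_time (T := (n + 1) * (2 * m + 9) + 3 + 3) (by omega)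
      · intro a ha
        rw [hB _ _ _ (by simp), hz S hS a ha]
      · intro v
        rw [← hcard]
        exact decode_eq_zero_iff hG1.hN hG1.hco fun T _ => hsa T
      · rintro s2 ⟨hF2, hin2, hm2, h31⟩
        have hF2' : Frame 27 s s2 := hF.trans (hF2 : Frame 31 s1 s2)
        have hG2 : Glob L n m s2 := hR.toGlob.of_frame hF2'
        have e27 : s2.reg 27 = S := (hF2 27 (by norm_num)).trans h27
        have e3 : s2.reg 3 = 2 ^ n := (hF2 3 (by norm_num)).trans h3
        have hcS : s2.inp (1 + n * n + S) = Q.card (ofMask n S) := by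
          rw [hin2, hR1.card S hS hJ]
        have hcle : Q.card (ofMask n S) ≤ m :=
          (Q.card_le_maxCard hJ).trans (Nat.le_mul_of_pos_right _ (by have := hR.hn; omega))
        refine (WP.cond 1 1 (by simp) (by simp) ?_ ?_).le_time (by omega)
        · intro h5
          simp only [eval_var, hG2.r6] at h5
          refine WP.setMem (by simp [hG2.r0, hG2.r1]; omega)
            (by simp [hG2.r9, e27]; have := hG2.off; omega)
            (by simp [hG2.r9, e27, hcS]; omega) ?_
          simp only [eval_var, eval_add, eval_inp, eval_ofNat, hG2.r9, e27, hcS]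
          refine ⟨by simpa using e27, by simpa using e3, hF2'.setMem.setReg, hin2.trans hin, ?_,
            step _ ?_ ?_⟩
          · intro a b c h
            simp only [Store.setReg_mem, Store.setMem_mem]
            rw [if_neg, hm2]
            · exact hB a b c h
            · exact fun h' => h h'.2
          · intro T hT
            rw [Store.setReg_mem, Store.setMem_mem, if_neg fun h => hT h.1, hm2]
          · have h6 := Small.coe_code (m := m) (h31 ▸ h5)
            rw [Store.setReg_mem, Store.setMem_mem, if_pos (by simp), hdp, h31, ← h6, code_coe,
              ← Nat.cast_add, code_coe]
        · intro h5
          rw [eval_var, eval_var, hG2.r6, h31, hx.code_lt, not_not] at h5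
          refine WP.skip ⟨e27, e3, hF2'.setReg, hin2.trans hin, ?_, step _ ?_ ?_⟩
          · intro a b c h
            rw [Store.setReg_mem, hm2]
            exact hB a b c h
          · intro T hT
            rw [Store.setReg_mem, hm2]
          · rw [Store.setReg_mem, hm2]
            refine hstay ?_
            rw [hdp, h5, hrec', if_neg (by omega)]
            rfl
    · intro h
      rw [eval_mul, heq] at h
      simp only [eval_mem, eval_var, eval_ofNat, h27, hR1.conn S hS] at h
      refine WP.skip ⟨h27, h3, hF.setReg, hin, hB, step _ (fun _ _ => rfl) (hstay ?_)⟩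
      by_cases hcard : (ofMask n S).card = k + 2
      · have hconn : ¬ ConnMask Q S := by
          intro hc
          simp [hc, hcard] at h
        rw [hrec, hrec', if_pos (by omega), if_neg (by omega), Q.optCost_eq_top_of_not_conn hconn]
      · change (if _ then _ else _) = _
        rw [if_neg hcard]
  · rintro s' ⟨hF, hin, hB, hM⟩ -
    exact ⟨hF, hin, hB, fun S hS => by rw [hM S hS, if_pos hS]⟩

end RAM
end DPconv

end

/-! ### One layer, and the dynamic program by convolution -/

section
open Finset

namespace DPconv
namespace RAM
open DPconv.RAM.Expr DPconv.Query

variable {L : Layout} {n N : ℕ} {s : Store}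

/-- The plane of the rank `k` (register 22) is computed from the table of optimal costs. -/
def encodeLayer : Prog :=
  assign 25 (10 + var 22) ⨟ assign 26 1 ⨟ fill 3 6 (setMem (var 40) (var 25) (var 41)
    (mem (mem (var 40) 0 3) 5 (var 41) *
      (1 - ((mem (var 40) 0 1 - var 22) + (var 22 - mem (var 40) 0 1))))) ⨟ transform

/-- Layer k changes only entries of sets of size k, so only the plane of rank k has to be computed
anew. This saves recomputing all n + 1 ranked zeta transforms in every layer. -/
theorem wp_encodeLayer {Q : Query n} {k : ℕ} {D : Finset (Fin n) → ℕ∞} (hR : Ready L Q N s)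
    (hk : k ≤ n) (h22 : s.reg 22 = k) (hsm : ∀ S, Small (Q.maxCard * n) (D S))
    (hD : DPCol n (Q.maxCard * n) D s)
    (hP : ∀ d ≤ n, d ≠ k → Planes (Q.maxCard * n) N D d s) :
    WP L encodeLayer ((n + 1) * (2 ^ n * (2 * (Q.maxCard * n) + 4) + 3) + 3) s fun s' =>
      Frame 25 s s' ∧ s'.inp = s.inp ∧ Keep (10 + k) s s' ∧
      ∀ d ≤ n, Planes (Q.maxCard * n) N D d s' := by
  set m := Q.maxCard * n with hm
  have hK : L.K = m + n + 20 := hR.K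
  have hV : 100 + 4 * 2 ^ n + 4 * m + n * n ≤ L.V := hR.V
  have hmn : n ≤ m := hR.hm
  let G : Grid := ⟨2 ^ n, m + 1, 0, 10 + k, id, fun c _ c' _ h => h⟩
  let f : ℕ → Finset (Fin n) → ZMod N := fun a T => if T.card = k then evalEmbed N a (D T) else 0
  let val : ℕ → ℕ → ℕ := fun S a => (f a (ofMask n S)).val
  have hF0 : Frame 25 s ((s.setReg 25 (10 + k)).setReg 26 1) := (Frame.refl _ _).setReg.setReg
  have hR0 := hR.of_frame hF0 rfl fun _ _ _ _ => rfl
  refine (WP.seq (WP.assign (by simp) (by simp [h22]; omega) (WP.seq (WP.assign (by simp)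
    (by simp; omega) (WP.seq ((wp_fill G val 1 (by simp [hR.r3, G]) (by simp [hR.r6, G, hm])
    ?_).imp ?_)))))).le_time (T := 1 + (1 + (2 ^ n * ((m + 1) * (1 + 1) + 2) + 1 +
      (n * (2 ^ n * (2 * m + 4) + 3) + 1)))) (by ring_nf; omega)
  · intro S hS a ha s' hb hW h40 h41
    change S < 2 ^ n at hS
    change a < m + 1 at ha
    simp only [eval_add, eval_var, eval_ofNat, h22] at hW
    have hR1 : Ready L Q N s' := hR0.of_frame hW.frame hW.inp fun i j c h =>
      hW.plane _ _ (by simp only [G]; omega)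
    have hG1 : ModGlob L n m N s' := hR1.toModGlob
    have e22 : s'.reg 22 = k := by rw [hW.frame 22 (by norm_num)]; simpa using h22
    have e25 : s'.reg 25 = 10 + k := by rw [hW.frame 25 (by norm_num)]; simp
    have h3 : s'.mem S 0 3 = code m (D (ofMask n S)) := by
      rw [hW.plane _ _ (by simp only [G]; omega)]; exact hD S hS
    have key : s'.mem (s'.mem S 0 3) 5 a * (1 - ((s'.mem S 0 1 - k) + (k - s'.mem S 0 1))) =
        val S a := by
      rw [h3, hR1.tables.enc _ (hsm _) a ha, hR1.pop S hS, indicator_eq]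
      simp only [val, f]
      split_ifs <;> simp
    exact wp_cell (by simp [hG1.r0, hG1.r1, e25, h41]; omega)
      (by simp [hG1.r0, hG1.r1, h41]; omega) (by simp [h40, G]) (by simp [e25, G])
      (by simp [h41, G]) (by simp [h40, h41, e22, key]) (hG1.val_lt _)
  · intro s1 hW
    simp only [eval_add, eval_var, eval_ofNat, h22] at hW
    have hR1 : Ready L Q N s1 := hR0.of_frame hW.frame hW.inp fun i j c h =>
      hW.plane _ _ (by simp only [G]; omega)
    refine (wp_transform (m := m) (J := 10 + k) (σ := 1) hR1.toModGlob hR1.pow ?_ (by omega)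
      (by omega) ?_ f fun S hS a ha => hW.done S hS a ha).imp ?_
    · rw [hW.frame 25 (by norm_num)]; simp
    · rw [hW.frame 26 (by norm_num)]; simp
    · rintro s2 ⟨hF2, hin2, hk2, hM2⟩
      refine ⟨(hF0.trans hW.frame).trans hF2, hin2.trans hW.inp, ?_, ?_⟩
      · intro i j c hj
        rw [hk2 i j c hj, hW.plane i c hj]
        rfl
      · intro d hd S hS a ha
        by_cases hdk : d = k
        · subst hdk
          rw [hM2 S hS a ha, Nat.cast_one, partialTransform_one]
        · rw [hk2 _ _ _ (by omega), hW.plane _ _ (by simp only [G]; omega)]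
          exact hP d hd hdk S hS a ha

/-- Ranked product, Möbius transform, decoding and zeta transform each take O(2^n n m). -/
theorem layer_time_le {p m n : ℕ} (hp : 4 ≤ p) (hm : 2 ≤ m) (hn : 2 ≤ n) :
    p * ((m + 1) * (2 * n + 6) + 2) + 1 + (1 + (1 +
      (n * (p * (2 * m + 4) + 3) + 1 + (p * ((n + 1) * (2 * m + 9) + 9) + 1 +
        ((n + 1) * (p * (2 * m + 4) + 3) + 3))))) ≤ p * (n + 1) * (30 * (m + 1)) := by
  have a1 : (m + 1) * (2 * n + 6) + 2 ≤ (n + 1) * (8 * (m + 1)) := by nlinarith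
  have a2 : p * (2 * m + 4) + 3 ≤ p * (5 * (m + 1)) := by nlinarith
  have a4 : (n + 1) * (2 * m + 9) + 9 ≤ (n + 1) * (9 * (m + 1)) := by nlinarith
  have e1 := Nat.mul_le_mul_left p a1
  have e2 := Nat.mul_le_mul_left (n + 1) a2
  have e3 : n * (p * (2 * m + 4) + 3) ≤ (n + 1) * (p * (2 * m + 4) + 3) :=
    Nat.mul_le_mul_right _ (by omega)
  have e4 := Nat.mul_le_mul_left p a4
  have e5 : 4 * 3 * 3 ≤ p * (n + 1) * (m + 1) :=
    Nat.mul_le_mul (Nat.mul_le_mul hp (by omega)) (by omega)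
  have e6 : p * (n + 1) * (30 * (m + 1)) = p * ((n + 1) * (8 * (m + 1))) +
    2 * ((n + 1) * (p * (5 * (m + 1)))) + p * ((n + 1) * (9 * (m + 1))) +
    3 * (p * (n + 1) * (m + 1)) := by ring
  omega

/-- The layers dominate. The modulus search takes O(2^n m), and the tables O(m^2), which is O(2^n m)
because m ≤ 2^n. -/
theorem convolutionDP_time_le {p m n : ℕ} (hp : 4 ≤ p) (hmp : m ≤ p) (hnm : n ≤ m) (hn : 2 ≤ n) :
    p * (m * 4 + 8) + 2 + (6 * ((m + 1) * (2 * m + 6)) + 20 + (1 +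
      ((n + 1) * (p * (2 * m + 4) + 3) + 3 + (1 +
        ((n - 1) * (1 + (1 + p * (n + 1) * (30 * (m + 1))) + 1) + 1))))) ≤
      100 * (p * n ^ 2 * m) := by
  obtain ⟨k, rfl⟩ : ∃ k, n = k + 1 := ⟨n - 1, by omega⟩
  rw [Nat.add_sub_cancel]
  have b1 : 4 * (p * m) ≤ p * (k + 1) ^ 2 * m := by
    have : 4 ≤ (k + 1) ^ 2 := by nlinarith
    calc 4 * (p * m) = p * 4 * m := by ring
      _ ≤ _ := Nat.mul_le_mul_right _ (Nat.mul_le_mul_left _ this)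
  have b2 : m * m ≤ p * m := Nat.mul_le_mul_right _ hmp
  have e1 : p * (m * 4 + 8) ≤ 8 * (p * m) := by nlinarith [Nat.mul_le_mul_left p (hn.trans hnm)]
  have e2 : (m + 1) * (2 * m + 6) ≤ 8 * (m * m) := by nlinarith
  have e3 : (k + 1 + 1) * (p * (2 * m + 4) + 3) ≤ 10 * (p * (k + 1) ^ 2 * m) := by
    have c1 : p * (2 * m + 4) + 3 ≤ p * (5 * m) := by nlinarith [Nat.mul_le_mul hp (hn.trans hnm)]
    have c2 : k + 1 + 1 ≤ 2 * (k + 1) ^ 2 := by nlinarith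
    refine (Nat.mul_le_mul c2 c1).trans (le_of_eq (by ring))
  have e4 : k * (p * (k + 1 + 1) * (30 * (m + 1))) ≤ 60 * (p * (k + 1) ^ 2 * m) := by
    have c1 : k * (k + 1 + 1) ≤ (k + 1) ^ 2 := by nlinarith
    have c2 : 30 * (m + 1) ≤ 60 * m := by omega
    calc k * (p * (k + 1 + 1) * (30 * (m + 1))) = p * (k * (k + 1 + 1)) * (30 * (m + 1)) := by ring
      _ ≤ p * (k + 1) ^ 2 * (60 * m) := Nat.mul_le_mul (Nat.mul_le_mul_left _ c1) c2
      _ = _ := by ring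
  have e5 : 4 * m ≤ p * m := Nat.mul_le_mul_right _ hp
  have e6 : k * (1 + (1 + p * (k + 1 + 1) * (30 * (m + 1))) + 1) =
    3 * k + k * (p * (k + 1 + 1) * (30 * (m + 1))) := by ring
  rw [e6]
  omega

/-- The same `transform` inverts the zeta transform on plane 6 when its sign register holds N - 1,
which is -1 modulo N. -/
def layer : Prog :=
  rankedProduct ⨟ assign 25 6 ⨟ assign 26 (var 8 - 1) ⨟ transform ⨟ decodeLayer ⨟ encodeLayer

theorem planes_congr {D D' : Finset (Fin n) → ℕ∞} {m d : ℕ} (h : ∀ T, T.card = d → D T = D' T)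
    (hP : Planes m N D d s) : Planes m N D' d s := by
  intro S hS a ha
  rw [hP S hS a ha]
  congr 1
  refine Finset.sum_congr rfl fun T hT => ?_
  simp only [h T (Finset.mem_filter.1 hT).2]

theorem wp_layer {Q : Query n} {k : ℕ} (hR : Ready L Q N s) (hk : k + 2 ≤ n)
    (h22 : s.reg 22 = k + 2) (h23 : s.reg 23 = k + 3)
    (hD : DPCol n (Q.maxCard * n) (dpTable Q (k + 1)) s)
    (hP : ∀ d ≤ n, Planes (Q.maxCard * n) N (dpTable Q (k + 1)) d s) :
    WP L layer (2 ^ n * (n + 1) * (30 * (Q.maxCard * n + 1))) s fun s' =>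
      Frame 22 s s' ∧ Ready L Q N s' ∧ s'.inp = s.inp ∧
      (∀ i k, k ≠ 3 → s'.mem i 0 k = s.mem i 0 k) ∧
      DPCol n (Q.maxCard * n) (dpTable Q (k + 2)) s' ∧
      ∀ d ≤ n, Planes (Q.maxCard * n) N (dpTable Q (k + 2)) d s' := by
  set m := Q.maxCard * n with hm
  have hK : L.K = m + n + 20 := hR.K
  have hV : 100 + 4 * 2 ^ n + 4 * m + n * n ≤ L.V := hR.V
  have hmn : n ≤ m := hR.hm
  have hn2 := hR.hn
  have h2n := hR.toGlob.two_pow_pos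
  have := hR.neZero
  have htime : 2 ^ n * ((m + 1) * (2 * n + 6) + 2) + 1 + (1 + (1 +
      (n * (2 ^ n * (2 * m + 4) + 3) + 1 + (2 ^ n * ((n + 1) * (2 * m + 9) + 9) + 1 +
        ((n + 1) * (2 ^ n * (2 * m + 4) + 3) + 3))))) ≤ 2 ^ n * (n + 1) * (30 * (m + 1)) := by
    exact layer_time_le h2n (hn2.trans hmn) hn2
  refine (WP.seq ((wp_rankedProduct (m := m) hR.toModGlob hk h22 h23 hP).imp ?_)).le_time htime
  rintro s1 ⟨hF1, hin1, hk1, hM1⟩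
  have hR1 : Ready L Q N s1 := hR.of_frame hF1 hin1 fun i j c h => hk1 _ _ _ (by omega)
  refine WP.seq (WP.assign (by simp) (by simp; omega) (WP.seq (WP.assign (by simp) ?_
    (WP.seq ((wp_transform (m := m) (J := 6) (σ := N - 1) (n := n) (N := N)
      (g := fun a => rankedConv (fun T => evalEmbed N a (dpTable Q (k + 1) T))
        (fun T => evalEmbed N a (dpTable Q (k + 1) T)) (k + 2)) ?_ ?_ ?_ (by norm_num) (by omega)
        ?_ ?_).imp ?_)))))
  · have := hR1.hN'
    simp [hR1.r8]; omega
  · exact hR1.toModGlob.of_frame ((Frame.refl 20 s1).setReg.setReg)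
  · exact hR1.pow
  · simp
  · simp [hR1.r8]
  · exact hM1
  · rintro s2 ⟨hF2, hin2, hk2, hM2⟩
    have hF12 : Frame 25 s1 s2 := (Frame.refl 25 s1).setReg.setReg.trans hF2
    have hF2' : Frame 25 s s2 := fun z hz => (hF12 z hz).trans (hF1 z (by omega))
    have hin2' : s2.inp = s.inp := hin2.trans hin1
    have hk2' : Keep 6 s s2 := fun i j c hj => (hk2 i j c hj).trans (hk1 i j c hj)
    have hR2 : Ready L Q N s2 := hR.of_frame hF2' hin2' fun i j c h => hk2' _ _ _ (by omega)
    refine WP.seq ((wp_decodeLayer (k := k) hR2 ?_ ?_ ?_).imp ?_)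
    · rw [hF2' 22 (by norm_num), h22]
    · intro S hS
      rw [hk2' _ _ _ (by norm_num)]
      exact hD S hS
    · intro S hS a ha
      rw [hM2 S hS a ha]
      have : ((N - 1 : ℕ) : ZMod N) = -1 := by
        have := natCast_sub_one_mul (N := N) 1
        simpa using this
      rw [this, partialTransform_neg_one]
      rfl
    · rintro s3 ⟨hF3, hin3, hB3, hD3⟩
      have hF3' := hF2'.trans hF3
      have hR3 : Ready L Q N s3 := hR2.of_frame hF3 hin3 fun i j c h => hB3 _ _ _ (by omega)
      refine (wp_encodeLayer (k := k + 2) (D := dpTable Q (k + 2)) hR3 hk ?_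
        (partialOpt_dpTable Q (k + 1)).small hD3 ?_).imp ?_
      · rw [hF3' 22 (by norm_num), h22]
      · intro d hd hdk
        refine planes_congr (D := dpTable Q (k + 1)) ?_ ?_
        · intro T hT
          change _ = (if _ then _ else _)
          rw [if_neg (by omega)]
        · intro S hS a ha
          rw [hB3 _ _ _ (by omega), hk2' _ _ _ (by omega)]
          exact hP d hd S hS a ha
      · rintro s4 ⟨hF4, hin4, hk4, hP4⟩
        refine ⟨fun z hz => (hF3'.trans hF4 : Frame 25 s s4) z (by omega),
          hR3.of_frame hF4 hin4 fun i j c h => hk4 _ _ _ (by omega),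
          by rw [hin4, hin3, hin2'], ?_, ?_, hP4⟩
        · intro i c hc
          rw [hk4 _ _ _ (by omega), hB3 _ _ _ (by omega), hk2' _ _ _ (by omega)]
        · intro S hS
          rw [hk4 _ _ _ (by omega)]
          exact hD3 S hS

/-- The dynamic program by fast subset convolution. -/
def convolutionDP : Prog :=
  modulusSearch ⨟ interpolationTables ⨟ assign 22 1 ⨟ encodeLayer ⨟ assign 21 (var 2 - 1) ⨟
  forLoop 20 21 (assign 22 (var 20 + 2) ⨟ assign 23 (var 20 + 3) ⨟ layer)

open Classical in
theorem wp_convolutionDP (Q : Query n) (hG : Glob L n (Q.maxCard * n) s)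
    (hm : Q.maxCard * n ≤ 2 ^ n)
    (hP : ∀ i < n, s.mem i 0 4 = 2 ^ i) (hC : ∀ S < 2 ^ n, s.mem S 0 1 = (ofMask n S).card)
    (hN : ∀ S < 2 ^ n, s.mem S 0 2 = if ConnMask Q S then 1 else 0)
    (hc : ∀ S < 2 ^ n, Q.Joinable (ofMask n S) → s.inp (1 + n * n + S) = Q.card (ofMask n S))
    (hD : DPCol n (Q.maxCard * n) (dpTable Q 1) s) (h0 : ∀ i j k, 1 ≤ j → s.mem i j k = 0) :
    WP L convolutionDP (100 * (2 ^ n * n ^ 2 * (Q.maxCard * n))) s fun s' =>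
      (∀ z < 20, z ≠ 8 → s'.reg z = s.reg z) ∧ s'.inp = s.inp ∧
      (∀ i k, k ≠ 3 → s'.mem i 0 k = s.mem i 0 k) ∧ DPCol n (Q.maxCard * n) Q.optCost s' := by
  set m := Q.maxCard * n with hmdef
  have hK : L.K = m + n + 20 := hG.K
  have hV : 100 + 4 * 2 ^ n + 4 * m + n * n ≤ L.V := hG.V
  have hmn : n ≤ m := hG.hm
  have hn2 := hG.hn
  have h2n := hG.two_pow_pos
  have htime : 2 ^ n * (m * 4 + 8) + 2 + (6 * ((m + 1) * (2 * m + 6)) + 20 + (1 +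
      ((n + 1) * (2 ^ n * (2 * m + 4) + 3) + 3 + (1 +
        ((n - 1) * (1 + (1 + 2 ^ n * (n + 1) * (30 * (m + 1))) + 1) + 1))))) ≤
      100 * (2 ^ n * n ^ 2 * m) := convolutionDP_time_le h2n hm hmn hn2
  refine (WP.seq ((wp_modulusSearch hG hm).imp ?_)).le_time htime
  rintro s1 ⟨N, hG1, hF1, hin1, hm1⟩
  refine WP.seq ((wp_interpolationTables hG1 (by rw [hm1]; exact h0)).imp ?_)
  rintro s2 ⟨hF2, hin2, hk2, hT2⟩
  have hR2 : Ready L Q N s2 :=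
    { toModGlob := hG1.of_frame hF2
      tables := hT2
      pow := fun i hi => by rw [hk2 _ _ _ (by simp), hm1, hP i hi]
      pop := fun i hi => by rw [hk2 _ _ _ (by simp), hm1, hC i hi]
      conn := fun i hi => by rw [hk2 _ _ _ (by simp), hm1, hN i hi]
      card := fun i hi => by rw [hin2, hin1]; exact hc i hi }
  have hR2' : Ready L Q N (s2.setReg 22 1) :=
    hR2.of_frame (Frame.refl 20 s2).setReg rfl fun _ _ _ _ => rfl
  refine WP.seq (WP.assign (by simp) (by simp; omega) (WP.seq
    ((wp_encodeLayer (k := 1) (D := dpTable Q 1) hR2' (by omega) (by simp)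
      (partialOpt_dpTable Q 0).small ?_ ?_).imp ?_)))
  · intro S hS
    rw [Store.setReg_mem, hk2 _ _ _ (by simp), hm1]
    exact hD S hS
  -- The planes of rank d ≠ 1 still consist of initial zeros. This is correct, since at the start
  -- every set of size other than 1 has cost ∞.
  · intro d hd hd1 S hS a ha
    rw [Store.setReg_mem, hk2 _ _ _ (by omega), hm1, h0 _ _ _ (by omega)]
    have : rankedZeta (fun T => evalEmbed N a (dpTable Q 1 T)) d (ofMask n S) = 0 := by
      refine Finset.sum_eq_zero fun T hT => ?_
      have h1 : dpTable Q 1 T = ⊤ := by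
        change (if _ then _ else _) = _
        rw [if_neg]
        have := (Finset.mem_filter.1 hT).2
        omega
      rw [h1, evalEmbed_top]
    rw [this, ZMod.val_zero]
  · rintro s3 ⟨hF3, hin3, hk3, hP3⟩
    have hF3' : Frame 20 s2 s3 := (Frame.refl 20 s2).setReg.trans hF3
    have hR3 : Ready L Q N s3 := hR2.of_frame hF3' hin3 fun i j c h => hk3 _ _ _ (by omega)
    refine WP.seq (WP.assign (by simp) (by simp [hR3.r2]; omega) (WP.forLoop (n - 1)
      (1 + (1 + 2 ^ n * (n + 1) * (30 * (m + 1)))) (fun k s' => Frame 20 s3 s' ∧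
        Ready L Q N s' ∧ s'.inp = s3.inp ∧ (∀ i k, k ≠ 3 → s'.mem i 0 k = s3.mem i 0 k) ∧
        s'.reg 21 = n - 1 ∧ DPCol n m (dpTable Q (k + 1)) s' ∧
        ∀ d ≤ n, Planes m N (dpTable Q (k + 1)) d s') (by simp [hR3.r2]) ?_ ?_ ?_))
    · have hFF : Frame 20 s3 ((s3.setReg 21 (n - 1)).setReg 20 0) := (Frame.refl 20 s3).setReg.setReg
      simp only [eval_sub, eval_var, eval_one, hR3.r2]
      refine ⟨hFF, hR3.of_frame hFF rfl fun _ _ _ _ => rfl, rfl, fun _ _ _ => rfl, by simp, ?_, hP3⟩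
      intro S hS
      rw [Store.setReg_mem, Store.setReg_mem, hk3 _ _ _ (by omega), Store.setReg_mem,
        hk2 _ _ _ (by simp), hm1]
      exact hD S hS
    · rintro k hk s4 hb4 ⟨hF4, hR4, hin4, hk4, h21, hD4, hP4⟩ h20 -
      have hFF : Frame 22 s4 ((s4.setReg 22 (k + 2)).setReg 23 (k + 3)) :=
        (Frame.refl 22 s4).setReg.setReg
      refine WP.seq (WP.assign (by simp) (by simp [h20]; omega) (WP.seq (WP.assign (by simp)
        (by simp [h20]; omega) ?_)))
      simp only [eval_add, eval_var, eval_ofNat, h20, Store.setReg_reg]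
      norm_num only [if_false]
      refine (wp_layer (k := k) (hR4.of_frame hFF rfl fun _ _ _ _ => rfl) (by omega)
        (by simp) (by simp) hD4 hP4).imp ?_
      rintro s5 ⟨hF5, hR5, hin5, hk5, hD5, hP5⟩
      have hF5' : Frame 22 s4 s5 := hFF.trans hF5
      refine ⟨by rw [hF5' 20 (by norm_num), h20], by rw [hF5' 21 (by norm_num), h21],
        (hF4.trans hF5' : Frame 20 s3 s5).setReg,
        hR5.of_frame (Frame.refl 20 s5).setReg rfl fun _ _ _ _ => rfl, hin5.trans hin4,
        fun i c h => (hk5 i c h).trans (hk4 i c h), ?_, hD5, hP5⟩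
      simp [hF5' 21 (by norm_num), h21]
    · rintro s4 ⟨hF4, hR4, hin4, hk4, -, hD4, -⟩ -
      refine ⟨fun z hz hz8 => ?_, ?_, fun i c h => ?_, ?_⟩
      · rw [hF4 z hz, hF3' z hz, hF2 z hz, hF1 z hz hz8]
      · rw [hin4, hin3]; exact hin2.trans hin1
      · rw [hk4 i c h, hk3 _ _ _ (by omega), Store.setReg_mem, hk2 _ _ _ (by simp), hm1]
      · intro S hS
        rw [hD4 S hS, show n - 1 + 1 = n by omega, dpTable_eq_optCost]

end RAM
end DPconv

end

/-! ### Reading the input and computing the dimensions -/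

section
open Finset

namespace DPconv
open DPconv.Query

section Input
variable {n : ℕ}

theorem getD_flatMap {α : Type*} {f : α → List ℕ} (hf : ∀ x, (f x).length = n) (xs : List α)
    {v u : ℕ} (hv : v < xs.length) (hu : u < n) (d : ℕ) :
    (xs.flatMap f).getD (v * n + u) d = (f xs[v]).getD u d := by
  induction xs generalizing v with
  | nil => simp at hv
  | cons x xs ih =>
    rw [List.flatMap_cons]
    cases v with
    | zero => rw [zero_mul, zero_add, List.getD_append _ _ _ _ (by rw [hf]; exact hu)]; rfl
    | succ v =>
      have h1 : (v + 1) * n + u - n = v * n + u := by rw [add_mul, one_mul]; omega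
      rw [List.getD_append_right _ _ _ _ (by rw [hf, add_mul]; omega), hf, h1,
        ih (by simpa using hv)]
      rfl

open Classical in
theorem length_matrix (Q : Query n) : ((List.finRange n).flatMap fun i =>
    (List.finRange n).map fun j => if Q.graph.Adj i j then 1 else 0).length = n * n := by
  rw [List.length_flatMap]
  simp

theorem length_input (Q : Query n) : Q.input.length = 1 + n * n + 2 ^ n := by
  unfold Query.input
  rw [List.length_append, List.length_cons, length_matrix, List.length_map, List.length_range]
  omega

theorem input_zero (Q : Query n) : Q.input.getD 0 0 = n := rfl

open Classical in
theorem input_adj (Q : Query n) {v u : ℕ} (hv : v < n) (hu : u < n) :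
    Q.input.getD (1 + v * n + u) 0 = if RAM.AdjNat Q v u then 1 else 0 := by
  have hlt : v * n + u < n * n := by
    have : (v + 1) * n ≤ n * n := Nat.mul_le_mul_right n hv
    rw [add_mul] at this
    omega
  unfold Query.input
  rw [List.getD_append _ _ _ _ (by rw [List.length_cons, length_matrix]; omega),
    show 1 + v * n + u = v * n + u + 1 by omega, List.getD_cons_succ,
    getD_flatMap (by simp) _ (by simpa using hv) hu]
  simp [List.getD_eq_getElem?_getD, hu, RAM.AdjNat, hv]

open Classical in
/-- The table of the join cardinalities in the input. -/
noncomputable def cardTable (Q : Query n) (S : ℕ) : ℕ :=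
  if Q.Joinable (ofMask n S) then Q.card (ofMask n S) else 0

theorem input_card (Q : Query n) {S : ℕ} (hS : S < 2 ^ n) :
    Q.input.getD (1 + n * n + S) 0 = cardTable Q S := by
  unfold Query.input
  rw [List.getD_append_right _ _ _ _ (by rw [List.length_cons, length_matrix]; omega),
    List.length_cons, length_matrix, show 1 + n * n + S - (n * n + 1) = S by omega]
  rw [List.getD_eq_getElem _ _ (by simpa using hS), List.getElem_map, List.getElem_range, cardTable]

theorem cardTable_le (Q : Query n) (S : ℕ) : cardTable Q S ≤ Q.maxCard := by
  unfold cardTable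
  split_ifs with h
  exacts [Q.card_le_maxCard h, Nat.zero_le _]

theorem one_le_maxCard (Q : Query n) : 1 ≤ Q.maxCard := le_max_left _ _

/-- The zeros entered at the other sets do not affect a maximum that is at least 1, so W can be
computed by one pass over the input table, before connectivity is known. -/
theorem max_sup_cardTable (Q : Query n) :
    max 1 ((Finset.range (2 ^ n)).sup (cardTable Q)) = Q.maxCard := by
  classical
  refine le_antisymm (max_le (one_le_maxCard Q) (Finset.sup_le fun S _ => cardTable_le Q S)) ?_
  unfold Query.maxCard
  refine max_le (le_max_left _ _) (Finset.sup_le fun S hS => ?_)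
  obtain ⟨T, hT, rfl⟩ := exists_ofMask S
  have hJ : Q.Joinable (ofMask n T) := by simpa using hS
  have h1 : Q.card (ofMask n T) = cardTable Q T := by rw [cardTable, if_pos hJ]
  rw [h1]
  exact (Finset.le_sup (f := cardTable Q) (Finset.mem_range.2 hT)).trans (le_max_right _ _)

theorem input_lt (Q : Query n) {V : ℕ} (hn : n < V) (hW : Q.maxCard < V) (a : ℕ) :
    Q.input.getD a 0 < V := by
  classical
  have h1 := one_le_maxCard Q
  have hmem : ∀ x ∈ Q.input, x < V := by
    intro x hx
    unfold Query.input at hx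
    simp only [List.mem_append, List.mem_cons, List.mem_flatMap, List.mem_map] at hx
    rcases hx with (rfl | ⟨i, -, j, -, rfl⟩) | ⟨S, -, rfl⟩
    · exact hn
    · split_ifs <;> omega
    · exact (cardTable_le Q S).trans_lt hW
  rcases lt_or_ge a Q.input.length with h | h
  · rw [List.getD_eq_getElem _ _ h]
    exact hmem _ (List.getElem_mem h)
  · rw [List.getD_eq_default _ _ h]
    omega

/-- Needed to see that the output, 2 n + 1 numbers, fits into the area of the input. -/
theorem JoinTree.Valid.length_code {G : SimpleGraph (Fin n)} {T : JoinTree n} (h : T.Valid G) :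
    T.code.length + 1 = 2 * T.rels.card := by
  induction T with
  | leaf i => simp [JoinTree.code, JoinTree.rels]
  | join l r ihl ihr =>
    obtain ⟨h1, h2, h3, -⟩ := h
    have h4 := ihl h1
    have h5 := ihr h2
    simp only [JoinTree.code, JoinTree.rels, List.length_cons, List.length_append,
      Finset.card_union_of_disjoint h3]
    omega

end Input

namespace RAM
open DPconv.RAM.Expr

variable {n : ℕ} {L : Layout} {s : Store}

/-- The dimensions of the instance are determined. -/
def setup : Prog :=
  assign 2 (inp 0) ⨟ assign 3 1 ⨟ forLoop 20 2 (assign 3 (var 3 + var 3)) ⨟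
  assign 9 (1 + var 2 * var 2) ⨟ assign 0 (var 9 + var 3) ⨟ assign 4 1 ⨟
  forLoop 20 3 (cond (var 4) (inp (var 9 + var 20)) (assign 4 (inp (var 9 + var 20))) .skip) ⨟
  assign 5 (var 4 * var 2) ⨟ assign 6 (var 5 + 1) ⨟ assign 7 (var 5 + 2) ⨟ assign 10 (var 2 + 1) ⨟
  assign 11 (2 * var 2 - 1) ⨟ assign 1 (var 5 + var 2 + 20)

/-- Only the input area is accessed here: array addresses depend on registers 0 and 1, which are
being computed. This gives the program its uniformity in n and W. -/
theorem wp_setup (Q : Query n) (hn : 2 ≤ n) (hoff : L.off = 1 + n * n + 2 ^ n)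
    (hK : L.K = Q.maxCard * n + n + 20)
    (hV : 100 + 4 * 2 ^ n + 4 * (Q.maxCard * n) + n * n ≤ L.V)
    (hin : ∀ a, s.inp a = Q.input.getD a 0) :
    WP L setup (2 ^ n * 4 + n * 2 + 20) s fun s' =>
      Glob L n (Q.maxCard * n) s' ∧ s'.inp = s.inp ∧ s'.mem = s.mem := by
  set m := Q.maxCard * n with hm
  have hmn : n ≤ m := Nat.le_mul_of_pos_left n (one_le_maxCard Q)
  have hWm : Q.maxCard ≤ m := Nat.le_mul_of_pos_right _ (by omega)
  have h4n : 2 * 2 ≤ n * n := Nat.mul_le_mul hn hn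
  have hi0 : s.inp 0 = n := by rw [hin, input_zero]
  have h2n : 0 < 2 ^ n := by positivity
  refine (WP.seq (WP.assign (by simp; omega) (by simp [hi0]; omega) (WP.seq (WP.assign (by simp)
    (by simp; omega) (WP.seq (WP.forLoop n 1 (fun i s' => s'.reg 2 = n ∧ s'.reg 3 = 2 ^ i ∧
      s'.inp = s.inp ∧ s'.mem = s.mem) ?_ ?_ ?_ ?_)))))).le_time
    (T := 1 + (1 + (n * (1 + 1) + 1 + (1 + (1 + (1 + (2 ^ n * (3 + 1) + 1 +
      (1 + (1 + (1 + (1 + (1 + 1))))))))))))  (by omega)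
  · simp [hi0]
  · simp [hi0]
  · rintro i hi s1 hb ⟨h2, h3, hin1, hm1⟩ h20 -
    have : 2 ^ (i + 1) ≤ 2 ^ n := Nat.pow_le_pow_right (by norm_num) hi
    rw [pow_succ] at this
    refine WP.assign (by simp) (by simp [h3]; omega) ?_
    refine ⟨by simpa using h20, by simpa using h2, by simpa using h2, ?_, hin1, hm1⟩
    simp [h3, pow_succ]
    omega
  · rintro s1 ⟨h2, h3, hin1, hm1⟩ -
    refine WP.seq (WP.assign (by simp) (by simp [h2]; omega) (WP.seq (WP.assign (by simp)
      (by simp [h3, h2]; omega) (WP.seq (WP.assign (by simp) (by simp; omega) (WP.seq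
        (WP.forLoop (2 ^ n) 3 (fun i s' => s'.reg 2 = n ∧ s'.reg 3 = 2 ^ n ∧
          s'.reg 9 = 1 + n * n ∧ s'.reg 0 = 1 + n * n + 2 ^ n ∧
          s'.reg 4 = max 1 ((Finset.range i).sup (cardTable Q)) ∧
          s'.inp = s.inp ∧ s'.mem = s.mem) ?_ ?_ ?_ ?_)))))))
    · simp [h3]
    · simp [h2, h3, hin1, hm1]
    · rintro S hS s2 hb ⟨h2', h3', h9, h0, h4, hin2, hm2⟩ h20 -
      have hc : s2.inp (1 + n * n + S) = cardTable Q S := by rw [hin2, hin, input_card Q hS]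
      have hle := cardTable_le Q S
      have hsup : max 1 ((Finset.range (S + 1)).sup (cardTable Q)) =
          max (cardTable Q S) (max 1 ((Finset.range S).sup (cardTable Q))) := by
        rw [Finset.range_add_one, Finset.sup_insert]
        exact max_left_comm _ _ _
      refine (WP.cond 1 1 (by simp) (by simp [h9, h20]; omega) ?_ ?_).le_time (by omega)
      · intro h
        simp only [eval_var, eval_inp, eval_add, h9, h20, hc, h4] at h
        refine WP.assign (by simp [h9, h20]; omega) (by simp [h9, h20, hc]; omega) ?_
        simp only [eval_var, eval_inp, eval_add, h9, h20, hc]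
        refine ⟨by simpa using h20, by simpa using h3', by simpa using h2', by simpa using h3',
          by simpa using h9, by simpa using h0, ?_, hin2, hm2⟩
        rw [hsup, max_eq_left h.le]
        simp
      · intro h
        simp only [eval_var, eval_inp, eval_add, h9, h20, hc, h4] at h
        refine WP.skip ⟨h20, h3', by simpa using h2', by simpa using h3', by simpa using h9,
          by simpa using h0, ?_, hin2, hm2⟩
        rw [hsup, max_eq_right (not_lt.1 h)]
        simpa using h4
    · rintro s2 ⟨h2', h3', h9, h0, h4, hin2, hm2⟩ -
      rw [max_sup_cardTable] at h4
      refine WP.seq (WP.assign (by simp) (by simp [h2', h4]; omega) (WP.seq (WP.assign (by simp)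
        (by simp [h2', h4]; omega) (WP.seq (WP.assign (by simp) (by simp [h2', h4]; omega) (WP.seq
        (WP.assign (by simp) (by simp [h2']; omega) (WP.seq (WP.assign (by simp)
        (by simp [h2']; omega) (WP.assign (by simp) (by simp [h2', h4]; omega) ?_))))))))))
      refine ⟨?_, hin2, hm2⟩
      constructor <;> simp [h2', h3', h4, h9, h0, hoff, hK, hn, hmn, hV, ← hm]

end RAM
end DPconv

end

/-! ### The complete program and its execution on the word RAM -/

section
open Finset

namespace DPconv
namespace RAM
open DPconv.RAM.Expr DPconv.Query

variable {n : ℕ} {L : Layout} {s : Store}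

/-- Join ordering on the word RAM. -/
def joinOrder : Prog :=
  setup ⨟ powTable ⨟ popTable ⨟ connTable ⨟ initDP ⨟
  cond (var 3) (var 5) quadraticDP convolutionDP ⨟
  cond (mem (var 3 - 1) 0 3) (var 6) writeTree (setInp 0 0)

/-- The two summands with the factor 100 are the two dynamic programs, since a conditional is
charged with both branches. The factor 2 n - 1 belongs to the searches for the tree. -/
theorem joinOrder_time_le {p n m : ℕ} (hn : 2 ≤ n) (hp : 4 ≤ p) (hnp : n ≤ p) (hnm : n ≤ m) :
    p * 4 + n * 2 + 20 + (n * 3 + 2 + (p * (2 * n + 4) + 1 + (p * (n * (4 * n + 4) + 6) + 1 +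
      (p * 6 + 1 + (100 * (p * n ^ 2 * m) + 100 * (p * n ^ 2 * m) + 1 +
        ((2 * n - 1) * (p * (4 * n + 10) + 4 * n + 13) + 6 + 1 + 1)))))) ≤
      300 * (p * n ^ 2 * m) := by
  have hm : 2 ≤ m := hn.trans hnm
  have hY : p * n ^ 2 * 2 ≤ p * n ^ 2 * m := Nat.mul_le_mul_left _ hm
  have h1 : p * 4 ≤ p * n ^ 2 := Nat.mul_le_mul_left _ (by nlinarith)
  have h2 : p * (2 * n + 4) ≤ 2 * (p * n ^ 2) := by
    calc p * (2 * n + 4) ≤ p * (2 * n ^ 2) := Nat.mul_le_mul_left _ (by nlinarith)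
      _ = _ := by ring
  have h3 : p * (n * (4 * n + 4) + 6) ≤ 8 * (p * n ^ 2) := by
    calc p * (n * (4 * n + 4) + 6) ≤ p * (8 * n ^ 2) := Nat.mul_le_mul_left _ (by nlinarith)
      _ = _ := by ring
  have h4 : (2 * n - 1) * (p * (4 * n + 10) + 4 * n + 13) ≤ 34 * (p * n ^ 2) := by
    have : p * (4 * n + 10) + 4 * n + 13 ≤ p * (17 * n) := by nlinarith
    calc (2 * n - 1) * (p * (4 * n + 10) + 4 * n + 13) ≤ (2 * n) * (p * (17 * n)) :=
          Nat.mul_le_mul (by omega) this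
      _ = _ := by ring
  omega

/-- One factor 2^n of 4^n n is traded for m, which is larger exactly when this program is chosen. -/
theorem quadraticDP_time_le {p n m : ℕ} (hn : 2 ≤ n) (hp : 0 < p) (hpm : p < m) :
    p * (p * (4 * n + 10) + 12) + 1 ≤ 100 * (p * n ^ 2 * m) := by
  have h1 : p * (4 * n + 10) ≤ m * (4 * n + 10) := Nat.mul_le_mul_right _ hpm.le
  have h2 : m * (4 * n + 10) + 12 ≤ 12 * (n ^ 2 * m) := by
    have : 4 * m ≤ n ^ 2 * m := Nat.mul_le_mul_right _ (by nlinarith)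
    have : 2 * n * m ≤ n ^ 2 * m := Nat.mul_le_mul_right _ (by nlinarith)
    nlinarith
  have h3 : 1 ≤ p * n ^ 2 * m := Nat.mul_pos (by positivity) (by omega)
  calc p * (p * (4 * n + 10) + 12) + 1 ≤ p * (12 * (n ^ 2 * m)) + 1 := by
        have := Nat.mul_le_mul_left p (show p * (4 * n + 10) + 12 ≤ 12 * (n ^ 2 * m) by omega)
        omega
    _ = 12 * (p * n ^ 2 * m) + 1 := by ring
    _ ≤ _ := by omega

/-- The output, read off the abstract state. -/
def Solution (Q : Query n) (s : Store) : Prop :=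
  (∃ T : JoinTree n, T.Valid Q.graph ∧ T.rels = Finset.univ ∧
      (T.costOut Q.card : ℕ∞) = Q.optCost Finset.univ ∧
      ∀ i, (h : i < (1 :: T.costOut Q.card :: T.code).length) →
        s.inp i = (1 :: T.costOut Q.card :: T.code)[i]) ∨
    (Q.optCost Finset.univ = ⊤ ∧ s.inp 0 = 0)

/-- For m > 2^n a modulus coprime to m! need not exist in the required range, but then the quadratic
program is affordable. Both programs end with the same column of optimal costs, and the tree is
written from it. -/
theorem wp_joinOrder (Q : Query n) (hn : 2 ≤ n) (hoff : L.off = 1 + n * n + 2 ^ n)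
    (hK : L.K = Q.maxCard * n + n + 20)
    (hV : 100 + 4 * 2 ^ n + 4 * (Q.maxCard * n) + n * n ≤ L.V)
    (hin : ∀ a, s.inp a = Q.input.getD a 0) (h0 : ∀ i j k, s.mem i j k = 0) :
    WP L joinOrder (300 * (2 ^ n * n ^ 2 * (Q.maxCard * n))) s (Solution Q) := by
  classical
  have hmn : n ≤ Q.maxCard * n := Nat.le_mul_of_pos_left n (one_le_maxCard Q)
  have hp4 : 2 ^ 2 ≤ 2 ^ n := Nat.pow_le_pow_right (by norm_num) hn
  have hpn : n ≤ 2 ^ n := Nat.lt_two_pow_self.le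
  have hcard : ∀ s' : Store, s'.inp = s.inp → ∀ S < 2 ^ n, Q.Joinable (ofMask n S) →
      s'.inp (1 + n * n + S) = Q.card (ofMask n S) := by
    intro s' h S hS hJ
    rw [h, hin, input_card Q hS, cardTable, if_pos hJ]
  refine (WP.seq ((wp_setup Q hn hoff hK hV hin).imp ?_)).le_time
    (joinOrder_time_le hn hp4 hpn hmn)
  set m := Q.maxCard * n with hm
  rintro s1 ⟨hG1, hin1, hm1⟩
  refine WP.seq ((wp_powTable hG1).imp ?_)
  rintro s2 ⟨hF2, hin2, hB2, hP2⟩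
  have hG2 := hG1.of_frame hF2
  refine WP.seq ((wp_popTable hG2 hP2).imp ?_)
  rintro s3 ⟨hF3, hin3, hB3, hC3⟩
  have hG3 := hG2.of_frame hF3
  have hP3 : ∀ i < n, s3.mem i 0 4 = 2 ^ i := fun i hi => by rw [hB3 _ _ _ (by simp), hP2 i hi]
  have hin3' : s3.inp = s.inp := by rw [hin3, hin2, hin1]
  refine WP.seq ((wp_connTable Q hG3 hP3 hC3 ?_).imp ?_)
  · intro v hv u hu
    rw [hin3', hin, input_adj Q hv hu]
  rintro s4 ⟨hF4, hin4, hB4, hN4⟩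
  have hG4 := hG3.of_frame hF4
  have hC4 : ∀ S < 2 ^ n, s4.mem S 0 1 = (ofMask n S).card :=
    fun S hS => by rw [hB4 _ _ _ (by simp), hC3 S hS]
  refine WP.seq ((wp_initDP Q hG4 hC4).imp ?_)
  rintro s5 ⟨hF5, hin5, hB5, hD5⟩
  have hG5 : Glob L n m s5 := hG4.of_frame hF5
  have hC5 : ∀ S < 2 ^ n, s5.mem S 0 1 = (ofMask n S).card :=
    fun S hS => by rw [hB5 _ _ _ (by simp), hC4 S hS]
  have hP5 : ∀ i < n, s5.mem i 0 4 = 2 ^ i :=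
    fun i hi => by rw [hB5 _ _ _ (by simp), hB4 _ _ _ (by simp), hP3 i hi]
  have hN5 : ∀ S < 2 ^ n, s5.mem S 0 2 = if ConnMask Q S then 1 else 0 :=
    fun S hS => by rw [hB5 _ _ _ (by simp), hN4 S hS]
  have hin5' : s5.inp = s.inp := by rw [hin5, hin4, hin3']
  refine WP.seq (WP.imp (Q := fun s' => (∀ z < 20, z ≠ 8 → s'.reg z = s5.reg z) ∧
    s'.inp = s5.inp ∧ (∀ i k, k ≠ 3 → s'.mem i 0 k = s5.mem i 0 k) ∧
    DPCol n m Q.optCost s') ?_ ?_)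
  · refine WP.cond (100 * (2 ^ n * n ^ 2 * m)) (100 * (2 ^ n * n ^ 2 * m)) (by simp) (by simp)
      ?_ ?_
    · intro h
      simp only [eval_var, hG5.r3, hG5.r5] at h
      refine ((wp_quadraticDP Q hG5 hP5 hC5 hN5 (hcard s5 hin5') hD5).le_time
        (quadraticDP_time_le hn (by positivity) h)).imp ?_
      rintro s6 ⟨hF6, hin6, hB6, hD6⟩
      exact ⟨fun z hz _ => hF6 z hz, hin6, fun i k hk => hB6 _ _ _ (by simp [hk]), hD6⟩
    · intro h
      simp only [eval_var, hG5.r3, hG5.r5, not_lt] at h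
      refine wp_convolutionDP Q hG5 h hP5 hC5 hN5 (hcard s5 hin5') hD5 ?_
      intro i j k hj
      rw [hB5 _ _ _ (by omega), hB4 _ _ _ (by omega), hB3 _ _ _ (by omega), hB2 _ _ _ (by omega),
        hm1, h0]
  rintro s6 ⟨hF6, hin6, hm6, hD6⟩
  have hG6 : Glob L n m s6 := hG5.of_frame' hF6
  have hfull : s6.mem (2 ^ n - 1) 0 3 = code m (Q.optCost Finset.univ) := by
    rw [hD6 _ (by omega), ofMask_full]
  have hK6 := hG6.K
  have hV6 := hG6.V
  refine (WP.cond ((2 * n - 1) * (2 ^ n * (4 * n + 10) + 4 * n + 13) + 6) 1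
    (by simp [hG6.r0, hG6.r1]; omega) (by simp) ?_ ?_).le_time le_rfl
  · intro h
    simp only [eval_mem, eval_sub, eval_var, eval_ofNat, hG6.r3, hG6.r6, hfull] at h
    have hne := ((small_optCost Q Finset.univ).code_lt).1 h
    refine (wp_writeTree Q hG6 (fun i hi => by rw [hm6 _ _ (by norm_num), hP5 i hi])
      (fun S hS => by rw [hm6 _ _ (by norm_num), hC5 S hS]) hD6 hne).imp ?_
    rintro s7 ⟨T, ⟨hT1, hT2, hT3⟩, hi0, hi1, hcode⟩
    rw [ofMask_full] at hT2 hT3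
    refine Or.inl ⟨T, hT1, hT2, hT3, fun i hi => ?_⟩
    match i with
    | 0 => exact hi0
    | 1 =>
      rw [hi1, hfull, ← hT3, code_coe]
      rfl
    | i + 2 =>
      have := hcode i (by simpa using hi)
      rwa [Nat.add_comm] at this
  · intro h
    simp only [eval_mem, eval_sub, eval_var, eval_ofNat, hG6.r3, hG6.r6, hfull] at h
    rw [(small_optCost Q Finset.univ).code_lt, not_not] at h
    refine WP.setInp (by simp) (by simp) (by simp; omega) (by simp; omega) ?_
    exact Or.inr ⟨h, by simp⟩

end RAM

namespace Query
open RAM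
variable {n : ℕ}

/-- The layout of the memory for the instance `Q` on a machine with `w`-bit words. -/
noncomputable def layout (Q : Query n) (w : ℕ) (hw : 240 * (n + Nat.log 2 Q.maxCard) ≤ w) (hn : 2 ≤ n) :
    Layout where
  off := 1 + n * n + 2 ^ n
  K := Q.maxCard * n + n + 20
  V := 2 ^ (6 * (n + Nat.log 2 Q.maxCard))
  B := 2 ^ w
  hV := le_trans (by norm_num : 100 ≤ 2 ^ 12) (Nat.pow_le_pow_right (by norm_num) (by omega))
  hB := by
    rw [← pow_mul]
    exact Nat.pow_le_pow_right (by norm_num) (by omega)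

/-- Let y = 2^n · 2^(log W), with the logarithm rounded down, so that y ≥ 4. All quantities on the
left are of order at most y^2, and y^6 absorbs the constants; this is the factor 6 in the exponent
of `V`. -/
theorem layout_V_le (Q : Query n) (hn : 2 ≤ n) :
    100 + 4 * 2 ^ n + 4 * (Q.maxCard * n) + n * n + Q.maxCard ≤
      2 ^ (6 * (n + Nat.log 2 Q.maxCard)) := by
  set l := Nat.log 2 Q.maxCard
  have h1 : Q.maxCard ≤ 2 * 2 ^ l := by
    have := (Nat.lt_pow_succ_log_self (b := 2) (by norm_num) Q.maxCard).le
    rwa [pow_succ, mul_comm] at this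
  have h2 : n ≤ 2 ^ n := Nat.lt_two_pow_self.le
  have h3 : 2 ^ 2 ≤ 2 ^ n := Nat.pow_le_pow_right (by norm_num) hn
  have h4 : 1 ≤ 2 ^ l := Nat.one_le_two_pow
  have h5 : 2 ^ (6 * (n + l)) = (2 ^ n * 2 ^ l) ^ 6 := by rw [← pow_add, ← pow_mul, mul_comm]
  rw [h5]
  have h6 : Q.maxCard * n ≤ 2 * (2 ^ n * 2 ^ l) := by
    calc Q.maxCard * n ≤ 2 * 2 ^ l * 2 ^ n := Nat.mul_le_mul h1 h2
      _ = _ := by ring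
  have h7 : 2 ^ n ≤ 2 ^ n * 2 ^ l := Nat.le_mul_of_pos_right _ (by omega)
  have h8 : n * n ≤ 2 ^ n * 2 ^ l * (2 ^ n * 2 ^ l) := Nat.mul_le_mul (h2.trans h7) (h2.trans h7)
  have h9 : Q.maxCard ≤ Q.maxCard * n := Nat.le_mul_of_pos_right _ (by omega)
  generalize 2 ^ n * 2 ^ l = y at *
  have hy : 4 ≤ y := h3.trans h7
  have h10 : 4 ^ 4 * y ^ 2 ≤ y ^ 6 := by
    calc 4 ^ 4 * y ^ 2 ≤ y ^ 4 * y ^ 2 := Nat.mul_le_mul_right _ (Nat.pow_le_pow_left hy 4)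
      _ = y ^ 6 := by ring
  have h11 : 4 * y ≤ y ^ 2 := by nlinarith
  have h12 : y * y = y ^ 2 := by ring
  omega

/-- The constant is 300 · 1000, as one unit of time in `WP` stands for 1000 machine steps. -/
theorem exec_joinOrder (Q : Query n) {w : ℕ} (hw : 240 * (n + Nat.log 2 Q.maxCard) ≤ w)
    (hn : 2 ≤ n) : ∃ (t : ℕ) (s : State), Exec (2 ^ w) joinOrder Q.start t s ∧ Q.IsOutput s ∧
      t ≤ 300000 * (2 ^ n * n ^ 2 * (Q.maxCard * n)) := by
  have hV := layout_V_le Q hn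
  have h2n : 0 < 2 ^ n := by positivity
  have hnn : 2 * n ≤ n * n := Nat.mul_le_mul_right n hn
  let s0 : Store := ⟨fun _ => 0, fun a => Q.input.getD a 0, fun _ _ _ => 0⟩
  have hwp := wp_joinOrder (L := Q.layout w hw hn) (s := s0) Q hn rfl rfl
    (le_trans (Nat.le_add_right _ Q.maxCard) hV) (fun _ => rfl) fun _ _ _ => rfl
  have hVpos : 0 < 2 ^ (6 * (n + Nat.log 2 Q.maxCard)) := by positivity
  have hnle : n ≤ n * n := Nat.le_mul_of_pos_left n (by omega)
  obtain ⟨t, σ, s', hexec, ht, hsim, -, hsol⟩ := hwp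
    ⟨fun _ => hVpos, input_lt Q (V := 2 ^ (6 * (n + Nat.log 2 Q.maxCard))) (by omega) (by omega),
      fun _ _ _ => hVpos⟩ Q.start
    -- The array lies behind the input, where the memory is 0, so it represents the zero array.
    ⟨fun _ _ => rfl, fun _ _ => rfl, fun i j _ k _ =>
      List.getD_eq_default _ _ (by rw [length_input]; exact Nat.le_add_left _ _)⟩
  have hoff : (Q.layout w hw hn).off = 1 + n * n + 2 ^ n := rfl
  refine ⟨t, σ, hexec, ?_, by omega⟩
  rcases hsol with ⟨T, h1, h2, h3, h4⟩ | ⟨h1, h2⟩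
  · refine Or.inl ⟨T, h1, h2, h3, fun i hi => ?_⟩
    have hlen := h1.length_code
    rw [h2, Finset.card_univ, Fintype.card_fin] at hlen
    have hi' : i < T.code.length + 1 + 1 := hi
    have hn2n : n < 2 ^ n := Nat.lt_two_pow_self
    rw [hsim.inp i (by omega), h4 i hi]
  · refine Or.inr ⟨h1, fun i hi => ?_⟩
    have hi0 : i = 0 := by simpa using hi
    subst hi0
    rw [hsim.inp 0 (by omega), h2]
    rfl

end Query
end DPconv

end

/-! ### The main theorem -/

theorem mainTheorem2 :
    -- the layers of the fast subset convolution evaluate the `(min, +)` subset convolution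
    (∀ (n : ℕ) (f g : Finset (Fin n) → ℕ∞) (S : Finset (Fin n)),
      DPconv.fscLayerMinPlus f g S.card S = DPconv.minPlusConv f g S) ∧
    -- the layered recursion computes the optimal cost of every set of relations
    (∀ (n : ℕ) (Q : DPconv.Query n) (S : Finset (Fin n)),
      DPconv.dpTable Q n S = Q.optCost S) ∧
    -- an optimal join order is computed on a word RAM, with words of `O(n + log W)` bits, ...
    ∃ (p : DPconv.RAM.Prog) (a : ℕ),
      -- in time `O(2^n n^2 · W n log (W n))`
      (∃ C : ℝ, ∀ (n : ℕ) (Q : DPconv.Query n) (w : ℕ), 2 ≤ n →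
        a * (n + Nat.log 2 Q.maxCard) ≤ w →
        Q.SolvedWithin p w
          (C * (2 ^ n * n ^ 2 * (Q.maxCard * n * Real.log (Q.maxCard * n))))) ∧
      -- which is `2^n n^{O(1)}` when `W` is polynomially bounded in `n`
      (∀ K q : ℕ, ∃ (C : ℝ) (e : ℕ), ∀ (n : ℕ) (Q : DPconv.Query n) (w : ℕ), 2 ≤ n →
        a * (n + Nat.log 2 Q.maxCard) ≤ w → Q.maxCard ≤ K * n ^ q →
        Q.SolvedWithin p w (C * (2 ^ n * n ^ e))) := by
  -- The word length factor is 240 = 40 · 6: expressions stay below `V ^ 40`, and V = 2^(6 (n + log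
  -- W)). The constant 600000 is twice 300000, since W n ≥ 2 gives log (W n) ≥ 1/2. The exponent q +
  -- 3 collects n^2, the bound n^q of W, and one more factor n.
  refine ⟨fun n f g S => DPconv.fscLayerMinPlus_card f g S,
    fun n Q S => DPconv.dpTable_eq_optCost Q S, DPconv.RAM.joinOrder, 240, ⟨600000, ?_⟩,
    fun K q => ⟨300000 * K, q + 3, ?_⟩⟩
  · intro n Q w hn hw
    obtain ⟨t, s, h1, h2, h3⟩ := Q.exec_joinOrder hw hn
    refine ⟨t, s, h1, h2, ?_⟩
    have hm : 2 ≤ Q.maxCard * n := hn.trans (Nat.le_mul_of_pos_left n (DPconv.one_le_maxCard Q))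
    have hm' : (2 : ℝ) ≤ Q.maxCard * n := by exact_mod_cast hm
    have hlog : 1 / 2 ≤ Real.log (Q.maxCard * n) := by
      refine le_trans ?_ (Real.log_le_log (by norm_num) hm')
      linarith [Real.log_two_gt_d9]
    have h3' : (t : ℝ) ≤ 300000 * (2 ^ n * n ^ 2 * (Q.maxCard * n)) := by exact_mod_cast h3
    have h4 : (Q.maxCard * n : ℝ) ≤ 2 * (Q.maxCard * n * Real.log (Q.maxCard * n)) := by
      nlinarith
    have h5 : (2 ^ n * n ^ 2 * (Q.maxCard * n) : ℝ) ≤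
        2 ^ n * n ^ 2 * (2 * (Q.maxCard * n * Real.log (Q.maxCard * n))) :=
      mul_le_mul_of_nonneg_left h4 (by positivity)
    linarith
  · intro n Q w hn hw hK
    obtain ⟨t, s, h1, h2, h3⟩ := Q.exec_joinOrder hw hn
    refine ⟨t, s, h1, h2, ?_⟩
    have h4 : t ≤ 300000 * K * (2 ^ n * n ^ (q + 3)) := by
      calc t ≤ 300000 * (2 ^ n * n ^ 2 * (Q.maxCard * n)) := h3
        _ ≤ 300000 * (2 ^ n * n ^ 2 * (K * n ^ q * n)) := by gcongr
        _ = _ := by ring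
    exact_mod_cast h4
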